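/- **Setting.** A learner plays $K$ arms for $T$ rounds. The loss sequence $(\ell_t)_{t\le T}$, $\ell_t\in[-1,1]^K$, is a deterministic or random sequence chosen by an oblivious adversary, i.e. independently of the learner's internal randomness. In round $t$ the learner draws an arm $I_t$ and observes only $\ell_{t,I_t}$. The pseudo-regret is $R_T=\max_{a\in[K]}\mathbb E\big[\sum_{t=1}^T(\ell_{t,I_t}-\ell_{t,a})\big]$. The losses are $S$-sparse, where $1\le S\le K$: every $\ell_t$ has at most $S$ nonzero entries. For $\Delta\in[0,1]^K$ and $C\ge 0$, the adversary satisfies a $(\Delta,C,T)$ *self-bounding constraint* if every algorithm (every measurable, possibly randomized policy) has $R_T\ge\sum_{t=1}^T\sum_{i=1}^K\Delta_i\,\mathbb P(I_t=i)-C$. In this regime there is assumed to be an arm $i^*$ with $\Delta_i>0$ for all $i\ne i^*$, and $\Delta_{\min}=\min\{\Delta_i:\Delta_i>0\}$. **Algorithm.** The inputs are $K,T$ and $\alpha\in(0,1)$; the algorithm does not know $S$, $\Delta$ or $C$. Put $\beta_1=\frac{8K}{1-\alpha}$, $\gamma=\max\big(6,48\sqrt{\alpha/(1-\alpha)}\big)$,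 $d=2$, $L_0=0$. In round $t$: - let $q_t$ be the minimizer over the probability simplex of $\langle L_{t-1},p\rangle+\beta_t\frac1\alpha\big(1-\sum_ip_i^\alpha\big)-\gamma\sum_i\ln p_i$, and $p_t=(1-\frac KT)q_t+\frac1T\mathbf 1$; - draw $I_t\sim p_t$, observe $\ell_{t,I_t}$, put $\hat\ell_{t,i}=\ell_{t,i}\mathbf 1\{I_t=i\}/p_{t,i}$ and $L_t=L_{t-1}+\hat\ell_t$; - put $z_t=\min\Big(\frac{(6d)^{2-\alpha}}{2(1-\alpha)}\min(p_{t,I_t},1-p_{t,I_t})^{2-\alpha}\hat\ell_{t,I_t}^2,\ \frac{18d^2\beta_t}{\gamma}\ell_{t,I_t}^2\Big)$, $h_t=\frac1\alpha\big(\sum_ip_{t,i}^\alpha-1\big)$ and $\beta_{t+1}=\beta_t+\frac{z_t}{\beta_th_t}$. Write $$A=\sqrt{\frac{(K^{1-\alpha}-1)S^\alpha T}{\alpha(1-\alpha)}},\qquad M=\frac{(K-1)^{1-\alpha}S^\alpha}{\alpha(1-\alpha)},\qquad B=\frac{M\ln T}{\Delta_{\min}}+\sqrt{C\,\frac{M\ln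 T}{\Delta_{\min}}}+\sqrt M,$$ $$\Lambda=\gamma K\ln T+\frac{\beta_1(K^{1-\alpha}-1)}{\alpha}\qquad\text{(lower-order terms)}.$$ **Theorem.** There is an absolute constant $c>0$ such that the following hold for all $K\ge4$, $T\ge 4K$, $1\le S\le K$ and all oblivious adversaries with $S$-sparse losses in $[-1,1]$. 1. For every $\alpha\in(0,1)$, the algorithm is a well-defined (measurable) randomized policy, and simultaneously - $R_T\le c\,(A+\Lambda)$ in the adversarial regime; - $R_T\le c\,(B+\Lambda)$ under a $(\Delta,C,T)$ self-bounding constraint. 2. For every $K\ge 4$ and $\alpha\in(0,1)$ there are $T_0$ and $\delta_0>0$, depending only on $K$ and $\alpha$, such that $R_T\le c\,A$ whenever $T\ge T_0$, and $R_T\le c\,B$ under a $(\Delta,C,T)$ self-bounding constraint with $\Delta_{\min}\le\delta_0$. 3. For $\alpha=1-\frac1{2\ln K}$: $R_T\le c\big(\sqrt{ST\ln K}+K\ln K\ln T\big)$, and under a $(\Delta,C,T)$ self-bounding constraint $R_T\le c\Big(\frac{S\ln K\ln T}{\Delta_{\min}}+\sqrt{C\,\frac{S\ln K\ln T}{\Delta_{\min}}}+K\ln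 K\ln T\Big)$. 4. If $S$ is known and $e^2S\le K$, then for $\alpha=1-\frac1{\ln(K/S)}$: $R_T\le c\big(\sqrt{ST\ln(K/S)}+\Lambda\big)$. -/

import Mathlib

open MeasureTheory
open scoped BigOperators

noncomputable section

namespace SparseBandit

/-! ## Bandit problems with an oblivious, possibly randomized adversary

The losses of `T` rounds form a random element of `Fin T → Fin K → ℝ`, whose law `μ` is the
adversary. It is drawn independently of the learner's internal randomness. Rounds are numbered from
`0`. -/

/-- The arms drawn and the losses observed in the first `t` rounds. -/
abbrev History (K t : ℕ) : Type := Fin t → Fin K × ℝ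

/-- A (randomized) bandit policy: `π t h i` is the probability of drawing arm `i` in the round that
follows the history `h` of the first `t` rounds. -/
abbrev Policy (K : ℕ) : Type := ∀ t : ℕ, History K t → Fin K → ℝ

/-- A policy is a bandit algorithm for horizon `T` if in each round it returns a probability vector
that depends measurably on the history. -/
structure IsAlgorithm {K : ℕ} (T : ℕ) (π : Policy K) : Prop where
  mem_simplex : ∀ t < T, ∀ h : History K t, π t h ∈ stdSimplex ℝ (Fin K)
  measurable : ∀ t < T, Measurable (π t)

/-- What the learner has seen before round `t`, if the losses are `l` and the arms are `I`. -/
def historyBefore {K T : ℕ} (l : Fin T → Fin K → ℝ) (I : Fin T → Fin K) (t : Fin T) :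
    History K t :=
  fun s => (I (Fin.castLE t.isLt.le s), l (Fin.castLE t.isLt.le s) (I (Fin.castLE t.isLt.le s)))

/-- The probability that the policy `π` draws the arms `I` when the losses are `l`. -/
def drawProb {K T : ℕ} (π : Policy K) (l : Fin T → Fin K → ℝ) (I : Fin T → Fin K) : ℝ :=
  ∏ t : Fin T, π t (historyBefore l I t) (I t)

/-- Expectation of `f losses arms` over the losses (with law `μ`) and the learner's draws. -/
def expect {K T : ℕ} (π : Policy K) (μ : Measure (Fin T → Fin K → ℝ))
    (f : (Fin T → Fin K → ℝ) → (Fin T → Fin K) → ℝ) : ℝ :=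
  ∫ l, ∑ I : Fin T → Fin K, drawProb π l I * f l I ∂μ

/-- The regret `R_{T,a}` with respect to arm `a`. -/
def regretAgainst {K T : ℕ} (π : Policy K) (μ : Measure (Fin T → Fin K → ℝ)) (a : Fin K) : ℝ :=
  expect π μ fun l I => ∑ t : Fin T, (l t (I t) - l t a)

/-- The pseudo-regret `R_T = max_a R_{T,a}`. -/
def regret {K T : ℕ} (π : Policy K) (μ : Measure (Fin T → Fin K → ℝ)) : ℝ :=
  ⨆ a : Fin K, regretAgainst π μ a

/-- The probability `P(I_t = i)`. -/
def armProb {K T : ℕ} (π : Policy K) (μ : Measure (Fin T → Fin K → ℝ)) (t : Fin T) (i : Fin K) :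
    ℝ :=
  expect π μ fun _ I => if I t = i then 1 else 0

/-- Signed sparse losses: almost surely all losses lie in `[-1, 1]` and every loss vector has at
most `S` nonzero entries. -/
def HasSparseLosses {K T : ℕ} (S : ℕ) (μ : Measure (Fin T → Fin K → ℝ)) : Prop :=
  ∀ᵐ l ∂μ, ∀ t : Fin T, (∀ i : Fin K, |l t i| ≤ 1) ∧ {i : Fin K | l t i ≠ 0}.ncard ≤ S

/-- The adversarial regime with a `(Δ, C, T)` self-bounding constraint. -/
structure SelfBounding {K T : ℕ} (Δ : Fin K → ℝ) (C : ℝ) (μ : Measure (Fin T → Fin K → ℝ)) :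
    Prop where
  gap_mem : ∀ i, Δ i ∈ Set.Icc (0 : ℝ) 1
  nonneg : 0 ≤ C
  le_regret : ∀ π : Policy K, IsAlgorithm T π →
    ∑ t : Fin T, ∑ i : Fin K, Δ i * armProb π μ t i - C ≤ regret π μ

/-- The smallest positive gap. -/
def gapMin {K : ℕ} (Δ : Fin K → ℝ) : ℝ := sInf {x : ℝ | ∃ i, 0 < Δ i ∧ Δ i = x}

/-! ## The algorithm -/

/-- The Tsallis entropy regularizer `ψ_TE(p) = (1/α)(1 - ∑ p_i^α)`. -/
def psiTE {K : ℕ} (α : ℝ) (p : Fin K → ℝ) : ℝ := 1 / α * (1 - ∑ i, p i ^ α)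

/-- The log-barrier function, meant for vectors with positive entries. -/
def psiLB {K : ℕ} (p : Fin K → ℝ) : ℝ := -∑ i, Real.log (p i)

/-- The FTRL objective with cumulative loss estimate `L` and learning rate `β`. -/
def objective {K : ℕ} (α γ β : ℝ) (L p : Fin K → ℝ) : ℝ :=
  ∑ i, L i * p i + β * psiTE α p + γ * psiLB p

/-- The points of the simplex at which the log-barrier is finite. -/
def posSimplex (K : ℕ) : Set (Fin K → ℝ) := {p | p ∈ stdSimplex ℝ (Fin K) ∧ ∀ i, 0 < p i}

/-- `q` minimizes the FTRL objective over the simplex. The objective is `+∞` at points of the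
simplex with a zero entry, so that the minimum is taken over the positive ones. -/
def IsFTRLMin {K : ℕ} (α γ β : ℝ) (L q : Fin K → ℝ) : Prop :=
  q ∈ posSimplex K ∧ ∀ p ∈ posSimplex K, objective α γ β L q ≤ objective α γ β L p

/-- One coordinate of the FTRL objective. -/
def coordObj (α γ β c x : ℝ) : ℝ := c * x - β / α * x ^ α - γ * Real.log x

theorem objective_eq {K : ℕ} (α γ β : ℝ) (L p : Fin K → ℝ) :
    objective α γ β L p = ∑ i, coordObj α γ β (L i) (p i) + β / α := by
  simp only [objective, psiTE, psiLB, coordObj, Finset.sum_sub_distrib, ← Finset.mul_sum]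
  ring

theorem strictConvexOn_coordObj {α γ β : ℝ} (hα : 0 < α) (hα' : α < 1) (hγ : 0 < γ) (hβ : 0 ≤ β)
    (c : ℝ) : StrictConvexOn ℝ (Set.Ioi 0) (coordObj α γ β c) := by
  refine ⟨convex_Ioi 0, fun x hx y hy hxy a b ha hb hab => ?_⟩
  have h1 := strictConcaveOn_log_Ioi.2 hx hy hxy ha hb hab
  have h2 := (Real.concaveOn_rpow hα.le hα'.le).2 (Set.mem_Ici.2 (le_of_lt hx))
    (Set.mem_Ici.2 (le_of_lt hy)) ha.le hb.le hab
  simp only [smul_eq_mul] at h1 h2 ⊢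
  have h3 := mul_lt_mul_of_pos_left h1 hγ
  have h4 := mul_le_mul_of_nonneg_left h2 (div_nonneg hβ hα.le)
  simp only [coordObj]
  nlinarith [h3, h4]

theorem existsUnique_isFTRLMin {K : ℕ} (hK : 0 < K) {α γ β : ℝ} (hα : 0 < α) (hα' : α < 1)
    (hγ : 0 < γ) (hβ : 0 ≤ β) (L : Fin K → ℝ) : ∃! q, IsFTRLMin α γ β L q := by
  have hK' : (0 : ℝ) < K := by exact_mod_cast hK
  set B : ℝ := ∑ i, (|L i| + β / α) with hB
  set u : Fin K → ℝ := fun _ => 1 / (K : ℝ) with hu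
  set F : ℝ := ∑ i, coordObj α γ β (L i) (u i) with hF
  set ε : ℝ := min (Real.exp (-((F + B) / γ))) (1 / K) with hε
  have hε0 : 0 < ε := lt_min (Real.exp_pos _) (by positivity)
  have husim : u ∈ stdSimplex ℝ (Fin K) := by
    refine ⟨fun _ => by positivity, ?_⟩
    simp [hu, hK'.ne']
  set A : Set (Fin K → ℝ) := stdSimplex ℝ (Fin K) ∩ {p | ∀ i, ε ≤ p i} with hA
  have hAc : IsCompact A := by
    refine (isCompact_stdSimplex ℝ (Fin K)).inter_right ?_
    simp only [Set.ofPred_forall]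
    exact isClosed_iInter fun i => isClosed_le continuous_const (continuous_apply i)
  have huA : u ∈ A := ⟨husim, fun _ => min_le_right _ _⟩
  have hcont : ContinuousOn (fun p : Fin K → ℝ => ∑ i, coordObj α γ β (L i) (p i)) A := by
    refine continuousOn_finsetSum _ fun i _ => ?_
    have hi : ContinuousOn (fun p : Fin K → ℝ => p i) A := (continuous_apply i).continuousOn
    have hne : ∀ p ∈ A, p i ≠ 0 := fun p hp => (hε0.trans_le (hp.2 i)).ne'
    exact ((continuousOn_const.mul hi).sub (continuousOn_const.mul
      (hi.rpow_const fun p hp => Or.inl (hne p hp)))).sub (continuousOn_const.mul (hi.log hne))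
  obtain ⟨q, hqA, hq⟩ := hAc.exists_isMinOn ⟨u, huA⟩ hcont
  have hqpos : q ∈ posSimplex K := ⟨hqA.1, fun i => hε0.trans_le (hqA.2 i)⟩
  have hmin : ∀ p ∈ posSimplex K,
      ∑ i, coordObj α γ β (L i) (q i) ≤ ∑ i, coordObj α γ β (L i) (p i) := by
    intro p hp
    by_cases hpA : p ∈ A
    · exact hq hpA
    have hle1 : ∀ i, p i ≤ 1 := fun i =>
      hp.1.2 ▸ Finset.single_le_sum (fun j _ => hp.1.1 j) (Finset.mem_univ i)
    obtain ⟨j, hj⟩ : ∃ j, p j < ε := by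
      by_contra hcon
      push Not at hcon
      exact hpA ⟨hp.1, hcon⟩
    have hlog : F + B ≤ -(γ * Real.log (p j)) := by
      have h1 : p j ≤ Real.exp (-((F + B) / γ)) := hj.le.trans (min_le_left _ _)
      have h2 : Real.log (p j) ≤ -((F + B) / γ) := by
        rw [← Real.log_exp (-((F + B) / γ))]
        exact Real.log_le_log (hp.2 j) h1
      have h3 := mul_le_mul_of_nonneg_left h2 hγ.le
      have h4 : γ * -((F + B) / γ) = -(F + B) := by field_simp
      linarith
    have hlow : ∀ i, 0 ≤ coordObj α γ β (L i) (p i) + (|L i| + β / α) + γ * Real.log (p i) := by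
      intro i
      have h1 : p i ^ α ≤ 1 := Real.rpow_le_one (hp.2 i).le (hle1 i) hα.le
      have h2 := mul_le_mul_of_nonneg_left h1 (div_nonneg hβ hα.le)
      have h3 : -|L i| ≤ L i * p i := by
        have := neg_abs_le (L i * p i)
        rw [abs_mul, abs_of_pos (hp.2 i)] at this
        nlinarith [abs_nonneg (L i), hle1 i]
      simp only [coordObj]
      linarith
    have hneg : ∀ i, γ * Real.log (p i) ≤ 0 := fun i =>
      mul_nonpos_of_nonneg_of_nonpos hγ.le (Real.log_nonpos (hp.2 i).le (hle1 i))
    have hsum : -(γ * Real.log (p j)) ≤ ∑ i, (coordObj α γ β (L i) (p i) + (|L i| + β / α)) := by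
      refine le_trans ?_ (Finset.single_le_sum (f := fun i =>
        coordObj α γ β (L i) (p i) + (|L i| + β / α)) (fun i _ => ?_) (Finset.mem_univ j))
      · linarith [hlow j]
      · have := hlow i
        have := hneg i
        linarith
    rw [Finset.sum_add_distrib, ← hB] at hsum
    have : ∑ i, coordObj α γ β (L i) (q i) ≤ F := hq huA
    linarith
  refine ⟨q, ⟨hqpos, fun p hp => ?_⟩, fun p hp => ?_⟩
  · rw [objective_eq, objective_eq]
    linarith [hmin p hp]
  · by_contra hne
    obtain ⟨j, hj⟩ : ∃ j, p j ≠ q j := Function.ne_iff.1 hne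
    set m : Fin K → ℝ := fun i => (1 / 2 : ℝ) * p i + (1 / 2 : ℝ) * q i with hm
    have hmpos : m ∈ posSimplex K := by
      refine ⟨⟨fun i => ?_, ?_⟩, fun i => ?_⟩
      · have := hp.1.2 i
        have := hqpos.2 i
        simp only [hm]
        positivity
      · simp only [hm, Finset.sum_add_distrib, ← Finset.mul_sum, hp.1.1.2, hqpos.1.2]
        norm_num
      · have := hp.1.2 i
        have := hqpos.2 i
        simp only [hm]
        positivity
    have hconv : ∀ i, StrictConvexOn ℝ (Set.Ioi 0) (coordObj α γ β (L i)) := fun i =>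
      strictConvexOn_coordObj hα hα' hγ hβ (L i)
    have hlt : ∑ i, coordObj α γ β (L i) (m i)
        < ∑ i, ((1 / 2 : ℝ) * coordObj α γ β (L i) (p i)
          + (1 / 2 : ℝ) * coordObj α γ β (L i) (q i)) := by
      refine Finset.sum_lt_sum (fun i _ => ?_) ⟨j, Finset.mem_univ j, ?_⟩
      · exact (hconv i).convexOn.2 (hp.1.2 i) (hqpos.2 i) (by norm_num) (by norm_num)
          (by norm_num)
      · exact (hconv j).2 (hp.1.2 j) (hqpos.2 j) hj (by norm_num) (by norm_num) (by norm_num)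
    rw [Finset.sum_add_distrib, ← Finset.mul_sum, ← Finset.mul_sum] at hlt
    have h1 := hmin m hmpos
    have h2 := hp.2 q hqpos
    rw [objective_eq, objective_eq] at h2
    linarith

/-- The minimizer of the FTRL objective; it exists and is unique by `existsUnique_isFTRLMin`. -/
def ftrlMin {K : ℕ} (α γ β : ℝ) (L : Fin K → ℝ) : Fin K → ℝ :=
  Classical.epsilon (IsFTRLMin α γ β L)

/-- The initial learning rate `β₁`. -/
def beta1 (K : ℕ) (α : ℝ) : ℝ := 8 * K / (1 - α)

/-- The weight `γ` of the log-barrier. -/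
def gam (α : ℝ) : ℝ := max 6 (48 * √(α / (1 - α)))

/-- The sampling distribution: `q_t` mixed with uniform exploration. -/
def samplingProb (K T : ℕ) (α β : ℝ) (L : Fin K → ℝ) : Fin K → ℝ :=
  fun i => (1 - (K : ℝ) / T) * ftrlMin α (gam α) β L i + 1 / T

/-- The importance-weighted loss estimate, if arm `i` was drawn from `p` and had loss `x`. -/
def lossEstimate {K : ℕ} (p : Fin K → ℝ) (i : Fin K) (x : ℝ) : Fin K → ℝ :=
  fun j => if i = j then x / p j else 0

/-- The real-time stability term `z_t` (with `d = 2`), if arm `i` was drawn from `p` and had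
loss `x`. -/
def stability {K : ℕ} (α β : ℝ) (p : Fin K → ℝ) (i : Fin K) (x : ℝ) : ℝ :=
  min ((6 * 2) ^ (2 - α) / (2 * (1 - α)) * min (p i) (1 - p i) ^ (2 - α)
        * lossEstimate p i x i ^ 2)
      (β * (18 * 2 ^ 2) / gam α * x ^ 2)

/-- The penalty term `h_t`. -/
def penalty {K : ℕ} (α : ℝ) (p : Fin K → ℝ) : ℝ := 1 / α * (∑ i, p i ^ α - 1)

/-- The cumulative loss estimate and the learning rate after a given history. -/
def state (K T : ℕ) (α : ℝ) : ∀ t : ℕ, History K t → (Fin K → ℝ) × ℝ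
  | 0, _ => (0, beta1 K α)
  | t + 1, h =>
    let L := (state K T α t (Fin.init h)).1
    let β := (state K T α t (Fin.init h)).2
    let i := (h (Fin.last t)).1
    let x := (h (Fin.last t)).2
    let p := samplingProb K T α β L
    (L + lossEstimate p i x, β + stability α β p i x / (β * penalty α p))

/-- FTRL with Tsallis entropy, log-barrier and real-time stability-penalty matching. It is told
`K`, `T` and `α`, but no property of the losses. -/
def spmAlgorithm (K T : ℕ) (α : ℝ) : Policy K :=
  fun t h => samplingProb K T α (state K T α t h).2 (state K T α t h).1

/-! ## The rates -/

/-- The leading term of the adversarial bound. -/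
def advRate (K S T : ℕ) (α : ℝ) : ℝ :=
  √(((K : ℝ) ^ (1 - α) - 1) * (S : ℝ) ^ α * T / (α * (1 - α)))

/-- The terms of the bound under a self-bounding constraint, with minimal gap `δ`. -/
def selfBoundingRate (K S T : ℕ) (α δ C : ℝ) : ℝ :=
  ((K : ℝ) - 1) ^ (1 - α) * (S : ℝ) ^ α * Real.log T / (α * (1 - α) * δ)
    + √(C * (((K : ℝ) - 1) ^ (1 - α) * (S : ℝ) ^ α * Real.log T / (α * (1 - α) * δ)))
    + √(((K : ℝ) - 1) ^ (1 - α) * (S : ℝ) ^ α / (α * (1 - α)))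

/-- The lower-order terms: they contain neither `√T` nor `ln T / Δ_min`. -/
def lowerOrder (K T : ℕ) (α : ℝ) : ℝ :=
  gam α * K * Real.log T + beta1 K α * ((K : ℝ) ^ (1 - α) - 1) / α

end SparseBandit

end

open SparseBandit

namespace SparseBandit

/-! ## Inequalities for powers and logarithms -/

/-! Write `g_t = z_t / β_t`, so that `β_{t+1} = β_t + g_t / h_t`. The learning rate is designed so
that in each round the price of raising it, `(β_{t+1} - β_t) h_t = g_t`, equals the stability cost
`g_t` of the loss estimate. The proof reduces the regret to `E ∑ g_t` and then bounds this sum in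
two ways.

Reduction (`round_le`, `pathExp_regret_le`). The leader `q_t` is an interior point, so the FTRL
objective exceeds its minimum exactly by a Bregman divergence (`IsFTRLMin.objective_eq_add`). The
Tsallis divergence and half of the log-barrier divergence pay for the loss estimate, at the price
`g_t` (`sum_lossEstimate_mul_sub_le`); the other half pays for the second-order effect of the new
learning rate (`objective_step`). The log-barrier is what permits losses of either sign. Telescoping
and adding the cost of exploration gives `R_T ≤ 4K + Λ + 3 E ∑ g_t`.

The sum of the `g_t`. Over rounds with `h_t ≤ U`, the sum `s` of the `g_t` is at most `U β`, hence
`s ^ 2` grows by at most `12 g_t + 2 U z_t` per round, and `s ≤ 12 + √(2 U ∑ z_t)`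
(`sum_filter_le_of_penalty_le`). With `U` the maximal penalty this is the adversarial bound.
Exploration keeps `h_t` within a factor `T` of its maximum, so splitting the rounds into `O(ln T)`
dyadic levels of `h_t` and applying Cauchy-Schwarz gives `O(ln T) + O(√(ln T ∑ z_t h_t))`
(`sum_le_of_penalty_levels`).

Sparsity. Arms with zero loss have `z_t = 0`. Jensen's inequality over the at most `S` other arms
bounds the conditional mean of `z_t` by a multiple of `S ^ α b ^ (1 - α) / (1 - α)` with `b ≥ ∑
min(p_i, 1 - p_i)`. Here `b = 1` serves the adversarial regime; `b = 2 (1 - p_{i*})`, together with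
`h_t ≤ (K-1) ^ (1-α) (1 - p_{i*}) ^ α / α`, makes `z_t h_t` linear in `1 - p_{i*}`
(`sum_mul_stability_mul_penalty_le`). So `R_T ≤ O(Λ) + O(√(M ln T · N))`, where `N` is the expected
number of draws of other arms. The self-bounding constraint gives `Δ_min N ≤ R_T + C`, and solving
for `R_T` yields the second bound. -/

theorem sum_rpow_le_card_rpow_mul {ι : Type*} (s : Finset ι) {r : ℝ} (hr : 0 < r) (hr1 : r ≤ 1)
    (x : ι → ℝ) (hx : ∀ i ∈ s, 0 ≤ x i) :
    ∑ i ∈ s, x i ^ r ≤ (s.card : ℝ) ^ (1 - r) * (∑ i ∈ s, x i) ^ r := by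
  rcases s.eq_empty_or_nonempty with rfl | hs
  · simp [Real.zero_rpow hr.ne']
  have hn : (0 : ℝ) < s.card := by exact_mod_cast hs.card_pos
  have h := (Real.concaveOn_rpow hr.le hr1).le_map_sum (t := s) (w := fun _ => 1 / (s.card : ℝ))
    (p := x) (fun _ _ => by positivity) (by simp [hn.ne']) (fun i hi => hx i hi)
  simp only [smul_eq_mul, ← Finset.mul_sum] at h
  rw [Real.mul_rpow (by positivity) (Finset.sum_nonneg hx), one_div,
    Real.inv_rpow hn.le] at h
  have h2 := mul_le_mul_of_nonneg_left h hn.le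
  rw [Real.rpow_sub hn, Real.rpow_one]
  calc ∑ i ∈ s, x i ^ r = s.card * ((s.card : ℝ)⁻¹ * ∑ i ∈ s, x i ^ r) := by field_simp
    _ ≤ _ := h2
    _ = _ := by ring

theorem sum_rpow_le_rpow_sum {ι : Type*} (s : Finset ι) {r : ℝ} (hr : 1 ≤ r)
    (x : ι → ℝ) (hx : ∀ i ∈ s, 0 ≤ x i) : ∑ i ∈ s, x i ^ r ≤ (∑ i ∈ s, x i) ^ r := by
  have hX : 0 ≤ ∑ i ∈ s, x i := Finset.sum_nonneg hx
  have key : ∀ y : ℝ, 0 ≤ y → y ^ r = y * y ^ (r - 1) := fun y hy => by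
    rw [← Real.rpow_one_add' hy (by linarith)]
    ring_nf
  rw [key _ hX, Finset.sum_mul]
  refine Finset.sum_le_sum fun i hi => ?_
  rw [key _ (hx i hi)]
  exact mul_le_mul_of_nonneg_left (Real.rpow_le_rpow (hx i hi)
    (Finset.single_le_sum hx hi) (by linarith)) (hx i hi)

/-- The left side is the convex conjugate of the log-barrier divergence; it becomes the price of a
loss in `mul_sub_le_bregLB`. -/
theorem sub_log_one_add_le {r : ℝ} (hr : -(1 / 2) ≤ r) : r - Real.log (1 + r) ≤ 2 * r ^ 2 := by
  have h1 : 0 < 1 + r := by linarith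
  have h := Real.one_sub_inv_le_log_of_pos h1
  have h2 : r - (1 - (1 + r)⁻¹) = r ^ 2 / (1 + r) := by field_simp; ring
  have h3 : r ^ 2 / (1 + r) ≤ 2 * r ^ 2 := by
    rw [div_le_iff₀ h1]
    nlinarith [sq_nonneg r]
  linarith

/-- Bernoulli's inequality for `y⁻¹` with exponent `1 - α`, then `1 / y ≥ 1 / 4`. This and the next
lemma give the sign of a derivative in `sq_le_tsallis_divergence`. -/
theorem sub_mul_sub_le_one_sub_rpow {α y : ℝ} (hα : 0 < α) (hα' : α < 1) (hy : 1 ≤ y)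
    (hy4 : y ≤ 4) : (1 - α) / 4 * (y - 1) ≤ 1 - y ^ (α - 1) := by
  have hy0 : 0 < y := by linarith
  have h := rpow_one_add_le_one_add_mul_self (s := y⁻¹ - 1) (p := 1 - α)
    (by linarith [inv_pos.2 hy0]) (by linarith) (by linarith)
  rw [show 1 + (y⁻¹ - 1) = y⁻¹ by ring, Real.inv_rpow hy0.le, ← Real.rpow_neg hy0.le,
    neg_sub] at h
  have h2 : (1 - α) / 4 * (y - 1) ≤ (1 - α) * (1 - y⁻¹) := by
    rw [div_mul_eq_mul_div, mul_div_assoc]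
    refine mul_le_mul_of_nonneg_left ?_ (by linarith)
    rw [show 1 - y⁻¹ = (y - 1) / y by field_simp]
    exact div_le_div_of_nonneg_left (by linarith) hy0 hy4
  linarith

theorem one_sub_rpow_le_sub_mul_sub {α y : ℝ} (hα : 0 < α) (hα' : α < 1) (hy0 : 0 < y)
    (hy : y ≤ 1) : 1 - y ^ (α - 1) ≤ (1 - α) / 4 * (y - 1) := by
  have h := rpow_one_add_le_one_add_mul_self (s := y - 1) (p := 1 - α)
    (by linarith) (by linarith) (by linarith)
  rw [show 1 + (y - 1) = y by ring] at h
  have hp : 0 < y ^ (1 - α) := Real.rpow_pos_of_pos hy0 _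
  have h3 : y ^ (α - 1) = (y ^ (1 - α))⁻¹ := by rw [← Real.rpow_neg hy0.le, neg_sub]
  have h4 : 1 + (1 - α) * (1 - y) ≤ (y ^ (1 - α))⁻¹ := by
    rw [le_inv_comm₀ (by nlinarith) hp]
    refine h.trans ?_
    rw [← one_div, le_div_iff₀ (by nlinarith)]
    nlinarith [sq_nonneg ((1 - α) * (1 - y))]
  rw [h3]
  nlinarith

/-- The difference of the two sides vanishes at `1`, decreases before it and increases after it. The
range must be bounded because the divergence grows only linearly at infinity. -/
theorem sq_le_tsallis_divergence {α y : ℝ} (hα : 0 < α) (hα' : α < 1) (hy0 : 0 < y)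
    (hy4 : y ≤ 4) : (1 - α) / 8 * (y - 1) ^ 2 ≤ (1 - y ^ α) / α + y - 1 := by
  set φ : ℝ → ℝ := fun y => (1 - y ^ α) / α + y - 1 - (1 - α) / 8 * (y - 1) ^ 2 with hφ
  have hd : ∀ y : ℝ, 0 < y → HasDerivAt φ (1 - y ^ (α - 1) - (1 - α) / 4 * (y - 1)) y := by
    intro y hy
    have h1 : HasDerivAt (fun y : ℝ => y ^ α) (α * y ^ (α - 1)) y :=
      Real.hasDerivAt_rpow_const (Or.inl hy.ne')
    have h2 := ((((h1.const_sub 1).div_const α).add (hasDerivAt_id y)).sub_const 1).sub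
      ((((hasDerivAt_id y).sub_const 1).pow 2).const_mul ((1 - α) / 8))
    refine (h2.congr_deriv ?_)
    simp only [id]
    field_simp
    ring
  have hφ1 : φ 1 = 0 := by simp [hφ]
  suffices 0 ≤ φ y by simp only [hφ] at this; linarith
  rw [← hφ1]
  rcases le_total y 1 with h | h
  · have : AntitoneOn φ (Set.Ioc 0 1) := by
      refine antitoneOn_of_deriv_nonpos (convex_Ioc 0 1)
        (fun x hx => (hd x hx.1).continuousAt.continuousWithinAt)
        (fun x hx => ?_) (fun x hx => ?_)
      · rw [interior_Ioc] at hx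
        exact (hd x hx.1).differentiableAt.differentiableWithinAt
      · rw [interior_Ioc] at hx
        rw [(hd x hx.1).deriv]
        linarith [one_sub_rpow_le_sub_mul_sub hα hα' hx.1 hx.2.le]
    exact this ⟨hy0, h⟩ ⟨one_pos, le_rfl⟩ h
  · have : MonotoneOn φ (Set.Icc 1 4) := by
      refine monotoneOn_of_deriv_nonneg (convex_Icc 1 4)
        (fun x hx => (hd x (by linarith [hx.1])).continuousAt.continuousWithinAt)
        (fun x hx => ?_) (fun x hx => ?_)
      · rw [interior_Icc] at hx
        exact (hd x (by linarith [hx.1])).differentiableAt.differentiableWithinAt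
      · rw [interior_Icc] at hx
        rw [(hd x (by linarith [hx.1])).deriv]
        linarith [sub_mul_sub_le_one_sub_rpow hα hα' hx.1.le hx.2.le]
    exact this ⟨le_rfl, by norm_num⟩ ⟨h, hy4⟩ h

/-! ## Bregman divergences of the two regularizers, coordinate by coordinate -/

/-- The Bregman divergence of `x ↦ -x ^ α / α`. -/
noncomputable def bregTE (α x q : ℝ) : ℝ := (q ^ α - x ^ α) / α + q ^ (α - 1) * (x - q)

/-- The Bregman divergence of `-log`. -/
noncomputable def bregLB (x q : ℝ) : ℝ := x / q - 1 - Real.log (x / q)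

theorem bregLB_nonneg {x q : ℝ} (hx : 0 < x) (hq : 0 < q) : 0 ≤ bregLB x q := by
  have := Real.log_le_sub_one_of_pos (div_pos hx hq)
  simp only [bregLB]
  linarith

/-- With `u = √(x / q)` the divergence is `u ^ 2 - 1 - 2 log u ≥ (u - 1) ^ 2`. This strong convexity
serves only to show that the leader depends continuously on its parameters. -/
theorem sq_sub_le_bregLB {x q : ℝ} (hx : 0 < x) (hq : 0 < q) (hx1 : x ≤ 1) (hq1 : q ≤ 1) :
    (x - q) ^ 2 / 4 ≤ bregLB x q := by
  have hs : 0 < √x := Real.sqrt_pos.2 hx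
  have ht : 0 < √q := Real.sqrt_pos.2 hq
  have hs1 : √x ≤ 1 := Real.sqrt_le_one.2 hx1
  have ht1 : √q ≤ 1 := Real.sqrt_le_one.2 hq1
  have hx' : x = √x ^ 2 := (Real.sq_sqrt hx.le).symm
  have hq' : q = √q ^ 2 := (Real.sq_sqrt hq.le).symm
  have h1 := Real.log_le_sub_one_of_pos (div_pos hs ht)
  have h2 : Real.log (x / q) = 2 * Real.log (√x / √q) := by
    rw [← Real.sqrt_div' _ hq.le, Real.log_sqrt (by positivity)]
    ring
  simp only [bregLB, h2]
  set s := √x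
  set t := √q
  have h3 : (s - t) ^ 2 ≤ (s / t - 1) ^ 2 := by
    rw [show s / t - 1 = (s - t) / t by field_simp, div_pow]
    exact le_div_self (sq_nonneg _) (by positivity) (pow_le_one₀ ht.le ht1)
  have h4 : x / q = (s / t) ^ 2 := by rw [hx', hq', div_pow]
  have h5 : (x - q) ^ 2 / 4 ≤ (s - t) ^ 2 := by
    rw [hx', hq', show (s ^ 2 - t ^ 2) ^ 2 / 4 = (s - t) ^ 2 * ((s + t) / 2) ^ 2 by ring]
    exact mul_le_of_le_one_right (sq_nonneg _) (pow_le_one₀ (by positivity) (by linarith))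
  rw [h4]
  nlinarith

theorem bregTE_eq {α x q : ℝ} (hx : 0 < x) (hq : 0 < q) :
    bregTE α x q = q ^ α * ((1 - (x / q) ^ α) / α + x / q - 1) := by
  rw [bregTE, Real.div_rpow hx.le hq.le, Real.rpow_sub_one hq.ne']
  have := Real.rpow_pos_of_pos hq α
  field_simp
  ring

theorem bregTE_nonneg {α x q : ℝ} (hα : 0 < α) (hα' : α < 1) (hx : 0 < x) (hq : 0 < q) :
    0 ≤ bregTE α x q := by
  rw [bregTE_eq hx hq]
  refine mul_nonneg (Real.rpow_nonneg hq.le _) ?_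
  have hy : 0 < x / q := div_pos hx hq
  have h := rpow_one_add_le_one_add_mul_self (s := x / q - 1) (p := α)
    (by linarith) hα.le hα'.le
  rw [show 1 + (x / q - 1) = x / q by ring] at h
  have h2 : -(x / q - 1) ≤ (1 - (x / q) ^ α) / α := by
    rw [le_div_iff₀ hα]
    linarith
  linarith

theorem le_bregTE {α x q : ℝ} (hα : 0 < α) (hα' : α < 1) (hx : 0 < x) (hq : 0 < q)
    (hxq : x ≤ 4 * q) : (1 - α) / 8 * q ^ (α - 2) * (x - q) ^ 2 ≤ bregTE α x q := by
  rw [bregTE_eq hx hq]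
  have h := sq_le_tsallis_divergence hα hα' (div_pos hx hq) ((div_le_iff₀ hq).2 hxq)
  refine le_trans (le_of_eq ?_) (mul_le_mul_of_nonneg_left h (Real.rpow_nonneg hq.le α))
  rw [Real.rpow_sub hq, Real.rpow_two]
  field_simp

/-- The log-barrier alone controls a loss `v`. -/
theorem mul_sub_le_bregLB {γ v x q : ℝ} (hγ : 0 < γ) (hx : 0 < x) (hq : 0 < q)
    (hv : |v| * q ≤ γ / 4) : v * (q - x) ≤ γ / 2 * bregLB x q + 4 * v ^ 2 * q ^ 2 / γ := by
  set r : ℝ := 2 * (v * q) / γ with hr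
  have hvq : |v * q| ≤ γ / 4 := by rwa [abs_mul, abs_of_pos hq]
  have hr1 : -(1 / 2) ≤ r := by
    rw [hr, le_div_iff₀ hγ]
    linarith [neg_abs_le (v * q)]
  have hy : 0 < x / q := div_pos hx hq
  have h1 := sub_log_one_add_le hr1
  -- Fenchel-Young: this tangent inequality at `(1 + r) (x / q)` splits into the divergence of `x /
  -- q` and the conjugate `r - log (1 + r)`.
  have h2 := Real.log_le_sub_one_of_pos (mul_pos (show 0 < 1 + r by linarith) hy)
  rw [Real.log_mul (by linarith) hy.ne'] at h2
  have h3 : r * (1 - x / q) ≤ bregLB x q + 2 * r ^ 2 := by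
    simp only [bregLB]
    linarith
  have h4 := mul_le_mul_of_nonneg_left h3 (show 0 ≤ γ / 2 by positivity)
  have h5 : γ / 2 * (r * (1 - x / q)) = v * (q - x) := by
    rw [hr]
    field_simp
  have h6 : γ / 2 * (2 * r ^ 2) = 4 * v ^ 2 * q ^ 2 / γ := by
    rw [hr]
    field_simp
    ring
  linarith

/-- Tangent line at `4`. The slope `5 / 9` is what makes `3 (y - 1 - log y) ≥ 4 / 3 (y - 1)`. -/
theorem log_le_of_four_le {y : ℝ} (hy : 4 ≤ y) : Real.log y ≤ 5 / 9 * (y - 1) := by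
  have h1 := Real.log_le_sub_one_of_pos (show 0 < y / 4 by linarith)
  have h2 : Real.log y = Real.log (y / 4) + 2 * Real.log 2 := by
    rw [Real.log_div (by linarith) (by norm_num),
      show (4 : ℝ) = 2 ^ 2 by norm_num, Real.log_pow]
    push_cast
    ring
  linarith [Real.log_two_lt_d9]

/-- The Tsallis entropy, helped by the log-barrier, controls a loss `v`. -/
theorem mul_sub_le_bregTE {α β γ v x q : ℝ} (hα : 0 < α) (hα' : α < 1) (hβ : 0 < β)
    (hγ : 6 ≤ γ) (hx : 0 < x) (hq : 0 < q) (hv : |v| * q ≤ 4 / 3) :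
    v * (q - x) ≤ β * bregTE α x q + γ / 2 * bregLB x q
      + 2 * v ^ 2 * q ^ (2 - α) / (β * (1 - α)) := by
  have hα1 : 0 < 1 - α := by linarith
  have hqa : 0 < q ^ (2 - α) := Real.rpow_pos_of_pos hq _
  rcases le_total x (4 * q) with h | h
  · have h1 := mul_le_mul_of_nonneg_left (le_bregTE hα hα' hx hq h) hβ.le
    have h2 := mul_nonneg (show 0 ≤ γ / 2 by linarith) (bregLB_nonneg hx hq)
    have h3 : q ^ (α - 2) = (q ^ (2 - α))⁻¹ := by rw [← Real.rpow_neg hq.le, neg_sub]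
    set A := q ^ (2 - α)
    set B := β * (1 - α) with hB
    have hBpos : 0 < B := mul_pos hβ hα1
    -- Near `q` the Tsallis divergence is quadratic, and completing the square gives the price.
    have h4 : v * (q - x) ≤ B / (8 * A) * (x - q) ^ 2 + 2 * v ^ 2 * A / B := by
      have : B / (8 * A) * (x - q) ^ 2 + 2 * v ^ 2 * A / B - v * (q - x)
          = (B * (x - q) + 4 * v * A) ^ 2 / (8 * A * B) := by
        field_simp
        ring
      have h5 : 0 ≤ (B * (x - q) + 4 * v * A) ^ 2 / (8 * A * B) := by positivity
      linarith
    rw [h3] at h1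
    have h6 : β * ((1 - α) / 8 * A⁻¹ * (x - q) ^ 2) = B / (8 * A) * (x - q) ^ 2 := by
      rw [hB]
      field_simp
    linarith
  -- Far from `q` the quadratic bound fails; the log-barrier, with weight `γ / 2 ≥ 3`, absorbs the
  -- whole loss at no price.
  · have hy : 4 ≤ x / q := by rwa [le_div_iff₀ hq]
    have h1 := log_le_of_four_le hy
    have h2 : 4 / 3 * (x / q - 1) ≤ 3 * bregLB x q := by
      simp only [bregLB]
      linarith
    have h3 : v * (q - x) ≤ 4 / 3 * (x / q - 1) := by
      have h4 : v * (q - x) ≤ |v| * q * (x / q - 1) := by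
        rw [show |v| * q * (x / q - 1) = |v| * (x - q) by field_simp]
        have := neg_abs_le v
        nlinarith
      exact h4.trans (mul_le_mul_of_nonneg_right hv (by linarith))
    have h4 := mul_nonneg hβ.le (bregTE_nonneg hα hα' hx hq)
    have h5 := mul_le_mul_of_nonneg_right (show 3 ≤ γ / 2 by linarith) (bregLB_nonneg hx hq)
    have h6 : 0 ≤ 2 * v ^ 2 * q ^ (2 - α) / (β * (1 - α)) := by positivity
    linarith

/-! ## Follow the regularized leader -/

theorem posSimplex_le_one {K : ℕ} {p : Fin K → ℝ} (hp : p ∈ posSimplex K) (i : Fin K) :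
    p i ≤ 1 :=
  hp.1.2 ▸ Finset.single_le_sum (fun j _ => hp.1.1 j) (Finset.mem_univ i)

theorem ftrlMin_spec {K : ℕ} (hK : 0 < K) {α γ β : ℝ} (hα : 0 < α) (hα' : α < 1)
    (hγ : 0 < γ) (hβ : 0 ≤ β) (L : Fin K → ℝ) : IsFTRLMin α γ β L (ftrlMin α γ β L) :=
  Classical.epsilon_spec (existsUnique_isFTRLMin hK hα hα' hγ hβ L).exists

theorem hasDerivAt_coordObj {α γ β c x : ℝ} (hα : 0 < α) (hx : 0 < x) :
    HasDerivAt (coordObj α γ β c) (c - β * x ^ (α - 1) - γ / x) x := by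
  have h1 : HasDerivAt (fun y : ℝ => y ^ α) (α * x ^ (α - 1)) x :=
    Real.hasDerivAt_rpow_const (Or.inl hx.ne')
  have h2 := (((hasDerivAt_id x).const_mul c).sub (h1.const_mul (β / α))).sub
    ((Real.hasDerivAt_log hx.ne').const_mul γ)
  refine h2.congr_deriv ?_
  field_simp

/-- First-order optimality of the minimizer. -/
theorem IsFTRLMin.sum_deriv_eq_zero {K : ℕ} {α γ β : ℝ} {L q p : Fin K → ℝ}
    (hq : IsFTRLMin α γ β L q) (hα : 0 < α) (hp : p ∈ posSimplex K) :
    ∑ i, (L i - β * q i ^ (α - 1) - γ / q i) * (p i - q i) = 0 := by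
  set ψ : ℝ → ℝ := fun s => ∑ i, coordObj α γ β (L i) (q i + s * (p i - q i)) with hψ
  have hd : HasDerivAt ψ (∑ i, (L i - β * q i ^ (α - 1) - γ / q i) * (p i - q i)) 0 := by
    refine HasDerivAt.fun_sum fun i _ => ?_
    have h1 : HasDerivAt (fun s : ℝ => q i + s * (p i - q i)) (p i - q i) 0 := by
      simpa using ((hasDerivAt_id (0 : ℝ)).mul_const (p i - q i)).const_add (q i)
    have h2 : HasDerivAt (coordObj α γ β (L i)) (L i - β * q i ^ (α - 1) - γ / q i)
        (q i + 0 * (p i - q i)) := by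
      simpa using hasDerivAt_coordObj hα (hq.1.2 i)
    exact h2.comp (0 : ℝ) h1
  refine IsLocalMin.hasDerivAt_eq_zero (f := ψ) (a := 0) ?_ hd
  -- The minimizer has positive entries, so the segment can be prolonged beyond it and `0` is a
  -- two-sided local minimum.
  have hpos : ∀ᶠ s : ℝ in nhds 0, ∀ i, 0 < q i + s * (p i - q i) := by
    rw [Filter.eventually_all]
    intro i
    have : ContinuousAt (fun s : ℝ => q i + s * (p i - q i)) 0 := by fun_prop
    exact this.eventually_const_lt (by simpa using hq.1.2 i)
  filter_upwards [hpos] with s hs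
  have hmem : (fun i => q i + s * (p i - q i)) ∈ posSimplex K := by
    refine ⟨⟨fun i => (hs i).le, ?_⟩, hs⟩
    rw [Finset.sum_add_distrib, ← Finset.mul_sum, Finset.sum_sub_distrib, hp.1.2, hq.1.1.2]
    ring
  have h := hq.2 _ hmem
  rw [objective_eq, objective_eq] at h
  simp only [hψ, zero_mul, add_zero]
  linarith

/-- The linear term of the expansion at `q` vanishes by first-order optimality; the remainder of a
separable function is a sum of Bregman divergences, so this is an identity. -/
theorem IsFTRLMin.objective_eq_add {K : ℕ} {α γ β : ℝ} {L q p : Fin K → ℝ}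
    (hq : IsFTRLMin α γ β L q) (hα : 0 < α) (hp : p ∈ posSimplex K) :
    objective α γ β L p = objective α γ β L q
      + ∑ i, (β * bregTE α (p i) (q i) + γ * bregLB (p i) (q i)) := by
  have h := hq.sum_deriv_eq_zero hα hp
  rw [objective_eq, objective_eq]
  have : ∀ i, coordObj α γ β (L i) (p i) = coordObj α γ β (L i) (q i)
      + (β * bregTE α (p i) (q i) + γ * bregLB (p i) (q i))
      + (L i - β * q i ^ (α - 1) - γ / q i) * (p i - q i) := by
    intro i
    have h1 := hp.2 i
    have h2 := hq.1.2 i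
    simp only [coordObj, bregTE, bregLB, Real.log_div h1.ne' h2.ne']
    field_simp
    ring
  rw [Finset.sum_congr rfl fun i _ => this i, Finset.sum_add_distrib, Finset.sum_add_distrib, h]
  ring

theorem penalty_eq_neg_psiTE {K : ℕ} (α : ℝ) (p : Fin K → ℝ) : penalty α p = -psiTE α p := by
  simp only [penalty, psiTE]
  ring

theorem sum_rpow_sub {K : ℕ} {α : ℝ} {p : Fin K → ℝ} (hp : p ∈ stdSimplex ℝ (Fin K)) :
    ∑ i, p i ^ α - 1 = ∑ i, (p i ^ α - p i) := by
  rw [Finset.sum_sub_distrib, hp.2]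

theorem rpow_sub_self_nonneg {α x : ℝ} (hα' : α < 1) (hx : 0 < x) (hx1 : x ≤ 1) :
    0 ≤ x ^ α - x := by
  have := Real.rpow_le_rpow_of_exponent_ge hx hx1 hα'.le
  rw [Real.rpow_one] at this
  linarith

theorem penalty_nonneg {K : ℕ} {α : ℝ} (hα : 0 < α) (hα' : α < 1) {p : Fin K → ℝ}
    (hp : p ∈ posSimplex K) : 0 ≤ penalty α p := by
  rw [penalty, sum_rpow_sub hp.1]
  exact mul_nonneg (by positivity) (Finset.sum_nonneg fun i _ =>
    rpow_sub_self_nonneg hα' (hp.2 i) (posSimplex_le_one hp i))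

/-- Concavity of the penalty. The constant `-1` costs nothing since the increments sum to zero; it
makes the weights nonnegative, and the products with `q i` then sum to `α * penalty α q`. -/
theorem penalty_le_add {K : ℕ} {α : ℝ} (hα : 0 < α) (hα' : α < 1) {p q : Fin K → ℝ}
    (hp : p ∈ posSimplex K) (hq : q ∈ posSimplex K) :
    penalty α p ≤ penalty α q + ∑ i, (q i ^ (α - 1) - 1) * (p i - q i) := by
  have h1 : ∑ i, (p i - q i) = 0 := by rw [Finset.sum_sub_distrib, hp.1.2, hq.1.2, sub_self]
  have h2 : 0 ≤ ∑ i, bregTE α (p i) (q i) :=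
    Finset.sum_nonneg fun i _ => bregTE_nonneg hα hα' (hp.2 i) (hq.2 i)
  have h3 : penalty α q + ∑ i, (q i ^ (α - 1) - 1) * (p i - q i) - penalty α p
      = ∑ i, bregTE α (p i) (q i) - ∑ i, (p i - q i) := by
    simp only [penalty, bregTE, sub_mul, Finset.sum_sub_distrib, Finset.sum_add_distrib,
      ← Finset.sum_div, one_mul]
    ring
  linarith

/-- The effect of one round on the minimal value of the objective. -/
theorem objective_step {K : ℕ} {α γ β δ s : ℝ} (hα : 0 < α) (hα' : α < 1) (hγ : 0 < γ)
    (hδ : 0 ≤ δ) {L v q x : Fin K → ℝ} (hq : IsFTRLMin α γ β L q) (hx : x ∈ posSimplex K)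
    (hs : ∑ i, v i * (q i - x i)
      ≤ ∑ i, (β * bregTE α (x i) (q i) + γ / 2 * bregLB (x i) (q i)) + s)
    (hh : δ * (α * penalty α q) ≤ γ / 4) :
    ∑ i, v i * q i + objective α γ β L q - objective α γ (β + δ) (L + v) x
      ≤ s + δ * penalty α q + 4 * (δ * (α * penalty α q)) ^ 2 / γ := by
  have hqp := hq.1
  have h1 := hq.objective_eq_add hα hx
  have h2 := mul_le_mul_of_nonneg_left (penalty_le_add hα hα' hx hqp) hδ
  have h3 : objective α γ (β + δ) (L + v) x
      = objective α γ β L x + ∑ i, v i * x i - δ * penalty α x := by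
    simp only [objective, penalty_eq_neg_psiTE, Pi.add_apply, add_mul, Finset.sum_add_distrib]
    ring
  have hαh : α * penalty α q = ∑ i, (q i ^ α - q i) := by
    rw [penalty, sum_rpow_sub hqp.1]
    field_simp
  have hnn : ∀ i, 0 ≤ q i ^ α - q i := fun i =>
    rpow_sub_self_nonneg hα' (hqp.2 i) (posSimplex_le_one hqp i)
  have hle : ∀ i, q i ^ α - q i ≤ α * penalty α q := fun i => by
    rw [hαh]
    exact Finset.single_le_sum (fun j _ => hnn j) (Finset.mem_univ i)
  have hmul : ∀ i, (q i ^ (α - 1) - 1) * q i = q i ^ α - q i := fun i => by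
    rw [sub_mul, one_mul, Real.rpow_sub_one (hqp.2 i).ne', div_mul_cancel₀ _ (hqp.2 i).ne']
  have hg : ∀ i, 0 ≤ q i ^ (α - 1) - 1 := fun i =>
    nonneg_of_mul_nonneg_left (by rw [hmul]; exact hnn i) (hqp.2 i)
  -- The change of the learning rate acts as one more loss vector, charged to the unused half of the
  -- log-barrier.
  have h4 : ∀ i, -(δ * (q i ^ (α - 1) - 1)) * (q i - x i) ≤ γ / 2 * bregLB (x i) (q i)
      + 4 * (δ * (q i ^ α - q i)) ^ 2 / γ := by
    intro i
    have h5 := mul_sub_le_bregLB (v := -(δ * (q i ^ (α - 1) - 1))) hγ (hx.2 i) (hqp.2 i) (by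
      rw [abs_neg, abs_of_nonneg (mul_nonneg hδ (hg i)), mul_assoc, hmul]
      exact (mul_le_mul_of_nonneg_left (hle i) hδ).trans hh)
    rw [← hmul i]
    convert h5 using 3
    ring
  have h6 := Finset.sum_le_sum fun i (_ : i ∈ Finset.univ) => h4 i
  have h7 : ∑ i, 4 * (δ * (q i ^ α - q i)) ^ 2 / γ ≤ 4 * (δ * (α * penalty α q)) ^ 2 / γ := by
    rw [← Finset.sum_div, ← Finset.mul_sum]
    refine div_le_div_of_nonneg_right (mul_le_mul_of_nonneg_left ?_ (by norm_num)) hγ.le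
    rw [hαh, Finset.mul_sum]
    exact Finset.sum_sq_le_sq_sum_of_nonneg fun i _ => mul_nonneg hδ (hnn i)
  have h8 : ∑ i, -(δ * (q i ^ (α - 1) - 1)) * (q i - x i)
      = δ * ∑ i, (q i ^ (α - 1) - 1) * (x i - q i) := by
    rw [Finset.mul_sum]
    exact Finset.sum_congr rfl fun i _ => by ring
  have h9 : ∑ i, v i * (q i - x i) = ∑ i, v i * q i - ∑ i, v i * x i := by
    simp only [mul_sub, Finset.sum_sub_distrib]
  have h10 : ∑ i, (β * bregTE α (x i) (q i) + γ * bregLB (x i) (q i))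
      = ∑ i, (β * bregTE α (x i) (q i) + γ / 2 * bregLB (x i) (q i))
        + ∑ i, γ / 2 * bregLB (x i) (q i) := by
    rw [← Finset.sum_add_distrib]
    exact Finset.sum_congr rfl fun i _ => by ring
  rw [Finset.sum_add_distrib] at h6
  linarith

/-! ## The stability term -/

theorem sum_lossEstimate_mul {K : ℕ} (p w : Fin K → ℝ) (I : Fin K) (x : ℝ) :
    ∑ j, lossEstimate p I x j * w j = x / p I * w I := by
  simp [lossEstimate, ite_mul]

/-- Explains the constant `6 d = 12` of the stability term: it leaves room for passing from `q` to
`4 / 3` times the sampling distribution. -/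
theorem four_mul_rpow_le_twelve_rpow {α : ℝ} (hα' : α < 1) :
    4 * (4 / 3 : ℝ) ^ (2 - α) ≤ (6 * 2) ^ (2 - α) := by
  have h : (6 * 2 : ℝ) = 9 * (4 / 3) := by norm_num
  rw [h, Real.mul_rpow (by norm_num) (by norm_num)]
  refine mul_le_mul_of_nonneg_right ?_ (by positivity)
  calc (4 : ℝ) ≤ 9 ^ (1 : ℝ) := by norm_num
    _ ≤ _ := Real.rpow_le_rpow_of_exponent_le (by norm_num) (by linarith)

theorem stability_div {K : ℕ} {α β : ℝ} (hβ : 0 < β) (p : Fin K → ℝ) (I : Fin K) (x : ℝ) :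
    stability α β p I x / β = min ((6 * 2) ^ (2 - α) / (2 * (1 - α))
      * min (p I) (1 - p I) ^ (2 - α) * (x / p I) ^ 2 / β) (72 / gam α * x ^ 2) := by
  rw [stability, ← min_div_div_right hβ.le]
  simp only [lossEstimate, if_true]
  congr 1
  field_simp
  ring

theorem six_le_gam (α : ℝ) : 6 ≤ gam α := le_max_left _ _

/-- The stability term bounds the effect of the loss estimate. -/
theorem sum_lossEstimate_mul_sub_le {K : ℕ} {α β : ℝ} (hα : 0 < α) (hα' : α < 1) (hβ : 0 < β)
    {p q x : Fin K → ℝ} (hp : p ∈ posSimplex K) (hq : q ∈ posSimplex K) (hx : x ∈ posSimplex K)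
    (hqp : ∀ i, q i ≤ 4 / 3 * p i) (I : Fin K) {l : ℝ} (hl : |l| ≤ 1) :
    ∑ j, lossEstimate p I l j * (q j - x j)
      ≤ ∑ i, (β * bregTE α (x i) (q i) + gam α / 2 * bregLB (x i) (q i))
        + stability α β p I l / β := by
  have hγ := six_le_gam α
  set γ := gam α with hγdef
  have hα1 : 0 < 1 - α := by linarith
  have hpI := hp.2 I
  have hqI := hq.2 I
  have hD : ∀ i, 0 ≤ β * bregTE α (x i) (q i) + γ / 2 * bregLB (x i) (q i) := fun i =>
    add_nonneg (mul_nonneg hβ.le (bregTE_nonneg hα hα' (hx.2 i) (hq.2 i)))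
      (mul_nonneg (by linarith) (bregLB_nonneg (hx.2 i) (hq.2 i)))
  have hDI := Finset.single_le_sum (fun i _ => hD i) (Finset.mem_univ I)
  rw [sum_lossEstimate_mul, stability_div hβ, ← sub_le_iff_le_add']
  set v := l / p I with hv
  have hvp : |v| * p I ≤ 1 := by
    rwa [hv, abs_div, abs_of_pos hpI, div_mul_cancel₀ _ hpI.ne']
  have hvq : |v| * q I ≤ 4 / 3 := by
    have := mul_le_mul_of_nonneg_left (hqp I) (abs_nonneg v)
    linarith
  have hconst : ∀ m Q : ℝ, 0 ≤ m → 0 ≤ Q → Q ≤ 4 / 3 * m →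
      2 * v ^ 2 * Q ^ (2 - α) / (β * (1 - α))
        ≤ (6 * 2) ^ (2 - α) / (2 * (1 - α)) * m ^ (2 - α) * v ^ 2 / β := by
    intro m Q hm hQ hQm
    have h1 := Real.rpow_le_rpow hQ hQm (show 0 ≤ 2 - α by linarith)
    rw [Real.mul_rpow (by norm_num) hm] at h1
    have h2 := mul_le_mul_of_nonneg_right (four_mul_rpow_le_twelve_rpow hα')
      (Real.rpow_nonneg hm (2 - α))
    rw [mul_assoc] at h2
    have h3 := (mul_le_mul_of_nonneg_left h1 (show (0 : ℝ) ≤ 4 by norm_num)).trans h2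
    have h4 : 2 * v ^ 2 * Q ^ (2 - α) / (β * (1 - α))
        = (4 * Q ^ (2 - α)) * (v ^ 2 / (2 * (1 - α) * β)) := by
      field_simp
      ring
    rw [h4]
    refine (mul_le_mul_of_nonneg_right h3 (by positivity)).trans (le_of_eq ?_)
    field_simp
  refine le_min ?_ ?_
  · rcases le_total (p I) (1 - p I) with h | h
    · rw [min_eq_left h]
      have h1 := mul_sub_le_bregTE hα hα' hβ hγ (hx.2 I) hqI hvq
      have h2 := hconst (p I) (q I) hpI.le hqI.le (hqp I)
      linarith
    -- When arm `I` has at least half of the mass, a loss `v` on it is equivalent to `-v` on every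
    -- other arm, because differences of probability vectors sum to zero. The price then involves
    -- only the small masses.
    · rw [min_eq_right h]
      have hm : 0 ≤ 1 - p I := by linarith [posSimplex_le_one hp I]
      have hcompl : ∀ y : Fin K → ℝ, y ∈ posSimplex K →
          ∑ j ∈ Finset.univ.erase I, y j = 1 - y I := fun y hy => by
        rw [← hy.1.2, ← Finset.add_sum_erase _ _ (Finset.mem_univ I)]
        ring
      have h1 : v * (q I - x I) = ∑ j ∈ Finset.univ.erase I, -v * (q j - x j) := by
        rw [← Finset.mul_sum, Finset.sum_sub_distrib, hcompl q hq, hcompl x hx]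
        ring
      have hv2 : |v| ≤ 2 := by
        have := mul_le_mul_of_nonneg_left (show 1 / 2 ≤ p I by linarith) (abs_nonneg v)
        linarith
      have h2 : ∀ j ∈ Finset.univ.erase I, -v * (q j - x j)
          ≤ (β * bregTE α (x j) (q j) + γ / 2 * bregLB (x j) (q j))
            + 2 * v ^ 2 / (β * (1 - α)) * q j ^ (2 - α) := by
        intro j hj
        have hpj : p j ≤ 1 - p I := by
          rw [← hcompl p hp]
          exact Finset.single_le_sum (fun i _ => (hp.2 i).le) hj
        have hqj : q j ≤ 2 / 3 := by linarith [hqp j]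
        have h3 := mul_sub_le_bregTE (v := -v) hα hα' hβ hγ (hx.2 j) (hq.2 j) (by
          rw [abs_neg]
          nlinarith [abs_nonneg v, hq.2 j])
        rw [neg_sq] at h3
        refine h3.trans (le_of_eq ?_)
        ring
      have h3 := Finset.sum_le_sum h2
      rw [← h1, Finset.sum_add_distrib, ← Finset.mul_sum] at h3
      have h4 : ∑ j ∈ Finset.univ.erase I, (β * bregTE α (x j) (q j) + γ / 2 * bregLB (x j) (q j))
          ≤ ∑ i, (β * bregTE α (x i) (q i) + γ / 2 * bregLB (x i) (q i)) :=
        Finset.sum_le_sum_of_subset_of_nonneg (Finset.erase_subset _ _) fun i _ _ => hD i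
      have h5 := sum_rpow_le_rpow_sum (Finset.univ.erase I) (show 1 ≤ 2 - α by linarith) q
        fun i _ => (hq.2 i).le
      rw [hcompl q hq] at h5
      have h6 := mul_le_mul_of_nonneg_left h5
        (show 0 ≤ 2 * v ^ 2 / (β * (1 - α)) by positivity)
      have h7 : 1 - q I ≤ 4 / 3 * (1 - p I) := by
        rw [← hcompl q hq, ← hcompl p hp, Finset.mul_sum]
        exact Finset.sum_le_sum fun i _ => hqp i
      have h8 := hconst (1 - p I) (1 - q I) hm (by linarith [posSimplex_le_one hq I]) h7
      rw [mul_div_right_comm] at h8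
      linarith
  -- The second entry of the minimum comes from the log-barrier alone: `4 (4 / 3) ^ 2 ≤ 72`.
  · have h1 := mul_sub_le_bregLB (show 0 < γ by linarith) (hx.2 I) hqI
      (show |v| * q I ≤ γ / 4 by linarith)
    have h2 : 4 * v ^ 2 * q I ^ 2 / γ ≤ 72 / γ * l ^ 2 := by
      rw [div_mul_eq_mul_div]
      refine div_le_div_of_nonneg_right ?_ (by linarith)
      have h3 := pow_le_pow_left₀ hqI.le (hqp I) 2
      have h4 : v ^ 2 * p I ^ 2 = l ^ 2 := by rw [hv]; field_simp
      nlinarith [mul_le_mul_of_nonneg_left h3 (sq_nonneg v), sq_nonneg l]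
    have h3 := mul_nonneg hβ.le (bregTE_nonneg hα hα' (hx.2 I) hqI)
    linarith

/-! ## The penalty and the sampling distribution -/

/-- The largest value of the penalty, attained by the uniform distribution. -/
noncomputable def maxPenalty (K : ℕ) (α : ℝ) : ℝ := ((K : ℝ) ^ (1 - α) - 1) / α

theorem maxPenalty_pos {K : ℕ} (hK : 2 ≤ K) {α : ℝ} (hα : 0 < α) (hα' : α < 1) :
    0 < maxPenalty K α := by
  have : (1 : ℝ) < (K : ℝ) ^ (1 - α) :=
    Real.one_lt_rpow (by exact_mod_cast hK) (by linarith)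
  exact div_pos (by linarith) hα

theorem penalty_le_maxPenalty {K : ℕ} {α : ℝ} (hα : 0 < α) (hα' : α < 1) {p : Fin K → ℝ}
    (hp : p ∈ posSimplex K) : penalty α p ≤ maxPenalty K α := by
  have h := sum_rpow_le_card_rpow_mul Finset.univ hα hα'.le p fun i _ => (hp.2 i).le
  rw [hp.1.2, Real.one_rpow, mul_one, Finset.card_univ, Fintype.card_fin] at h
  rw [penalty, maxPenalty, one_div_mul_eq_div]
  exact div_le_div_of_nonneg_right (by linarith) hα.le

/-- The term `p i ^ α ≤ 1` of the distinguished arm cancels the `-1`; Jensen's inequality handles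
the other `K - 1` arms. -/
theorem penalty_le_of_arm {K : ℕ} {α : ℝ} (hα : 0 < α) (hα' : α < 1) {p : Fin K → ℝ}
    (hp : p ∈ posSimplex K) (i : Fin K) :
    penalty α p ≤ ((K : ℝ) - 1) ^ (1 - α) * (1 - p i) ^ α / α := by
  have h := sum_rpow_le_card_rpow_mul (Finset.univ.erase i) hα hα'.le p fun i _ => (hp.2 i).le
  have hs : ∑ j ∈ Finset.univ.erase i, p j = 1 - p i := by
    rw [← hp.1.2, ← Finset.add_sum_erase _ _ (Finset.mem_univ i)]
    ring
  have hK : 1 ≤ K := i.pos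
  rw [hs, Finset.card_erase_of_mem (Finset.mem_univ i), Finset.card_univ, Fintype.card_fin,
    Nat.cast_sub hK, Nat.cast_one] at h
  have h1 : p i ^ α ≤ 1 := Real.rpow_le_one (hp.2 i).le (posSimplex_le_one hp i) hα.le
  rw [penalty, one_div_mul_eq_div, ← Finset.add_sum_erase _ _ (Finset.mem_univ i)]
  exact div_le_div_of_nonneg_right (by linarith) hα.le

/-- Some arm has mass at most `1 / K`, and its contribution `p i (p i ^ (α - 1) - 1)` suffices.
Hence all penalties lie within a factor `T` of each other, which limits the number of dyadic levels.
-/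
theorem maxPenalty_div_le_penalty {K T : ℕ} (hK : 2 ≤ K) {α : ℝ} (hα : 0 < α) (hα' : α < 1)
    {p : Fin K → ℝ} (hp : p ∈ posSimplex K) (hpT : ∀ i, 1 / (T : ℝ) ≤ p i) :
    maxPenalty K α / T ≤ penalty α p := by
  have hK0 : (0 : ℝ) < K := by exact_mod_cast (by omega : 0 < K)
  obtain ⟨i, hi⟩ : ∃ i, p i ≤ 1 / (K : ℝ) := by
    by_contra! h
    have h1 := Finset.sum_lt_sum_of_nonempty (s := (Finset.univ : Finset (Fin K)))
      ⟨⟨0, by omega⟩, Finset.mem_univ _⟩ fun i _ => h i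
    rw [hp.1.2] at h1
    simp [hK0.ne'] at h1
  have hpi := hp.2 i
  have h1 : (K : ℝ) ^ (1 - α) ≤ p i ^ (α - 1) := by
    have := Real.rpow_le_rpow_of_nonpos hpi hi (show α - 1 ≤ 0 by linarith)
    rwa [one_div, Real.inv_rpow hK0.le, ← Real.rpow_neg hK0.le, neg_sub] at this
  have h2 : p i ^ α - p i = p i * (p i ^ (α - 1) - 1) := by
    rw [Real.rpow_sub_one hpi.ne']
    field_simp
  have h3 : 0 ≤ (K : ℝ) ^ (1 - α) - 1 := by
    have := maxPenalty_pos hK hα hα'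
    rw [maxPenalty, lt_div_iff₀ hα] at this
    linarith
  have h4 : 1 / (T : ℝ) * ((K : ℝ) ^ (1 - α) - 1) ≤ p i ^ α - p i := by
    rw [h2]
    exact mul_le_mul (hpT i) (by linarith) h3 hpi.le
  have h5 := Finset.single_le_sum (fun j _ => rpow_sub_self_nonneg hα' (hp.2 j)
    (posSimplex_le_one hp j)) (Finset.mem_univ i)
  rw [penalty, sum_rpow_sub hp.1, maxPenalty, one_div_mul_eq_div, div_right_comm]
  refine div_le_div_of_nonneg_right ?_ hα.le
  rw [← one_div_mul_eq_div]
  linarith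

/-- Mixing with uniform exploration. -/
noncomputable def mixUniform (K T : ℕ) (q : Fin K → ℝ) : Fin K → ℝ :=
  fun i => (1 - (K : ℝ) / T) * q i + 1 / T

theorem div_le_quarter {K T : ℕ} (hK : 0 < K) (hT : 4 * K ≤ T) :
    0 < (T : ℝ) ∧ 0 < (K : ℝ) ∧ (K : ℝ) / T ≤ 1 / 4 := by
  have hT0 : (0 : ℝ) < T := by exact_mod_cast (by omega : 0 < T)
  refine ⟨hT0, by exact_mod_cast hK, ?_⟩
  rw [div_le_iff₀ hT0]
  have : (4 * K : ℝ) ≤ T := by exact_mod_cast hT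
  linarith

theorem one_div_le_mixUniform {K T : ℕ} (hK : 0 < K) (hT : 4 * K ≤ T)
    {q : Fin K → ℝ} (hq : q ∈ stdSimplex ℝ (Fin K)) (i : Fin K) :
    1 / (T : ℝ) ≤ mixUniform K T q i := by
  obtain ⟨_, _, h⟩ := div_le_quarter hK hT
  have := mul_nonneg (show 0 ≤ 1 - (K : ℝ) / T by linarith) (hq.1 i)
  simp only [mixUniform]
  linarith

theorem mixUniform_mem {K T : ℕ} (hK : 0 < K) (hT : 4 * K ≤ T)
    {q : Fin K → ℝ} (hq : q ∈ stdSimplex ℝ (Fin K)) :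
    mixUniform K T q ∈ posSimplex K := by
  obtain ⟨hT0, _, h⟩ := div_le_quarter hK hT
  have hpos : ∀ i, 0 < mixUniform K T q i := fun i =>
    lt_of_lt_of_le (by positivity) (one_div_le_mixUniform hK hT hq i)
  refine ⟨⟨fun i => (hpos i).le, ?_⟩, hpos⟩
  simp only [mixUniform, Finset.sum_add_distrib, ← Finset.mul_sum, hq.2, Finset.sum_const,
    Finset.card_univ, Fintype.card_fin, nsmul_eq_mul]
  ring

theorem le_mixUniform {K T : ℕ} (hK : 0 < K) (hT : 4 * K ≤ T)
    {q : Fin K → ℝ} (hq : q ∈ stdSimplex ℝ (Fin K)) (i : Fin K) :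
    q i ≤ 4 / 3 * mixUniform K T q i := by
  obtain ⟨hT0, _, h⟩ := div_le_quarter hK hT
  have := mul_le_mul_of_nonneg_right h (hq.1 i)
  have h2 : 0 < 1 / (T : ℝ) := by positivity
  simp only [mixUniform]
  linarith

/-- The learning rate uses the penalty of the sampling distribution, the analysis that of the
leader. By concavity mixing retains a fraction `1 - K / T ≥ 3 / 4` of the penalty. -/
theorem penalty_le_mixUniform {K T : ℕ} (hK : 0 < K) (hT : 4 * K ≤ T)
    {α : ℝ} (hα : 0 < α) (hα' : α < 1) {q : Fin K → ℝ}
    (hq : q ∈ posSimplex K) : penalty α q ≤ 4 / 3 * penalty α (mixUniform K T q) := by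
  obtain ⟨hT0, hK0, h⟩ := div_le_quarter hK hT
  have h1 : ∀ i, (1 - (K : ℝ) / T) * q i ^ α + K / T * (1 / K) ^ α ≤ mixUniform K T q i ^ α := by
    intro i
    have := (Real.concaveOn_rpow hα.le hα'.le).2 (Set.mem_Ici.2 (hq.2 i).le)
      (Set.mem_Ici.2 (show (0 : ℝ) ≤ 1 / K by positivity)) (show 0 ≤ 1 - (K : ℝ) / T by linarith)
      (show 0 ≤ (K : ℝ) / T by positivity) (by ring)
    simp only [smul_eq_mul] at this
    rwa [show (K : ℝ) / T * (1 / K) = 1 / T by field_simp] at this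
  have h2 := Finset.sum_le_sum fun i (_ : i ∈ Finset.univ) => h1 i
  rw [Finset.sum_add_distrib, ← Finset.mul_sum, Finset.sum_const, Finset.card_univ,
    Fintype.card_fin, nsmul_eq_mul] at h2
  have h3 : (1 : ℝ) ≤ K * (1 / K) ^ α := by
    have hK1 : (1 / (K : ℝ)) ≤ 1 := by
      rw [div_le_one hK0]
      exact_mod_cast hK
    have := Real.rpow_le_rpow_of_exponent_ge (show (0 : ℝ) < 1 / K by positivity) hK1 hα'.le
    rw [Real.rpow_one] at this
    calc (1 : ℝ) = K * (1 / K) := by field_simp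
      _ ≤ _ := mul_le_mul_of_nonneg_left this hK0.le
  have h4 : 0 ≤ ∑ i, q i ^ α - 1 := by
    have := penalty_nonneg hα hα' hq
    rw [penalty, one_div_mul_eq_div, le_div_iff₀ hα] at this
    linarith
  have h5 := mul_le_mul_of_nonneg_left h3 (show 0 ≤ (K : ℝ) / T by positivity)
  have h6 := mul_le_mul_of_nonneg_right h h4
  rw [penalty, penalty, ← mul_assoc, mul_comm (4 / 3) (1 / α), mul_assoc]
  refine mul_le_mul_of_nonneg_left ?_ (by positivity)
  nlinarith

/-! ## The sum of the stability terms relative to the learning rates -/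

theorem le_add_sqrt_of_sq_le {x b c : ℝ} (hb : 0 ≤ b) (hc : 0 ≤ c) (h : x ^ 2 ≤ b * x + c) :
    x ≤ b + √c := by
  by_contra! hx
  have h1 := Real.sq_sqrt hc
  have h2 := Real.sqrt_nonneg c
  nlinarith

/-- Rounds in which the penalty is at most `U`. -/
theorem sum_filter_le_of_penalty_le {β g z h : ℕ → ℝ} {U : ℝ} (P : ℕ → Prop) [DecidablePred P]
    (hU : 0 ≤ U) (hβ0 : 0 ≤ β 0) (hg : ∀ t, 0 ≤ g t) (hg' : ∀ t, g t ≤ 12)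
    (hz : ∀ t, g t * β t = z t) (hβ : ∀ t, β (t + 1) = β t + g t / h t) (hh : ∀ t, 0 < h t)
    (hP : ∀ t, P t → h t ≤ U) (n : ℕ) :
    ∑ t ∈ Finset.range n with P t, g t ≤ 12 + √(2 * U * ∑ t ∈ Finset.range n with P t, z t) := by
  -- The induction carries `s ≤ U β n`, with `s` the partial sum of the selected `g t`. Adding `g`
  -- to `s` adds `2 s g + g ^ 2` to the square, where `s g ≤ U β g = U z` and `g ^ 2 ≤ 12 g`. Rounds
  -- outside `P` only increase `β`.
  have key : 0 ≤ β n ∧ 0 ≤ ∑ t ∈ Finset.range n with P t, z t ∧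
      ∑ t ∈ Finset.range n with P t, g t ≤ U * β n ∧
      (∑ t ∈ Finset.range n with P t, g t) ^ 2 ≤ 12 * ∑ t ∈ Finset.range n with P t, g t
        + 2 * U * ∑ t ∈ Finset.range n with P t, z t := by
    simp only [Finset.sum_filter]
    induction n with
    | zero => simp [hβ0, mul_nonneg hU hβ0]
    | succ n ih =>
      obtain ⟨h1, h2, h3, h4⟩ := ih
      have h5 : 0 ≤ g n / h n := div_nonneg (hg n) (hh n).le
      simp only [Finset.sum_range_succ]
      rw [hβ]
      by_cases hp : P n
      · have h6 : g n ≤ U * (g n / h n) := by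
          rw [← mul_div_assoc, le_div_iff₀ (hh n), mul_comm]
          exact mul_le_mul_of_nonneg_right (hP n hp) (hg n)
        simp only [if_pos hp]
        rw [← hz]
        have h7 := mul_le_mul_of_nonneg_left h3 (hg n)
        have h8 := mul_le_mul_of_nonneg_left (hg' n) (hg n)
        refine ⟨by linarith, ?_, by linarith, by nlinarith⟩
        have := mul_nonneg (hg n) h1
        linarith
      · simp only [if_neg hp, add_zero]
        refine ⟨by linarith, h2, ?_, h4⟩
        have := mul_nonneg hU h5
        linarith
  exact le_add_sqrt_of_sq_le (by norm_num) (mul_nonneg (by linarith) key.2.1) key.2.2.2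

/-- The sum of the relative stability terms, by the dyadic size of the penalty. -/
theorem sum_le_of_penalty_levels {β g z h : ℕ → ℝ} {H : ℝ} {N : ℕ} (hN : 0 < N)
    (hH : 0 < H) (hβ0 : 0 ≤ β 0) (hg : ∀ t, 0 ≤ g t) (hg' : ∀ t, g t ≤ 12)
    (hz : ∀ t, g t * β t = z t) (hβ : ∀ t, β (t + 1) = β t + g t / h t)
    (hz0 : ∀ t, 0 ≤ z t) (hh : ∀ t, H / N ≤ h t) (hh' : ∀ t, h t ≤ H) (n : ℕ) :
    ∑ t ∈ Finset.range n, g t ≤ 12 * ((Nat.log 2 N + 1 : ℕ) : ℝ)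
      + √(4 * ((Nat.log 2 N + 1 : ℕ) : ℝ) * ∑ t ∈ Finset.range n, z t * h t) := by
  set J := Nat.log 2 N + 1 with hJ
  have hN' : (0 : ℝ) < N := by exact_mod_cast hN
  have hpos : ∀ t, 0 < h t := fun t => (div_pos hH hN').trans_le (hh t)
  -- Level `j` consists of the rounds with `h t` between `H / 2 ^ (j + 1)` and `H / 2 ^ j`.
  set lev : ℕ → ℕ := fun t => Nat.log 2 ⌊H / h t⌋₊ with hlev
  have hfl : ∀ t, 1 ≤ ⌊H / h t⌋₊ := fun t => by
    rw [Nat.one_le_floor_iff, one_le_div (hpos t)]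
    exact hh' t
  have hup : ∀ t, h t ≤ H / 2 ^ lev t := fun t => by
    have h1 : 2 ^ lev t ≤ ⌊H / h t⌋₊ := Nat.pow_log_le_self 2 (by have := hfl t; omega)
    have h2 : (2 : ℝ) ^ lev t ≤ H / h t :=
      le_trans (by exact_mod_cast h1) (Nat.floor_le (div_pos hH (hpos t)).le)
    rw [le_div_iff₀ (hpos t)] at h2
    rw [le_div_iff₀ (by positivity)]
    linarith
  have hlow : ∀ t, H / 2 ^ lev t ≤ 2 * h t := fun t => by
    have h1 : ⌊H / h t⌋₊ + 1 ≤ 2 ^ (lev t + 1) := Nat.lt_pow_succ_log_self (by norm_num) _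
    have h2 : H / h t ≤ (2 : ℝ) ^ (lev t + 1) :=
      (Nat.lt_floor_add_one _).le.trans (by exact_mod_cast h1)
    rw [div_le_iff₀ (hpos t), pow_succ] at h2
    rw [div_le_iff₀ (by positivity)]
    linarith
  have hmaps : ∀ t ∈ Finset.range n, lev t ∈ Finset.range J := fun t _ => by
    rw [Finset.mem_range, hJ, Nat.lt_succ_iff]
    refine Nat.log_mono_right (Nat.floor_le_of_le ?_)
    rw [div_le_iff₀ (hpos t)]
    have := hh t
    rw [div_le_iff₀ hN'] at this
    linarith
  set Y : ℕ → ℝ := fun j => ∑ t ∈ Finset.range n with lev t = j, 4 * (z t * h t) with hY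
  have hY0 : ∀ j, 0 ≤ Y j := fun j => Finset.sum_nonneg fun t _ =>
    mul_nonneg (by norm_num) (mul_nonneg (hz0 t) (hpos t).le)
  have hj : ∀ j ∈ Finset.range J,
      ∑ t ∈ Finset.range n with lev t = j, g t ≤ 12 + √(Y j) := by
    intro j _
    -- Within a level `U ≤ 2 * h t`, which turns `2 * U * z t` into `4 * (z t * h t)`.
    have h1 := sum_filter_le_of_penalty_le (U := H / 2 ^ j) (fun t => lev t = j) (by positivity)
      hβ0 hg hg' hz hβ hpos (fun t ht => ht ▸ hup t) n
    refine h1.trans (add_le_add_right (Real.sqrt_le_sqrt ?_) _)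
    rw [hY, Finset.mul_sum]
    refine Finset.sum_le_sum fun t ht => ?_
    rw [Finset.mem_filter] at ht
    have h2 := hlow t
    rw [ht.2] at h2
    have := mul_le_mul_of_nonneg_left h2 (hz0 t)
    linarith
  have hsum := Finset.sum_le_sum hj
  rw [Finset.sum_fiberwise_of_maps_to hmaps, Finset.sum_add_distrib, Finset.sum_const,
    Finset.card_range, nsmul_eq_mul, mul_comm] at hsum
  refine hsum.trans (add_le_add_right (Real.le_sqrt_of_sq_le ?_) _)
  -- Cauchy-Schwarz over the `J` levels.
  have h1 := sq_sum_le_card_mul_sum_sq (s := Finset.range J) (f := fun j => √(Y j))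
  simp only [Real.sq_sqrt (hY0 _), Finset.card_range] at h1
  refine h1.trans (le_of_eq ?_)
  rw [hY, Finset.sum_fiberwise_of_maps_to hmaps, ← Finset.mul_sum]
  ring

/-! ## The state of the algorithm -/

theorem beta1_pos {K : ℕ} (hK : 0 < K) {α : ℝ} (hα' : α < 1) : 0 < beta1 K α :=
  div_pos (by positivity) (by linarith)

theorem isFTRLMin_ftrlMin {K : ℕ} (hK : 0 < K) {α β : ℝ} (hα : 0 < α) (hα' : α < 1)
    (hβ : 0 ≤ β) (L : Fin K → ℝ) : IsFTRLMin α (gam α) β L (ftrlMin α (gam α) β L) :=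
  ftrlMin_spec hK hα hα' (by linarith [six_le_gam α]) hβ L

theorem samplingProb_mem {K T : ℕ} (hK : 0 < K) (hT : 4 * K ≤ T) {α β : ℝ} (hα : 0 < α)
    (hα' : α < 1) (hβ : 0 ≤ β) (L : Fin K → ℝ) : samplingProb K T α β L ∈ posSimplex K :=
  mixUniform_mem hK hT (isFTRLMin_ftrlMin hK hα hα' hβ L).1.1

theorem one_div_le_samplingProb {K T : ℕ} (hK : 0 < K) (hT : 4 * K ≤ T) {α β : ℝ} (hα : 0 < α)
    (hα' : α < 1) (hβ : 0 ≤ β) (L : Fin K → ℝ) (i : Fin K) :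
    1 / (T : ℝ) ≤ samplingProb K T α β L i :=
  one_div_le_mixUniform hK hT (isFTRLMin_ftrlMin hK hα hα' hβ L).1.1 i

theorem stability_nonneg {K : ℕ} {α β : ℝ} (hα' : α < 1) (hβ : 0 ≤ β) {p : Fin K → ℝ}
    (hp : p ∈ posSimplex K) (i : Fin K) (x : ℝ) : 0 ≤ stability α β p i x := by
  have h1 : 0 ≤ min (p i) (1 - p i) :=
    le_min (hp.2 i).le (by linarith [posSimplex_le_one hp i])
  have h2 := six_le_gam α
  have h3 : 0 < 1 - α := by linarith
  refine le_min ?_ ?_ <;> positivity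

theorem beta1_le_state {K T : ℕ} (hK : 0 < K) (hT : 4 * K ≤ T) {α : ℝ} (hα : 0 < α)
    (hα' : α < 1) (t : ℕ) (h : History K t) : beta1 K α ≤ (state K T α t h).2 := by
  induction t with
  | zero => exact le_rfl
  | succ t ih =>
    have h0 := ih (Fin.init h)
    have hβ := (beta1_pos hK hα').le.trans h0
    have hp := samplingProb_mem hK hT hα hα' hβ (state K T α t (Fin.init h)).1
    exact h0.trans (le_add_of_nonneg_right (div_nonneg (stability_nonneg hα' hβ hp _ _)
      (mul_nonneg hβ (penalty_nonneg hα hα' hp))))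

theorem state_pos {K T : ℕ} (hK : 0 < K) (hT : 4 * K ≤ T) {α : ℝ} (hα : 0 < α)
    (hα' : α < 1) (t : ℕ) (h : History K t) : 0 < (state K T α t h).2 :=
  (beta1_pos hK hα').trans_le (beta1_le_state hK hT hα hα' t h)

theorem spmAlgorithm_mem {K T : ℕ} (hK : 0 < K) (hT : 4 * K ≤ T) {α : ℝ} (hα : 0 < α)
    (hα' : α < 1) (t : ℕ) (h : History K t) : spmAlgorithm K T α t h ∈ posSimplex K :=
  samplingProb_mem hK hT hα hα' (state_pos hK hT hα hα' t h).le _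

/-! ## The analysis of a fixed sequence of draws and observations -/

/-- The first `t` entries of a sequence of draws and observations. -/
def prefixHistory {K : ℕ} (h : ℕ → Fin K × ℝ) (t : ℕ) : History K t := fun s => h s

/-- The stability term of round `t`. -/
noncomputable def roundStability (K T : ℕ) (α : ℝ) (h : ℕ → Fin K × ℝ) (t : ℕ) : ℝ :=
  stability α (state K T α t (prefixHistory h t)).2 (spmAlgorithm K T α t (prefixHistory h t))
    (h t).1 (h t).2

/-- The penalty term of round `t`. -/
noncomputable def roundPenalty (K T : ℕ) (α : ℝ) (h : ℕ → Fin K × ℝ) (t : ℕ) : ℝ :=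
  penalty α (spmAlgorithm K T α t (prefixHistory h t))

/-- The stability term of round `t`, relative to the learning rate. -/
noncomputable def roundGain (K T : ℕ) (α : ℝ) (h : ℕ → Fin K × ℝ) (t : ℕ) : ℝ :=
  roundStability K T α h t / (state K T α t (prefixHistory h t)).2

/-- The FTRL minimizer after the history `h`. -/
noncomputable def leader (K T : ℕ) (α : ℝ) (t : ℕ) (h : History K t) : Fin K → ℝ :=
  ftrlMin α (gam α) (state K T α t h).2 (state K T α t h).1

theorem state_succ_prefixHistory {K T : ℕ} {α : ℝ} (h : ℕ → Fin K × ℝ) (t : ℕ) :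
    state K T α (t + 1) (prefixHistory h (t + 1))
      = ((state K T α t (prefixHistory h t)).1
          + lossEstimate (spmAlgorithm K T α t (prefixHistory h t)) (h t).1 (h t).2,
        (state K T α t (prefixHistory h t)).2
          + roundGain K T α h t / roundPenalty K T α h t) := by
  rw [roundGain, div_div]
  rfl

theorem roundStability_nonneg {K T : ℕ} (hK : 0 < K) (hT : 4 * K ≤ T) {α : ℝ} (hα : 0 < α)
    (hα' : α < 1) (h : ℕ → Fin K × ℝ) (t : ℕ) : 0 ≤ roundStability K T α h t :=
  stability_nonneg hα' (state_pos hK hT hα hα' _ _).le (spmAlgorithm_mem hK hT hα hα' _ _) _ _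

theorem roundGain_nonneg {K T : ℕ} (hK : 0 < K) (hT : 4 * K ≤ T) {α : ℝ} (hα : 0 < α)
    (hα' : α < 1) (h : ℕ → Fin K × ℝ) (t : ℕ) : 0 ≤ roundGain K T α h t :=
  div_nonneg (roundStability_nonneg hK hT hα hα' h t) (state_pos hK hT hα hα' _ _).le

theorem roundGain_le {K T : ℕ} (hK : 0 < K) (hT : 4 * K ≤ T) {α : ℝ} (hα : 0 < α)
    (hα' : α < 1) {h : ℕ → Fin K × ℝ} {t : ℕ} (hx : |(h t).2| ≤ 1) :
    roundGain K T α h t ≤ 72 / gam α := by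
  rw [roundGain, roundStability, stability_div (state_pos hK hT hα hα' _ _)]
  refine (min_le_right _ _).trans (mul_le_of_le_one_right ?_ ?_)
  · have := six_le_gam α
    positivity
  · exact (sq_le_one_iff_abs_le_one _).2 hx

/-- The constant is `48 ^ 2 = 96 * 24`: a learning-rate increment `δ` with `δ H ≤ 96 / γ` then
satisfies `24 α δ H ≤ γ`, as `round_le` needs. -/
theorem gam_sq_ge {α : ℝ} (hα : 0 < α) (hα' : α < 1) : 2304 * α ≤ gam α ^ 2 := by
  have h1 : 48 * √(α / (1 - α)) ≤ gam α := le_max_right _ _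
  have h2 : 0 ≤ α / (1 - α) := div_nonneg hα.le (by linarith)
  have h3 := pow_le_pow_left₀ (by positivity) h1 2
  rw [mul_pow, Real.sq_sqrt h2] at h3
  have h4 : α ≤ α / (1 - α) := le_div_self hα.le (by linarith) (by linarith)
  linarith

theorem roundPenalty_pos {K T : ℕ} (hK : 2 ≤ K) (hT : 4 * K ≤ T) {α : ℝ} (hα : 0 < α)
    (hα' : α < 1) (h : ℕ → Fin K × ℝ) (t : ℕ) :
    maxPenalty K α / T ≤ roundPenalty K T α h t ∧ 0 < roundPenalty K T α h t := by
  have h1 : maxPenalty K α / T ≤ roundPenalty K T α h t :=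
    maxPenalty_div_le_penalty hK hα hα' (spmAlgorithm_mem (by omega) hT hα hα' _ _)
      fun i => one_div_le_samplingProb (by omega) hT hα hα'
        (state_pos (by omega) hT hα hα' _ _).le _ i
  refine ⟨h1, lt_of_lt_of_le ?_ h1⟩
  have : (0 : ℝ) < T := by exact_mod_cast (by omega : 0 < T)
  exact div_pos (maxPenalty_pos hK hα hα') this

/-- One round of follow the regularized leader with the learning rates of the algorithm. -/
theorem round_le {K T : ℕ} (hK : 2 ≤ K) (hT : 4 * K ≤ T) {α : ℝ} (hα : 0 < α)
    (hα' : α < 1) {h : ℕ → Fin K × ℝ} {t : ℕ} (hx : |(h t).2| ≤ 1) {x : Fin K → ℝ}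
    (hxp : x ∈ posSimplex K) :
    ∑ i, lossEstimate (spmAlgorithm K T α t (prefixHistory h t)) (h t).1 (h t).2 i
        * leader K T α t (prefixHistory h t) i
      + objective α (gam α) (state K T α t (prefixHistory h t)).2
          (state K T α t (prefixHistory h t)).1 (leader K T α t (prefixHistory h t))
      - objective α (gam α) (state K T α (t + 1) (prefixHistory h (t + 1))).2
          (state K T α (t + 1) (prefixHistory h (t + 1))).1 x
      ≤ 3 * roundGain K T α h t := by
  have hK0 : 0 < K := by omega
  have hβ := state_pos hK0 hT hα hα' t (prefixHistory h t)
  have hg0 := roundGain_nonneg hK0 hT hα hα' h t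
  have hg := roundGain_le hK0 hT hα hα' hx
  have hh := (roundPenalty_pos hK hT hα hα' h t).2
  have hq := isFTRLMin_ftrlMin hK0 hα hα' hβ.le (state K T α t (prefixHistory h t)).1
  have hγ := six_le_gam α
  have hγ2 := gam_sq_ge hα hα'
  rw [state_succ_prefixHistory]
  set δ := roundGain K T α h t / roundPenalty K T α h t with hδ
  have hδ0 : 0 ≤ δ := div_nonneg hg0 hh.le
  set H := penalty α (leader K T α t (prefixHistory h t)) with hH
  have hH0 : 0 ≤ H := penalty_nonneg hα hα' hq.1
  have h1 : δ * H ≤ 4 / 3 * roundGain K T α h t := by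
    have h2 : H ≤ 4 / 3 * roundPenalty K T α h t := penalty_le_mixUniform hK0 hT hα hα' hq.1
    have h3 := mul_le_mul_of_nonneg_left h2 hδ0
    rwa [mul_left_comm, hδ, div_mul_cancel₀ _ hh.ne'] at h3
  have h0 : 0 ≤ δ * H := mul_nonneg hδ0 hH0
  have h2 : δ * H ≤ 96 / gam α := by
    refine h1.trans ((mul_le_mul_of_nonneg_left hg (by norm_num)).trans (le_of_eq ?_))
    ring
  rw [le_div_iff₀ (by linarith)] at h2
  have hαH : α * (δ * H) ≤ gam α / 4 := by
    rw [le_div_iff₀ (by norm_num)]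
    nlinarith
  -- The second-order cost is a sixth of the first-order one. The total is at most `1 + 7 / 6 * 4 /
  -- 3 = 23 / 9` times the gain, below `3`.
  have h3 : 4 * (δ * (α * H)) ^ 2 / gam α ≤ δ * H / 6 := by
    rw [div_le_div_iff₀ (by linarith) (by norm_num)]
    have h4 : α * (δ * H) * 24 ≤ gam α := by nlinarith
    have h5 : α * (δ * H) ≤ δ * H := mul_le_of_le_one_left h0 hα'.le
    have h6 := mul_le_mul h4 h5 (mul_nonneg hα.le h0) (show 0 ≤ gam α by linarith)
    linarith
  have h4 := sum_lossEstimate_mul_sub_le hα hα' hβ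
    (spmAlgorithm_mem hK0 hT hα hα' t (prefixHistory h t)) hq.1 hxp
    (le_mixUniform hK0 hT hq.1.1) (h t).1 hx
  have h5 := objective_step hα hα' (show 0 < gam α by linarith) hδ0 hq hxp h4
    (show δ * (α * H) ≤ gam α / 4 by linarith)
  change _ ≤ roundGain K T α h t + δ * H + 4 * (δ * (α * H)) ^ 2 / gam α at h5
  refine le_trans h5 ?_
  linarith

theorem sum_estimates {K T : ℕ} {α : ℝ} (h : ℕ → Fin K × ℝ) (x : Fin K → ℝ) (n : ℕ) :
    ∑ t ∈ Finset.range n, ∑ i, lossEstimate (spmAlgorithm K T α t (prefixHistory h t))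
        (h t).1 (h t).2 i * x i
      = ∑ i, (state K T α n (prefixHistory h n)).1 i * x i := by
  induction n with
  | zero => simp [state]
  | succ n ih =>
    rw [Finset.sum_range_succ, ih, state_succ_prefixHistory, ← Finset.sum_add_distrib]
    exact Finset.sum_congr rfl fun i _ => (add_mul _ _ _).symm

/-- The regret of the leader on the loss estimates. -/
theorem sum_estimates_sub_le {K T : ℕ} (hK : 2 ≤ K) (hT : 4 * K ≤ T) {α : ℝ} (hα : 0 < α)
    (hα' : α < 1) {h : ℕ → Fin K × ℝ} (hx : ∀ t, |(h t).2| ≤ 1) {u : Fin K → ℝ}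
    (hu : u ∈ posSimplex K) (huT : ∀ i, 1 / (T : ℝ) ≤ u i) (n : ℕ) :
    ∑ t ∈ Finset.range n, (h t).2 / spmAlgorithm K T α t (prefixHistory h t) (h t).1
        * (leader K T α t (prefixHistory h t) (h t).1 - u (h t).1)
      ≤ 3 * ∑ t ∈ Finset.range n, roundGain K T α h t + lowerOrder K T α := by
  have hK0 : 0 < K := by omega
  have hγ := six_le_gam α
  set F : ℕ → (Fin K → ℝ) → ℝ := fun t => objective α (gam α)
    (state K T α t (prefixHistory h t)).2 (state K T α t (prefixHistory h t)).1 with hF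
  set Q : ℕ → Fin K → ℝ := fun t => leader K T α t (prefixHistory h t) with hQ
  have hmin : ∀ t, IsFTRLMin α (gam α) (state K T α t (prefixHistory h t)).2
      (state K T α t (prefixHistory h t)).1 (Q t) := fun t =>
    isFTRLMin_ftrlMin hK0 hα hα' (state_pos hK0 hT hα hα' _ _).le _
  -- Telescoping: `round_le` is applied with the next leader as the competing point.
  have h1 : ∑ t ∈ Finset.range n, (h t).2 / spmAlgorithm K T α t (prefixHistory h t) (h t).1
      * Q t (h t).1 ≤ 3 * ∑ t ∈ Finset.range n, roundGain K T α h t + F n (Q n) - F 0 (Q 0) := by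
    induction n with
    | zero => simp
    | succ n ih =>
      have := round_le hK hT hα hα' (hx n) (hmin (n + 1)).1
      rw [sum_lossEstimate_mul] at this
      rw [Finset.sum_range_succ, Finset.sum_range_succ]
      linarith
  have h2 := sum_estimates (T := T) (α := α) h u n
  simp only [sum_lossEstimate_mul] at h2
  have h3 : F n (Q n) ≤ F n u := (hmin n).2 u hu
  have hT0 : (0 : ℝ) < T := by exact_mod_cast (by omega : 0 < T)
  have h4 : psiLB u ≤ K * Real.log T := by
    rw [psiLB, ← Finset.sum_neg_distrib]
    refine (Finset.sum_le_card_nsmul _ _ (Real.log T) fun i _ => ?_).trans_eq (by simp)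
    have := Real.log_le_log (by positivity) (huT i)
    rw [one_div, Real.log_inv] at this
    linarith
  have h5 : 0 ≤ psiLB (Q 0) := by
    rw [psiLB, ← Finset.sum_neg_distrib]
    exact Finset.sum_nonneg fun i _ => neg_nonneg.2 (Real.log_nonpos ((hmin 0).1.2 i).le
      (posSimplex_le_one (hmin 0).1 i))
  -- The last learning rate enters with the factor `-penalty α u ≤ 0` and is dropped. The comparator
  -- is bounded below by `1 / T` so that its log-barrier costs only `K log T`.
  have h6 : F n u ≤ ∑ i, (state K T α n (prefixHistory h n)).1 i * u i
      + gam α * K * Real.log T := by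
    have h7 := mul_nonneg (state_pos hK0 hT hα hα' n (prefixHistory h n)).le
      (penalty_nonneg hα hα' hu)
    have h8 := mul_le_mul_of_nonneg_left h4 (show 0 ≤ gam α by linarith)
    rw [penalty_eq_neg_psiTE] at h7
    simp only [hF, objective]
    linarith
  have h9 : -(beta1 K α * ((K : ℝ) ^ (1 - α) - 1) / α) ≤ F 0 (Q 0) := by
    have h7 := mul_le_mul_of_nonneg_left (penalty_le_maxPenalty hα hα' (hmin 0).1)
      (beta1_pos hK0 hα').le
    have h8 := mul_nonneg (show 0 ≤ gam α by linarith) h5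
    rw [penalty_eq_neg_psiTE, maxPenalty, ← mul_div_assoc] at h7
    simp only [hF, objective, state, Pi.zero_apply, zero_mul, Finset.sum_const_zero]
    linarith
  rw [lowerOrder, Finset.sum_congr rfl fun t _ => mul_sub _ _ _, Finset.sum_sub_distrib, h2]
  linarith

theorem roundGain_le_twelve {K T : ℕ} (hK : 0 < K) (hT : 4 * K ≤ T) {α : ℝ} (hα : 0 < α)
    (hα' : α < 1) {h : ℕ → Fin K × ℝ} {t : ℕ} (hx : |(h t).2| ≤ 1) :
    roundGain K T α h t ≤ 12 := by
  refine (roundGain_le hK hT hα hα' hx).trans ?_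
  have := six_le_gam α
  rw [div_le_iff₀ (by linarith)]
  linarith

theorem roundGain_mul {K T : ℕ} (hK : 0 < K) (hT : 4 * K ≤ T) {α : ℝ} (hα : 0 < α)
    (hα' : α < 1) (h : ℕ → Fin K × ℝ) (t : ℕ) :
    roundGain K T α h t * (state K T α t (prefixHistory h t)).2 = roundStability K T α h t :=
  div_mul_cancel₀ _ (state_pos hK hT hα hα' _ _).ne'

theorem roundPenalty_le {K T : ℕ} (hK : 0 < K) (hT : 4 * K ≤ T) {α : ℝ} (hα : 0 < α)
    (hα' : α < 1) (h : ℕ → Fin K × ℝ) (t : ℕ) : roundPenalty K T α h t ≤ maxPenalty K α :=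
  penalty_le_maxPenalty hα hα' (spmAlgorithm_mem hK hT hα hα' _ _)

theorem sum_roundGain_le {K T : ℕ} (hK : 2 ≤ K) (hT : 4 * K ≤ T) {α : ℝ} (hα : 0 < α)
    (hα' : α < 1) {h : ℕ → Fin K × ℝ} (hx : ∀ t, |(h t).2| ≤ 1) (n : ℕ) :
    ∑ t ∈ Finset.range n, roundGain K T α h t
      ≤ 12 + √(2 * maxPenalty K α * ∑ t ∈ Finset.range n, roundStability K T α h t) := by
  have hK0 : 0 < K := by omega
  have := sum_filter_le_of_penalty_le (fun _ => True) (maxPenalty_pos hK hα hα').le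
    (state_pos hK0 hT hα hα' 0 (prefixHistory h 0)).le (roundGain_nonneg hK0 hT hα hα' h)
    (fun t => roundGain_le_twelve hK0 hT hα hα' (hx t)) (roundGain_mul hK0 hT hα hα' h)
    (fun t => by rw [state_succ_prefixHistory])
    (fun t => (roundPenalty_pos hK hT hα hα' h t).2)
    (fun t _ => roundPenalty_le hK0 hT hα hα' h t) n
  simpa using this

theorem sum_roundGain_le_levels {K T : ℕ} (hK : 2 ≤ K) (hT : 4 * K ≤ T) {α : ℝ} (hα : 0 < α)
    (hα' : α < 1) {h : ℕ → Fin K × ℝ} (hx : ∀ t, |(h t).2| ≤ 1) (n : ℕ) :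
    ∑ t ∈ Finset.range n, roundGain K T α h t ≤ 12 * ((Nat.log 2 T + 1 : ℕ) : ℝ)
      + √(4 * ((Nat.log 2 T + 1 : ℕ) : ℝ)
        * ∑ t ∈ Finset.range n, roundStability K T α h t * roundPenalty K T α h t) := by
  have hK0 : 0 < K := by omega
  exact sum_le_of_penalty_levels (by omega) (maxPenalty_pos hK hα hα')
    (state_pos hK0 hT hα hα' 0 (prefixHistory h 0)).le (roundGain_nonneg hK0 hT hα hα' h)
    (fun t => roundGain_le_twelve hK0 hT hα hα' (hx t)) (roundGain_mul hK0 hT hα hα' h)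
    (fun t => by rw [state_succ_prefixHistory]) (roundStability_nonneg hK0 hT hα hα' h)
    (fun t => (roundPenalty_pos hK hT hα hα' h t).1)
    (fun t => roundPenalty_le hK0 hT hα hα' h t) n

/-! ## The conditional expectation of the stability term -/

theorem twelve_rpow_le {α : ℝ} (hα : 0 < α) : (6 * 2 : ℝ) ^ (2 - α) ≤ 144 := by
  calc (6 * 2 : ℝ) ^ (2 - α) ≤ (6 * 2) ^ (2 : ℝ) :=
        Real.rpow_le_rpow_of_exponent_le (by norm_num) (by linarith)
    _ = 144 := by norm_num

/-- After the factor `p i`, one power of `p i` remains in the denominator and is absorbed by one of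
the `2 - α` powers of the minimum. A zero loss has zero stability, which is where sparsity enters.
-/
theorem mul_stability_le {K : ℕ} {α β : ℝ} (hα : 0 < α) (hα' : α < 1)
    {p : Fin K → ℝ} (hp : p ∈ posSimplex K) (i : Fin K) {x : ℝ} (hx : |x| ≤ 1) :
    p i * stability α β p i x
      ≤ if x ≠ 0 then 72 / (1 - α) * min (p i) (1 - p i) ^ (1 - α) else 0 := by
  have hpi := hp.2 i
  have hα1 : 0 < 1 - α := by linarith
  set m := min (p i) (1 - p i) with hm
  have hm0 : 0 ≤ m := le_min hpi.le (by linarith [posSimplex_le_one hp i])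
  have h1 : stability α β p i x
      ≤ (6 * 2) ^ (2 - α) / (2 * (1 - α)) * m ^ (2 - α) * (x / p i) ^ 2 := by
    refine (min_le_left _ _).trans_eq ?_
    simp [lossEstimate, hm]
  refine (mul_le_mul_of_nonneg_left h1 hpi.le).trans ?_
  split_ifs with h0
  · have h2 : m ^ (2 - α) = m * m ^ (1 - α) := by
      rw [← Real.rpow_one_add' hm0 (by linarith)]
      ring_nf
    have h3 : m / p i ≤ 1 := (div_le_one hpi).2 (min_le_left _ _)
    have h4 : x ^ 2 ≤ 1 := (sq_le_one_iff_abs_le_one _).2 hx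
    have h5 : p i * ((6 * 2) ^ (2 - α) / (2 * (1 - α)) * m ^ (2 - α) * (x / p i) ^ 2)
        = (6 * 2) ^ (2 - α) / 2 / (1 - α) * m ^ (1 - α) * (m / p i * x ^ 2) := by
      rw [h2]
      field_simp
    rw [h5]
    have h6 : m / p i * x ^ 2 ≤ 1 := mul_le_one₀ h3 (sq_nonneg _) h4
    have h7 : (6 * 2 : ℝ) ^ (2 - α) / 2 / (1 - α) ≤ 72 / (1 - α) :=
      div_le_div_of_nonneg_right ((div_le_div_of_nonneg_right (twelve_rpow_le hα)
        (by norm_num)).trans_eq (by norm_num)) hα1.le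
    have h8 := mul_le_mul_of_nonneg_right h7 (Real.rpow_nonneg hm0 (1 - α))
    exact (mul_le_of_le_one_right (by positivity) h6).trans h8
  · rw [not_not] at h0
    simp [h0]

/-- Jensen's inequality with exponent `1 - α` over the arms with nonzero loss: the source of `S ^
α`. -/
theorem sum_mul_stability_le {K S : ℕ} {α β : ℝ} (hα : 0 < α) (hα' : α < 1)
    {p : Fin K → ℝ} (hp : p ∈ posSimplex K) {l : Fin K → ℝ} (hl : ∀ i, |l i| ≤ 1)
    (hS : {i | l i ≠ 0}.ncard ≤ S) {b : ℝ}
    (hb : ∑ i, min (p i) (1 - p i) ≤ b) :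
    ∑ i, p i * stability α β p i (l i) ≤ 72 / (1 - α) * ((S : ℝ) ^ α * b ^ (1 - α)) := by
  classical
  have hα1 : 0 < 1 - α := by linarith
  have hm : ∀ i, 0 ≤ min (p i) (1 - p i) := fun i =>
    le_min (hp.2 i).le (by linarith [posSimplex_le_one hp i])
  have h1 := Finset.sum_le_sum fun i (_ : i ∈ Finset.univ) =>
    mul_stability_le (β := β) hα hα' hp i (hl i)
  refine h1.trans ?_
  rw [← Finset.sum_filter, ← Finset.mul_sum]
  refine mul_le_mul_of_nonneg_left ?_ (by positivity)
  have h2 := sum_rpow_le_card_rpow_mul {i | l i ≠ 0} hα1 (by linarith)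
    (fun i => min (p i) (1 - p i)) fun i _ => hm i
  have h3 : (Finset.univ.filter fun i => l i ≠ 0).card ≤ S := by
    rw [← Set.ncard_coe_finset]
    simpa using hS
  rw [sub_sub_cancel] at h2
  refine h2.trans (mul_le_mul (Real.rpow_le_rpow (by positivity) (by exact_mod_cast h3) hα.le)
    (Real.rpow_le_rpow (Finset.sum_nonneg fun i _ => hm i) (le_trans ?_ hb) hα1.le)
    (Real.rpow_nonneg (Finset.sum_nonneg fun i _ => hm i) _) (by positivity))
  exact Finset.sum_le_sum_of_subset_of_nonneg (Finset.subset_univ _) fun i _ _ => hm i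

theorem sum_mul_stability_le_adv {K S : ℕ} {α β : ℝ} (hα : 0 < α) (hα' : α < 1)
    {p : Fin K → ℝ} (hp : p ∈ posSimplex K) {l : Fin K → ℝ} (hl : ∀ i, |l i| ≤ 1)
    (hS : {i | l i ≠ 0}.ncard ≤ S) :
    ∑ i, p i * stability α β p i (l i) ≤ 72 / (1 - α) * (S : ℝ) ^ α := by
  have := sum_mul_stability_le (β := β) hα hα' hp hl hS (b := 1) (by
    rw [← hp.1.2]
    exact Finset.sum_le_sum fun i _ => min_le_left _ _)
  simpa using this

/-- The stability contributes the exponent `1 - α` and the penalty the exponent `α`, so the product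
is linear in `1 - p i₀`, the quantity that a self-bounding constraint controls. -/
theorem sum_mul_stability_mul_penalty_le {K S : ℕ} {α β : ℝ} (hα : 0 < α)
    (hα' : α < 1) {p : Fin K → ℝ} (hp : p ∈ posSimplex K) {l : Fin K → ℝ}
    (hl : ∀ i, |l i| ≤ 1) (hS : {i | l i ≠ 0}.ncard ≤ S) (i₀ : Fin K) :
    (∑ i, p i * stability α β p i (l i)) * penalty α p
      ≤ 144 * (((K : ℝ) - 1) ^ (1 - α) * (S : ℝ) ^ α / (α * (1 - α))) * (1 - p i₀) := by
  have hα1 : 0 < 1 - α := by linarith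
  have hy : 0 ≤ 1 - p i₀ := by linarith [posSimplex_le_one hp i₀]
  have hK : (0 : ℝ) ≤ (K : ℝ) - 1 := by
    have : (1 : ℝ) ≤ K := by exact_mod_cast i₀.pos
    linarith
  have h1 := sum_mul_stability_le (β := β) hα hα' hp hl hS (b := 2 * (1 - p i₀)) (by
    have hs : ∑ j ∈ Finset.univ.erase i₀, p j = 1 - p i₀ := by
      rw [← hp.1.2, ← Finset.add_sum_erase _ _ (Finset.mem_univ i₀)]
      ring
    rw [← Finset.add_sum_erase _ _ (Finset.mem_univ i₀)]
    have h2 := Finset.sum_le_sum fun i (_ : i ∈ Finset.univ.erase i₀) =>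
      min_le_left (p i) (1 - p i)
    rw [hs] at h2
    linarith [min_le_right (p i₀) (1 - p i₀)])
  have h2 := penalty_le_of_arm hα hα' hp i₀
  have h3 : (2 * (1 - p i₀)) ^ (1 - α) ≤ 2 * (1 - p i₀) ^ (1 - α) := by
    rw [Real.mul_rpow (by norm_num) hy]
    refine mul_le_mul_of_nonneg_right ?_ (Real.rpow_nonneg hy _)
    calc (2 : ℝ) ^ (1 - α) ≤ 2 ^ (1 : ℝ) :=
          Real.rpow_le_rpow_of_exponent_le (by norm_num) (by linarith)
      _ = 2 := Real.rpow_one 2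
  have h4 : ∑ i, p i * stability α β p i (l i)
      ≤ 72 / (1 - α) * ((S : ℝ) ^ α * (2 * (1 - p i₀) ^ (1 - α))) :=
    h1.trans (mul_le_mul_of_nonneg_left (mul_le_mul_of_nonneg_left h3 (by positivity))
      (by positivity))
  refine (mul_le_mul h4 h2 (penalty_nonneg hα hα' hp) (by positivity)).trans (le_of_eq ?_)
  have h5 : (1 - p i₀) ^ (1 - α) * (1 - p i₀) ^ α = 1 - p i₀ := by
    rw [← Real.rpow_add' hy (by norm_num), sub_add_cancel, Real.rpow_one]
  calc _ = 144 * (((K : ℝ) - 1) ^ (1 - α) * (S : ℝ) ^ α / (α * (1 - α)))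
        * ((1 - p i₀) ^ (1 - α) * (1 - p i₀) ^ α) := by
        field_simp
        ring
    _ = _ := by rw [h5]

/-! ## Expectations over the draws of the learner, for fixed losses -/

/-- Extend finitely many draws to a sequence. -/
def extendDraws {K n : ℕ} (i₀ : Fin K) (I : Fin n → Fin K) (s : ℕ) : Fin K :=
  if h : s < n then I ⟨s, h⟩ else i₀

/-- The probability of the draws `J`, if arms are drawn from `c` given the previous draws. -/
noncomputable def pathWeight {K : ℕ} (c : ∀ t : ℕ, (Fin t → Fin K) → Fin K → ℝ) (n : ℕ)
    (J : Fin n → Fin K) : ℝ :=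
  ∏ s : Fin n, c s (fun r => J (Fin.castLE s.isLt.le r)) (J s)

/-- The expectation of `f` over the first `n` draws. -/
noncomputable def pathExp {K : ℕ} (c : ∀ t : ℕ, (Fin t → Fin K) → Fin K → ℝ) (i₀ : Fin K)
    (n : ℕ) (f : (ℕ → Fin K) → ℝ) : ℝ :=
  ∑ J : Fin n → Fin K, pathWeight c n J * f (extendDraws i₀ J)

theorem extendDraws_val {K n : ℕ} (i₀ : Fin K) (I : Fin n → Fin K) (s : Fin n) :
    extendDraws i₀ I s = I s := by
  simp [extendDraws]

theorem extendDraws_snoc {K n : ℕ} (i₀ : Fin K) (I : Fin n → Fin K) (i : Fin K) :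
    extendDraws i₀ (Fin.snoc I i : Fin (n + 1) → Fin K)
      = Function.update (extendDraws i₀ I) n i := by
  funext s
  rcases lt_trichotomy s n with h | h | h
  · simp [extendDraws, Function.update, h.ne, h, Nat.lt_succ_of_lt h, Fin.snoc]
  · subst h
    simp [extendDraws, Fin.snoc]
  · simp [extendDraws, Function.update, h.ne', h.not_gt, show ¬ s < n + 1 by omega]

theorem pathWeight_snoc {K : ℕ} (c : ∀ t : ℕ, (Fin t → Fin K) → Fin K → ℝ) (n : ℕ)
    (J : Fin n → Fin K) (i : Fin K) :
    pathWeight c (n + 1) (Fin.snoc J i : Fin (n + 1) → Fin K) = pathWeight c n J * c n J i := by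
  rw [pathWeight, Fin.prod_univ_castSucc, pathWeight]
  congr 1
  · refine Finset.prod_congr rfl fun s _ => ?_
    have h1 : (fun r : Fin s => (Fin.snoc J i : Fin (n + 1) → Fin K)
        (Fin.castLE s.castSucc.isLt.le r)) = fun r : Fin s => J (Fin.castLE s.isLt.le r) := by
      funext r
      exact Fin.snoc_castSucc (α := fun _ => Fin K) i J (Fin.castLE s.isLt.le r)
    have h2 : (Fin.snoc J i : Fin (n + 1) → Fin K) s.castSucc = J s :=
      Fin.snoc_castSucc (α := fun _ => Fin K) i J s
    rw [h2]
    exact congrFun (congrArg (c s) h1) (J s)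
  · have h1 : (fun r : Fin n => (Fin.snoc J i : Fin (n + 1) → Fin K)
        (Fin.castLE (Fin.last n).isLt.le r)) = J := by
      funext r
      exact Fin.snoc_castSucc (α := fun _ => Fin K) i J r
    have h2 : (Fin.snoc J i : Fin (n + 1) → Fin K) (Fin.last n) = i :=
      Fin.snoc_last (α := fun _ => Fin K) i J
    rw [h2]
    exact congrFun (congrArg (c n) h1) i

theorem sum_snoc {K n : ℕ} (F : (Fin (n + 1) → Fin K) → ℝ) :
    ∑ J, F J = ∑ J : Fin n → Fin K, ∑ i, F (Fin.snoc J i : Fin (n + 1) → Fin K) := by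
  rw [← (Fin.snocEquiv fun _ : Fin (n + 1) => Fin K).sum_comp F, Fintype.sum_prod_type_right]
  rfl

theorem pathExp_succ {K : ℕ} (c : ∀ t : ℕ, (Fin t → Fin K) → Fin K → ℝ) (i₀ : Fin K)
    (n : ℕ) (f : (ℕ → Fin K) → ℝ) :
    pathExp c i₀ (n + 1) f = pathExp c i₀ n fun a =>
      ∑ i, c n (fun s => a s) i * f (Function.update a n i) := by
  rw [pathExp, sum_snoc, pathExp]
  refine Finset.sum_congr rfl fun J _ => ?_
  rw [Finset.mul_sum]
  refine Finset.sum_congr rfl fun i _ => ?_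
  have : (fun s : Fin n => extendDraws i₀ J s) = J := funext fun s => extendDraws_val i₀ J s
  rw [pathWeight_snoc, extendDraws_snoc, this, mul_assoc]

theorem pathExp_add {K : ℕ} (c : ∀ t : ℕ, (Fin t → Fin K) → Fin K → ℝ) (i₀ : Fin K)
    (n : ℕ) (f g : (ℕ → Fin K) → ℝ) :
    pathExp c i₀ n (fun a => f a + g a) = pathExp c i₀ n f + pathExp c i₀ n g := by
  simp only [pathExp, mul_add, Finset.sum_add_distrib]

theorem pathExp_const_mul {K : ℕ} (c : ∀ t : ℕ, (Fin t → Fin K) → Fin K → ℝ) (i₀ : Fin K)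
    (n : ℕ) (b : ℝ) (f : (ℕ → Fin K) → ℝ) :
    pathExp c i₀ n (fun a => b * f a) = b * pathExp c i₀ n f := by
  simp only [pathExp, mul_left_comm _ b, ← Finset.mul_sum]

theorem pathExp_sum {K : ℕ} (c : ∀ t : ℕ, (Fin t → Fin K) → Fin K → ℝ) (i₀ : Fin K)
    (n : ℕ) {ι : Type*} (s : Finset ι) (f : ι → (ℕ → Fin K) → ℝ) :
    pathExp c i₀ n (fun a => ∑ i ∈ s, f i a) = ∑ i ∈ s, pathExp c i₀ n (f i) := by
  simp only [pathExp, Finset.mul_sum]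
  exact Finset.sum_comm

/-- The draws follow probability distributions in the first `T` rounds. -/
def IsDrawKernel {K : ℕ} (T : ℕ) (c : ∀ t : ℕ, (Fin t → Fin K) → Fin K → ℝ) : Prop :=
  ∀ t < T, ∀ J, c t J ∈ stdSimplex ℝ (Fin K)

theorem IsDrawKernel.pathWeight_nonneg {K T : ℕ} {c : ∀ t : ℕ, (Fin t → Fin K) → Fin K → ℝ}
    (hc : IsDrawKernel T c) (J : Fin T → Fin K) : 0 ≤ pathWeight c T J :=
  Finset.prod_nonneg fun s _ => (hc s s.isLt _).1 _

theorem IsDrawKernel.pathExp_mono {K T : ℕ} {c : ∀ t : ℕ, (Fin t → Fin K) → Fin K → ℝ}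
    (hc : IsDrawKernel T c) (i₀ : Fin K) {f g : (ℕ → Fin K) → ℝ} (hfg : ∀ a, f a ≤ g a) :
    pathExp c i₀ T f ≤ pathExp c i₀ T g :=
  Finset.sum_le_sum fun J _ => mul_le_mul_of_nonneg_left (hfg _) (hc.pathWeight_nonneg J)

theorem IsDrawKernel.pathExp_succ_eq {K T : ℕ} {c : ∀ t : ℕ, (Fin t → Fin K) → Fin K → ℝ}
    (hc : IsDrawKernel T c) (i₀ : Fin K) {n : ℕ} (hn : n < T) {f : (ℕ → Fin K) → ℝ}
    (hf : DependsOn f (Set.Iio n)) : pathExp c i₀ (n + 1) f = pathExp c i₀ n f := by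
  rw [pathExp_succ]
  congr 1
  funext a
  have : ∀ i, f (Function.update a n i) = f a := fun i => hf fun s hs =>
    Function.update_of_ne (ne_of_lt hs) _ _
  simp only [this, ← Finset.sum_mul, (hc n hn _).2, one_mul]

/-- Draws after round `m` have total probability one and integrate out. -/
theorem IsDrawKernel.pathExp_eq {K T : ℕ} {c : ∀ t : ℕ, (Fin t → Fin K) → Fin K → ℝ}
    (hc : IsDrawKernel T c) (i₀ : Fin K) {m : ℕ} (hm : m ≤ T) {f : (ℕ → Fin K) → ℝ}
    (hf : DependsOn f (Set.Iio m)) : pathExp c i₀ T f = pathExp c i₀ m f := by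
  have : ∀ n, m ≤ n → n ≤ T → pathExp c i₀ n f = pathExp c i₀ m f := by
    intro n hmn
    induction n, hmn using Nat.le_induction with
    | base => exact fun _ => rfl
    | succ n hmn ih =>
      intro hn
      rw [hc.pathExp_succ_eq i₀ hn (hf.mono (Set.Iio_subset_Iio hmn)), ih (by omega)]
  exact this T hm le_rfl

/-- The tower rule: conditioning on the draws before round `t`. -/
theorem IsDrawKernel.pathExp_condExp {K T : ℕ} {c : ∀ t : ℕ, (Fin t → Fin K) → Fin K → ℝ}
    (hc : IsDrawKernel T c) (i₀ : Fin K) {t : ℕ} (ht : t < T) {f : (ℕ → Fin K) → ℝ}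
    (hf : DependsOn f (Set.Iio (t + 1))) :
    pathExp c i₀ T f = pathExp c i₀ T fun a =>
      ∑ i, c t (fun s => a s) i * f (Function.update a t i) := by
  rw [hc.pathExp_eq i₀ ht hf, pathExp_succ, hc.pathExp_eq i₀ ht.le]
  intro a b hab
  have h1 : (fun s : Fin t => a s) = fun s : Fin t => b s := funext fun s => hab s s.isLt
  simp only [h1]
  refine Finset.sum_congr rfl fun i _ => ?_
  congr 1
  refine hf fun s hs => ?_
  rcases Nat.lt_succ_iff_lt_or_eq.1 hs with h | h
  · rw [Function.update_of_ne h.ne, Function.update_of_ne h.ne]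
    exact hab s h
  · subst h
    simp

theorem IsDrawKernel.pathExp_const {K T : ℕ} {c : ∀ t : ℕ, (Fin t → Fin K) → Fin K → ℝ}
    (hc : IsDrawKernel T c) (i₀ : Fin K) (b : ℝ) : pathExp c i₀ T (fun _ => b) = b := by
  rw [hc.pathExp_eq i₀ (Nat.zero_le T) (fun _ _ _ => rfl)]
  simp [pathExp, pathWeight]

theorem IsDrawKernel.pathExp_sqrt_le {K T : ℕ} {c : ∀ t : ℕ, (Fin t → Fin K) → Fin K → ℝ}
    (hc : IsDrawKernel T c) (i₀ : Fin K) {f : (ℕ → Fin K) → ℝ} (hf : ∀ a, 0 ≤ f a) :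
    pathExp c i₀ T (fun a => √(f a)) ≤ √(pathExp c i₀ T f) := by
  have h1 : ∑ J : Fin T → Fin K, pathWeight c T J = 1 := by
    have := hc.pathExp_const i₀ 1
    simpa [pathExp] using this
  exact Real.strictConcaveOn_sqrt.concaveOn.le_map_sum
    (fun J _ => hc.pathWeight_nonneg J) h1 fun J _ => hf _

/-! ## The draws of the algorithm -/

/-- The draws and observations, if the arms are `a` and the losses `l`. -/
def playHistory {K : ℕ} (l : ℕ → Fin K → ℝ) (a : ℕ → Fin K) : ℕ → Fin K × ℝ :=
  fun s => (a s, l s (a s))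

/-- The distribution of the next draw under a policy, given the previous draws. -/
def drawKernel {K : ℕ} (π : Policy K) (l : ℕ → Fin K → ℝ) (t : ℕ) (J : Fin t → Fin K) :
    Fin K → ℝ :=
  π t fun s => (J s, l s (J s))

theorem drawKernel_prefix {K : ℕ} (π : Policy K) (l : ℕ → Fin K → ℝ) (t : ℕ) (a : ℕ → Fin K) :
    drawKernel π l t (fun s => a s) = π t (prefixHistory (playHistory l a) t) := rfl

/-- Extend the losses of `T` rounds by zero. -/
def extendLosses {K T : ℕ} (l : Fin T → Fin K → ℝ) (t : ℕ) : Fin K → ℝ :=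
  if h : t < T then l ⟨t, h⟩ else 0

theorem extendLosses_val {K T : ℕ} (l : Fin T → Fin K → ℝ) (t : Fin T) :
    extendLosses l t = l t := by
  simp [extendLosses]

theorem drawProb_eq_pathWeight {K T : ℕ} (π : Policy K) (l : Fin T → Fin K → ℝ)
    (I : Fin T → Fin K) :
    drawProb π l I = pathWeight (drawKernel π (extendLosses l)) T I := by
  refine Finset.prod_congr rfl fun t _ => ?_
  rw [drawKernel]
  congr 2
  funext s
  rw [historyBefore, ← extendLosses_val l (Fin.castLE t.isLt.le s)]
  rfl

theorem sum_drawProb_mul {K T : ℕ} (π : Policy K) (l : Fin T → Fin K → ℝ) (i₀ : Fin K)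
    (f : (ℕ → Fin K) → ℝ) :
    ∑ I : Fin T → Fin K, drawProb π l I * f (extendDraws i₀ I)
      = pathExp (drawKernel π (extendLosses l)) i₀ T f := by
  simp only [drawProb_eq_pathWeight, pathExp]

theorem prefixHistory_playHistory_congr {K : ℕ} (l : ℕ → Fin K → ℝ) {a b : ℕ → Fin K} {t : ℕ}
    (hab : ∀ s < t, a s = b s) :
    prefixHistory (playHistory l a) t = prefixHistory (playHistory l b) t := by
  funext s
  simp only [prefixHistory, playHistory, hab s s.isLt]

/-- The tower rule for a function of the past and the draw of round `t`. -/
theorem IsDrawKernel.pathExp_history {K T : ℕ} {π : Policy K} {l : ℕ → Fin K → ℝ}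
    (hc : IsDrawKernel T (drawKernel π l)) (i₀ : Fin K) {t : ℕ} (ht : t < T)
    (f : History K t → Fin K → ℝ) :
    pathExp (drawKernel π l) i₀ T (fun a => f (prefixHistory (playHistory l a) t) (a t))
      = pathExp (drawKernel π l) i₀ T fun a =>
        ∑ i, π t (prefixHistory (playHistory l a) t) i
          * f (prefixHistory (playHistory l a) t) i := by
  rw [hc.pathExp_condExp i₀ ht]
  · congr 1
    funext a
    refine Finset.sum_congr rfl fun i _ => ?_
    rw [drawKernel_prefix, Function.update_self,
      prefixHistory_playHistory_congr l (a := Function.update a t i) (b := a)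
        fun s hs => Function.update_of_ne (ne_of_lt hs) _ _]
  · intro a b hab
    have h1 : a t = b t := hab t (Nat.lt_succ_self t)
    have h2 := prefixHistory_playHistory_congr l fun s hs => hab s (Nat.lt_succ_of_lt hs)
    simp only [h1, h2]

/-! ## Regret bounds for fixed losses -/

theorem isDrawKernel_spmAlgorithm {K T : ℕ} (hK : 0 < K) (hT : 4 * K ≤ T) {α : ℝ}
    (hα : 0 < α) (hα' : α < 1) (l : ℕ → Fin K → ℝ) :
    IsDrawKernel T (drawKernel (spmAlgorithm K T α) l) :=
  fun _ _ _ => (spmAlgorithm_mem hK hT hα hα' _ _).1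

/-- The cost of exploration, in one round. -/
theorem sum_mul_mixUniform_le {K T : ℕ} (hK : 0 < K) (hT : 4 * K ≤ T) {q : Fin K → ℝ}
    (hq : q ∈ stdSimplex ℝ (Fin K)) {l : Fin K → ℝ} (hl : ∀ i, |l i| ≤ 1) (a : Fin K) :
    ∑ i, mixUniform K T q i * (l i - l a
      - l i / mixUniform K T q i * (q i - mixUniform K T (Pi.single a 1) i)) ≤ 4 * K / T := by
  obtain ⟨hT0, hK0, h⟩ := div_le_quarter hK hT
  have hp := mixUniform_mem hK hT hq
  -- Importance weighting cancels the probability. After summation the terms are at most `2 K / T`,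
  -- `K / T` and `K / T`.
  have h1 : ∀ i, mixUniform K T q i * (l i - l a
      - l i / mixUniform K T q i * (q i - mixUniform K T (Pi.single a 1) i))
      = 2 / T * l i - K / T * (q i * l i)
        + (1 - (K : ℝ) / T) * (l i * (Pi.single a 1 : Fin K → ℝ) i)
        - mixUniform K T q i * l a := by
    intro i
    have h2 := (hp.2 i).ne'
    rw [mul_sub, ← mul_assoc, mul_div_cancel₀ _ h2]
    simp only [mixUniform]
    ring
  have h3 : ∑ i, l i ≤ K := by
    refine (Finset.sum_le_card_nsmul _ _ 1 fun i _ => (abs_le.1 (hl i)).2).trans_eq (by simp)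
  have h4 : -1 ≤ ∑ i, q i * l i := by
    rw [← hq.2, ← Finset.sum_neg_distrib]
    refine Finset.sum_le_sum fun i _ => ?_
    nlinarith [hq.1 i, (abs_le.1 (hl i)).1]
  have h5 : ∑ i, l i * (Pi.single a 1 : Fin K → ℝ) i = l a := by
    simp [Pi.single_apply]
  rw [Finset.sum_congr rfl fun i _ => h1 i]
  simp only [Finset.sum_sub_distrib, Finset.sum_add_distrib, ← Finset.mul_sum, ← Finset.sum_mul,
    h5, hp.1.2]
  have h6 := mul_le_mul_of_nonneg_left h3 (show 0 ≤ 2 / (T : ℝ) by positivity)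
  have h7 := mul_le_mul_of_nonneg_left h4 (show 0 ≤ (K : ℝ) / T by positivity)
  have h8 := mul_le_mul_of_nonneg_left (abs_le.1 (hl a)).1 (show 0 ≤ (K : ℝ) / T by positivity)
  rw [show 4 * (K : ℝ) / T = 2 / T * K + K / T + K / T by ring]
  linarith

section FixedLosses

variable {K T : ℕ} {α : ℝ} {l : ℕ → Fin K → ℝ}

/-- The true regret differs from the leader's regret on the estimates, against the mixed comparator,
by terms of conditional mean at most `4 K / T`. The latter regret is bounded on every path by
`sum_estimates_sub_le`. -/
theorem pathExp_regret_le (hK : 2 ≤ K) (hT : 4 * K ≤ T) (hα : 0 < α) (hα' : α < 1)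
    (hl : ∀ t i, |l t i| ≤ 1) (i₀ a₀ : Fin K) :
    pathExp (drawKernel (spmAlgorithm K T α) l) i₀ T
        (fun a => ∑ t ∈ Finset.range T, (l t (a t) - l t a₀))
      ≤ 4 * K + lowerOrder K T α + 3 * pathExp (drawKernel (spmAlgorithm K T α) l) i₀ T
        fun a => ∑ t ∈ Finset.range T, roundGain K T α (playHistory l a) t := by
  have hK0 : 0 < K := by omega
  have hc := isDrawKernel_spmAlgorithm hK0 hT hα hα' l
  set c := drawKernel (spmAlgorithm K T α) l
  set u : Fin K → ℝ := mixUniform K T (Pi.single a₀ 1) with hu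
  have hs : (Pi.single a₀ 1 : Fin K → ℝ) ∈ stdSimplex ℝ (Fin K) := single_mem_stdSimplex ℝ a₀
  set f : ∀ t, History K t → Fin K → ℝ := fun t h i => l t i - l t a₀
    - l t i / spmAlgorithm K T α t h i * (leader K T α t h i - u i) with hf
  have h1 : ∀ t < T, pathExp c i₀ T
      (fun a => f t (prefixHistory (playHistory l a) t) (a t)) ≤ 4 * K / T := by
    intro t ht
    rw [hc.pathExp_history i₀ ht, ← hc.pathExp_const i₀ (4 * K / T : ℝ)]
    refine hc.pathExp_mono i₀ fun a => ?_
    exact sum_mul_mixUniform_le hK0 hT (isFTRLMin_ftrlMin hK0 hα hα'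
      (state_pos hK0 hT hα hα' _ _).le _).1.1 (hl t) a₀
  have h2 : ∀ a : ℕ → Fin K, ∑ t ∈ Finset.range T, (l t (a t) - l t a₀)
      ≤ ∑ t ∈ Finset.range T, f t (prefixHistory (playHistory l a) t) (a t)
        + (3 * ∑ t ∈ Finset.range T, roundGain K T α (playHistory l a) t
          + lowerOrder K T α) := by
    intro a
    have h3 := sum_estimates_sub_le hK hT hα hα' (h := playHistory l a)
      (fun t => hl t (a t)) (mixUniform_mem hK0 hT hs) (one_div_le_mixUniform hK0 hT hs) T
    simp only [hf, Finset.sum_sub_distrib, playHistory] at h3 ⊢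
    linarith
  refine (hc.pathExp_mono i₀ h2).trans ?_
  rw [pathExp_add, pathExp_add, pathExp_const_mul, hc.pathExp_const, pathExp_sum]
  have h4 : ∑ t ∈ Finset.range T, pathExp c i₀ T
      (fun a => f t (prefixHistory (playHistory l a) t) (a t)) ≤ 4 * K := by
    refine (Finset.sum_le_card_nsmul _ _ _ fun t ht => h1 t (Finset.mem_range.1 ht)).trans_eq ?_
    have : (T : ℝ) ≠ 0 := by exact_mod_cast (by omega : T ≠ 0)
    rw [Finset.card_range, nsmul_eq_mul]
    field_simp
  linarith

/-- The state and the weight `w` depend only on the past, so the draw of round `t` can be averaged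
out. The weight is `1` in the adversarial regime and the penalty in the self-bounding one. -/
theorem pathExp_roundStability (hK : 0 < K) (hT : 4 * K ≤ T) (hα : 0 < α) (hα' : α < 1)
    (i₀ : Fin K) {t : ℕ} (ht : t < T) (w : History K t → ℝ) :
    pathExp (drawKernel (spmAlgorithm K T α) l) i₀ T
        (fun a => roundStability K T α (playHistory l a) t
          * w (prefixHistory (playHistory l a) t))
      = pathExp (drawKernel (spmAlgorithm K T α) l) i₀ T fun a =>
        (∑ i, spmAlgorithm K T α t (prefixHistory (playHistory l a) t) i
          * stability α (state K T α t (prefixHistory (playHistory l a) t)).2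
            (spmAlgorithm K T α t (prefixHistory (playHistory l a) t)) i (l t i))
          * w (prefixHistory (playHistory l a) t) := by
  have hc := isDrawKernel_spmAlgorithm hK hT hα hα' l
  refine (hc.pathExp_history i₀ ht fun h i =>
    stability α (state K T α t h).2 (spmAlgorithm K T α t h) i (l t i) * w h).trans ?_
  simp only [Finset.sum_mul, mul_assoc]

theorem pathExp_roundGain_le (hK : 2 ≤ K) (hT : 4 * K ≤ T) (hα : 0 < α) (hα' : α < 1)
    (hl : ∀ t i, |l t i| ≤ 1) {S : ℕ} (hS : ∀ t, {i | l t i ≠ 0}.ncard ≤ S) (i₀ : Fin K) :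
    pathExp (drawKernel (spmAlgorithm K T α) l) i₀ T
        (fun a => ∑ t ∈ Finset.range T, roundGain K T α (playHistory l a) t)
      ≤ 12 + 12 * advRate K S T α := by
  have hK0 : 0 < K := by omega
  have hα1 : 0 < 1 - α := by linarith
  have hc := isDrawKernel_spmAlgorithm hK0 hT hα hα' l
  have hH := maxPenalty_pos hK hα hα'
  refine (hc.pathExp_mono i₀ fun a => sum_roundGain_le hK hT hα hα' (h := playHistory l a)
    (fun t => hl t (a t)) T).trans ?_
  rw [pathExp_add, hc.pathExp_const]
  refine add_le_add_right ((hc.pathExp_sqrt_le i₀ fun a => mul_nonneg (by positivity)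
    (Finset.sum_nonneg fun t _ => roundStability_nonneg hK0 hT hα hα' _ t)).trans ?_) _
  rw [pathExp_const_mul, pathExp_sum]
  have h1 : ∀ t ∈ Finset.range T, pathExp (drawKernel (spmAlgorithm K T α) l) i₀ T
      (fun a => roundStability K T α (playHistory l a) t) ≤ 72 / (1 - α) * (S : ℝ) ^ α := by
    intro t ht
    have h2 := pathExp_roundStability (l := l) hK0 hT hα hα' i₀ (Finset.mem_range.1 ht)
      fun _ => 1
    simp only [mul_one] at h2
    rw [h2, ← hc.pathExp_const i₀ (72 / (1 - α) * (S : ℝ) ^ α)]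
    exact hc.pathExp_mono i₀ fun a => sum_mul_stability_le_adv hα hα'
      (spmAlgorithm_mem hK0 hT hα hα' _ _) (hl t) (hS t)
  have h2 := Finset.sum_le_card_nsmul _ _ _ h1
  rw [Finset.card_range, nsmul_eq_mul] at h2
  rw [advRate, show (12 : ℝ) = √144 by rw [show (144 : ℝ) = 12 ^ 2 by norm_num,
    Real.sqrt_sq (by norm_num)], ← Real.sqrt_mul (by norm_num)]
  refine Real.sqrt_le_sqrt ((mul_le_mul_of_nonneg_left h2 (by positivity)).trans_eq ?_)
  rw [maxPenalty]
  field_simp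
  ring

theorem pathExp_roundGain_le_selfBounding (hK : 2 ≤ K) (hT : 4 * K ≤ T) (hα : 0 < α)
    (hα' : α < 1) (hl : ∀ t i, |l t i| ≤ 1) {S : ℕ} (hS : ∀ t, {i | l t i ≠ 0}.ncard ≤ S)
    (i₀ : Fin K) :
    pathExp (drawKernel (spmAlgorithm K T α) l) i₀ T
        (fun a => ∑ t ∈ Finset.range T, roundGain K T α (playHistory l a) t)
      ≤ 12 * ((Nat.log 2 T + 1 : ℕ) : ℝ) + √(576 * ((Nat.log 2 T + 1 : ℕ) : ℝ)
        * (((K : ℝ) - 1) ^ (1 - α) * (S : ℝ) ^ α / (α * (1 - α)))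
        * pathExp (drawKernel (spmAlgorithm K T α) l) i₀ T
          fun a => ∑ t ∈ Finset.range T, if a t = i₀ then 0 else 1) := by
  have hK0 : 0 < K := by omega
  have hα1 : 0 < 1 - α := by linarith
  have hc := isDrawKernel_spmAlgorithm hK0 hT hα hα' l
  set J := ((Nat.log 2 T + 1 : ℕ) : ℝ)
  have hJ : 0 ≤ J := Nat.cast_nonneg _
  set M := ((K : ℝ) - 1) ^ (1 - α) * (S : ℝ) ^ α / (α * (1 - α)) with hM
  refine (hc.pathExp_mono i₀ fun a => sum_roundGain_le_levels hK hT hα hα'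
    (h := playHistory l a) (fun t => hl t (a t)) T).trans ?_
  rw [pathExp_add, hc.pathExp_const]
  refine add_le_add_right ((hc.pathExp_sqrt_le i₀ fun a => mul_nonneg (by positivity)
    (Finset.sum_nonneg fun t _ => mul_nonneg (roundStability_nonneg hK0 hT hα hα' _ t)
      (roundPenalty_pos hK hT hα hα' _ t).2.le)).trans ?_) _
  rw [pathExp_const_mul, pathExp_sum, pathExp_sum]
  have h1 : ∀ t ∈ Finset.range T, pathExp (drawKernel (spmAlgorithm K T α) l) i₀ T
      (fun a => roundStability K T α (playHistory l a) t * roundPenalty K T α (playHistory l a) t)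
      ≤ 144 * M * pathExp (drawKernel (spmAlgorithm K T α) l) i₀ T
        fun a => if a t = i₀ then 0 else 1 := by
    intro t ht
    have h2 := pathExp_roundStability (l := l) hK0 hT hα hα' i₀ (Finset.mem_range.1 ht)
      fun h => penalty α (spmAlgorithm K T α t h)
    have h3 := hc.pathExp_history i₀ (Finset.mem_range.1 ht) fun _ i => if i = i₀ then 0 else 1
    simp only [roundPenalty]
    rw [h2, h3, ← pathExp_const_mul]
    refine hc.pathExp_mono i₀ fun a => ?_
    have hp := spmAlgorithm_mem hK0 hT hα hα' t (prefixHistory (playHistory l a) t)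
    refine (sum_mul_stability_mul_penalty_le hα hα' hp (hl t) (hS t) i₀).trans_eq ?_
    congr 1
    have hs := Finset.add_sum_erase Finset.univ
      (spmAlgorithm K T α t (prefixHistory (playHistory l a) t)) (Finset.mem_univ i₀)
    rw [hp.1.2] at hs
    rw [← Finset.add_sum_erase _ _ (Finset.mem_univ i₀), if_pos rfl, mul_zero, zero_add,
      ← eq_sub_of_add_eq' hs]
    refine Finset.sum_congr rfl fun i hi => ?_
    rw [if_neg (Finset.ne_of_mem_erase hi), mul_one]
  have h2 := Finset.sum_le_sum h1
  rw [← Finset.mul_sum] at h2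
  refine Real.sqrt_le_sqrt ((mul_le_mul_of_nonneg_left h2 (by positivity)).trans_eq ?_)
  ring

end FixedLosses

/-! ## Measurability of the algorithm -/

/-- The divergence of the two minimizers is the excess of the first objective at the second
minimizer. Optimality for the second objective bounds this by the variation of the difference of the
two objectives. -/
theorem sq_ftrlMin_sub_le {K : ℕ} {α γ β β' : ℝ} (hα : 0 < α) (hα' : α < 1)
    (hγ : 0 < γ) (hβ : 0 ≤ β) {L L' q q' : Fin K → ℝ}
    (hq : IsFTRLMin α γ β L q) (hq' : IsFTRLMin α γ β' L' q') (j : Fin K) :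
    (q' j - q j) ^ 2 ≤ 4 / γ * (∑ i, |L i - L' i| + |β - β'| * maxPenalty K α) := by
  have h1 := hq.objective_eq_add hα hq'.1
  have h2 := hq'.2 q hq.1
  have h3 : γ * bregLB (q' j) (q j)
      ≤ ∑ i, (β * bregTE α (q' i) (q i) + γ * bregLB (q' i) (q i)) := by
    have h4 : ∀ i, γ * bregLB (q' i) (q i)
        ≤ β * bregTE α (q' i) (q i) + γ * bregLB (q' i) (q i) := fun i =>
      le_add_of_nonneg_left (mul_nonneg hβ (bregTE_nonneg hα hα' (hq'.1.2 i) (hq.1.2 i)))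
    have h5 : ∀ i, 0 ≤ γ * bregLB (q' i) (q i) := fun i =>
      mul_nonneg hγ.le (bregLB_nonneg (hq'.1.2 i) (hq.1.2 i))
    exact (h4 j).trans (Finset.single_le_sum (f := fun i =>
      β * bregTE α (q' i) (q i) + γ * bregLB (q' i) (q i))
      (fun i _ => (h5 i).trans (h4 i)) (Finset.mem_univ j))
  have h6 : objective α γ β L q' - objective α γ β L q
      - (objective α γ β' L' q' - objective α γ β' L' q)
      = ∑ i, (L i - L' i) * (q' i - q i) + (β - β') * (penalty α q - penalty α q') := by
    simp only [objective, penalty_eq_neg_psiTE, sub_mul, mul_sub, Finset.sum_sub_distrib]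
    ring
  have h7 : ∑ i, (L i - L' i) * (q' i - q i) ≤ ∑ i, |L i - L' i| := by
    refine Finset.sum_le_sum fun i _ => (le_abs_self _).trans ?_
    rw [abs_mul]
    refine mul_le_of_le_one_right (abs_nonneg _) (abs_le.2 ⟨?_, ?_⟩)
    · linarith [hq'.1.2 i, posSimplex_le_one hq.1 i]
    · linarith [hq.1.2 i, posSimplex_le_one hq'.1 i]
  have h8 : (β - β') * (penalty α q - penalty α q') ≤ |β - β'| * maxPenalty K α := by
    refine (le_abs_self _).trans ?_
    rw [abs_mul]
    refine mul_le_mul_of_nonneg_left (abs_le.2 ⟨?_, ?_⟩) (abs_nonneg _)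
    · linarith [penalty_nonneg hα hα' hq.1, penalty_le_maxPenalty hα hα' hq'.1]
    · linarith [penalty_nonneg hα hα' hq'.1, penalty_le_maxPenalty hα hα' hq.1]
  have h9 := sq_sub_le_bregLB (hq'.1.2 j) (hq.1.2 j) (posSimplex_le_one hq'.1 j)
    (posSimplex_le_one hq.1 j)
  have h10 := mul_le_mul_of_nonneg_left h9 hγ.le
  rw [div_mul_eq_mul_div, le_div_iff₀ hγ]
  linarith

/-- The minimizer is picked by choice, so its measurability comes from continuity. The truncation
`max θ.2 0` extends it to all parameters and is invisible to the algorithm, whose learning rates are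
positive. -/
theorem continuous_ftrlMin {K : ℕ} (hK : 0 < K) {α γ : ℝ} (hα : 0 < α) (hα' : α < 1)
    (hγ : 0 < γ) :
    Continuous fun θ : (Fin K → ℝ) × ℝ => ftrlMin α γ (max θ.2 0) θ.1 := by
  refine continuous_pi fun j => continuous_iff_continuousAt.2 fun θ => ?_
  rw [ContinuousAt, tendsto_iff_dist_tendsto_zero]
  have hmin : ∀ θ : (Fin K → ℝ) × ℝ,
      IsFTRLMin α γ (max θ.2 0) θ.1 (ftrlMin α γ (max θ.2 0) θ.1) := fun θ =>
    ftrlMin_spec hK hα hα' hγ (le_max_right _ _) _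
  refine squeeze_zero (g := fun θ' : (Fin K → ℝ) × ℝ => √(4 / γ * (∑ i, |θ.1 i - θ'.1 i|
    + |max θ.2 0 - max θ'.2 0| * maxPenalty K α))) (fun _ => dist_nonneg) (fun θ' => ?_) ?_
  · rw [Real.dist_eq]
    exact Real.abs_le_sqrt (sq_ftrlMin_sub_le hα hα' hγ (le_max_right _ _) (hmin θ) (hmin θ') j)
  · have hcont : Continuous fun θ' : (Fin K → ℝ) × ℝ => √(4 / γ * (∑ i, |θ.1 i - θ'.1 i|
        + |max θ.2 0 - max θ'.2 0| * maxPenalty K α)) := by fun_prop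
    simpa using hcont.tendsto θ

theorem measurable_apply_index {Ω : Type*} [MeasurableSpace Ω] {K : ℕ} {f : Ω → Fin K → ℝ}
    {i : Ω → Fin K} (hf : Measurable f) (hi : Measurable i) :
    Measurable fun ω => f ω (i ω) := by
  have : (fun ω => f ω (i ω)) = fun ω => ∑ j, if i ω = j then f ω j else 0 := by
    funext ω
    simp
  rw [this]
  exact Finset.measurable_sum _ fun j _ => Measurable.ite (hi (measurableSet_singleton j))
    ((measurable_pi_apply j).comp hf) measurable_const

theorem measurable_lossEstimate {Ω : Type*} [MeasurableSpace Ω] {K : ℕ} {p : Ω → Fin K → ℝ}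
    {i : Ω → Fin K} {x : Ω → ℝ} (hp : Measurable p) (hi : Measurable i) (hx : Measurable x) :
    Measurable fun ω => lossEstimate (p ω) (i ω) (x ω) :=
  measurable_pi_lambda _ fun j => Measurable.ite (hi (measurableSet_singleton j))
    (hx.div ((measurable_pi_apply j).comp hp)) measurable_const

theorem measurable_stability {Ω : Type*} [MeasurableSpace Ω] {K : ℕ} {α : ℝ} {β : Ω → ℝ}
    {p : Ω → Fin K → ℝ} {i : Ω → Fin K} {x : Ω → ℝ} (hβ : Measurable β) (hp : Measurable p)
    (hi : Measurable i) (hx : Measurable x) :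
    Measurable fun ω => stability α (β ω) (p ω) (i ω) (x ω) := by
  have h1 := measurable_apply_index hp hi
  have h2 := measurable_apply_index (measurable_lossEstimate hp hi hx) hi
  unfold stability
  exact ((((h1.min (h1.const_sub 1)).pow_const _).const_mul _).mul (h2.pow_const 2)).min
    (((hβ.mul_const _).div_const _).mul (hx.pow_const 2))

theorem measurable_penalty {K : ℕ} {α : ℝ} : Measurable (penalty α : (Fin K → ℝ) → ℝ) := by
  unfold penalty
  exact ((Finset.measurable_sum _ fun i _ =>
    (measurable_pi_apply i).pow_const α).sub_const 1).const_mul _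

section Measurable

variable {K T : ℕ} {α : ℝ}

theorem measurable_samplingProb (hK : 0 < K) (hα : 0 < α) (hα' : α < 1) :
    Measurable fun θ : (Fin K → ℝ) × ℝ => samplingProb K T α (max θ.2 0) θ.1 := by
  have h := (continuous_ftrlMin hK hα hα' (show 0 < gam α by linarith [six_le_gam α])).measurable
  exact measurable_pi_lambda _ fun i =>
    (((measurable_pi_apply i).comp h).const_mul _).add_const _

theorem measurable_spmAlgorithm_of_state (hK : 0 < K) (hT : 4 * K ≤ T) (hα : 0 < α)
    (hα' : α < 1) {t : ℕ} (h : Measurable (state K T α t)) :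
    Measurable (spmAlgorithm K T α t) := by
  have := (measurable_samplingProb (T := T) hK hα hα').comp h
  convert this using 1
  funext h
  simp only [spmAlgorithm, Function.comp, max_eq_left (state_pos hK hT hα hα' t h).le]

theorem measurable_state (hK : 0 < K) (hT : 4 * K ≤ T) (hα : 0 < α) (hα' : α < 1) (t : ℕ) :
    Measurable (state K T α t) := by
  induction t with
  | zero => exact measurable_const
  | succ t ih =>
    have hinit : Measurable fun h : History K (t + 1) => (Fin.init h : History K t) :=
      measurable_pi_lambda _ fun s => measurable_pi_apply s.castSucc
    have hs := ih.comp hinit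
    have hp := (measurable_spmAlgorithm_of_state hK hT hα hα' ih).comp hinit
    have hlast : Measurable fun h : History K (t + 1) => h (Fin.last t) :=
      measurable_pi_apply _
    exact (hs.fst.add (measurable_lossEstimate hp hlast.fst hlast.snd)).prodMk
      (hs.snd.add ((measurable_stability hs.snd hp hlast.fst hlast.snd).div
        (hs.snd.mul (measurable_penalty.comp hp))))

theorem isAlgorithm_spmAlgorithm (hK : 0 < K) (hT : 4 * K ≤ T) (hα : 0 < α) (hα' : α < 1) :
    IsAlgorithm T (spmAlgorithm K T α) :=
  ⟨fun t _ h => (spmAlgorithm_mem hK hT hα hα' t h).1, fun t _ =>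
    measurable_spmAlgorithm_of_state hK hT hα hα' (measurable_state hK hT hα hα' t)⟩

end Measurable

/-! ## Expectations over the losses -/

section Expect

variable {K T : ℕ} {π : Policy K}

theorem measurable_drawProb (hπ : IsAlgorithm T π) (I : Fin T → Fin K) :
    Measurable fun l => drawProb π l I := by
  refine Finset.measurable_prod _ fun t _ => ?_
  have h1 : Measurable fun l : Fin T → Fin K → ℝ => historyBefore l I t :=
    measurable_pi_lambda _ fun s => measurable_const.prodMk
      ((measurable_pi_apply _).comp (measurable_pi_apply _))
  exact (measurable_pi_apply (I t)).comp ((hπ.measurable t t.isLt).comp h1)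

theorem drawProb_mem_Icc (hπ : IsAlgorithm T π) (l : Fin T → Fin K → ℝ) (I : Fin T → Fin K) :
    drawProb π l I ∈ Set.Icc (0 : ℝ) 1 := by
  have h := fun t : Fin T => hπ.mem_simplex t t.isLt (historyBefore l I t)
  exact ⟨Finset.prod_nonneg fun t _ => (h t).1 _, Finset.prod_le_one (fun t _ => (h t).1 _)
    fun t _ => (h t).2 ▸ Finset.single_le_sum (fun j _ => (h t).1 j) (Finset.mem_univ _)⟩

theorem integrable_sum_drawProb (hπ : IsAlgorithm T π) {μ : Measure (Fin T → Fin K → ℝ)}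
    [IsProbabilityMeasure μ] {f : (Fin T → Fin K → ℝ) → (Fin T → Fin K) → ℝ} {B : ℝ}
    (hf : ∀ I, Measurable fun l => f l I) (hB : ∀ᵐ l ∂μ, ∀ I, |f l I| ≤ B) :
    Integrable (fun l => ∑ I, drawProb π l I * f l I) μ := by
  refine integrable_finsetSum _ fun I _ => Integrable.of_bound
    ((measurable_drawProb hπ I).mul (hf I)).aestronglyMeasurable B ?_
  filter_upwards [hB] with l hl
  have h := drawProb_mem_Icc hπ l I
  rw [Real.norm_eq_abs, abs_mul, abs_of_nonneg h.1]
  exact (mul_le_of_le_one_left (abs_nonneg _) h.2).trans (hl I)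

end Expect

theorem extendLosses_abs_le {K T : ℕ} {l : Fin T → Fin K → ℝ} (hl : ∀ t i, |l t i| ≤ 1)
    (t : ℕ) (i : Fin K) : |extendLosses l t i| ≤ 1 := by
  unfold extendLosses
  split_ifs with h
  · exact hl _ i
  · simp

theorem ncard_extendLosses_le {K T S : ℕ} {l : Fin T → Fin K → ℝ}
    (hS : ∀ t, {i | l t i ≠ 0}.ncard ≤ S) (t : ℕ) : {i | extendLosses l t i ≠ 0}.ncard ≤ S := by
  unfold extendLosses
  split_ifs with h
  · exact hS _
  · simp

theorem sum_drawProb_regret {K T : ℕ} (π : Policy K) (l : Fin T → Fin K → ℝ) (i₀ a₀ : Fin K) :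
    ∑ I, drawProb π l I * ∑ t, (l t (I t) - l t a₀)
      = pathExp (drawKernel π (extendLosses l)) i₀ T fun a =>
        ∑ t ∈ Finset.range T, (extendLosses l t (a t) - extendLosses l t a₀) := by
  rw [← sum_drawProb_mul]
  refine Finset.sum_congr rfl fun I _ => ?_
  rw [Finset.sum_range]
  simp only [extendLosses_val, extendDraws_val]

theorem sum_drawProb_other {K T : ℕ} (π : Policy K) (l : Fin T → Fin K → ℝ) (i₀ : Fin K) :
    ∑ I, drawProb π l I * ∑ t, (if I t = i₀ then (0 : ℝ) else 1)
      = pathExp (drawKernel π (extendLosses l)) i₀ T fun a =>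
        ∑ t ∈ Finset.range T, if a t = i₀ then 0 else 1 := by
  rw [← sum_drawProb_mul]
  refine Finset.sum_congr rfl fun I _ => ?_
  rw [Finset.sum_range]
  simp only [extendDraws_val]

/-! ## The regret of the algorithm -/

theorem one_le_log_of_le {K T : ℕ} (hK : 4 ≤ K) (hT : 4 * K ≤ T) : 1 ≤ Real.log T := by
  have hT16 : (16 : ℝ) ≤ T := by exact_mod_cast (by omega : 16 ≤ T)
  have h1 := Real.log_le_log (by norm_num) hT16
  rw [show (16 : ℝ) = 2 ^ 4 by norm_num, Real.log_pow] at h1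
  push_cast at h1
  linarith [Real.log_two_gt_d9]

/-- Lets the lower-order terms absorb the cost `4 K` of exploration and the additive constants and
logarithms. -/
theorem le_lowerOrder {K T : ℕ} (hK : 4 ≤ K) (hT : 4 * K ≤ T) {α : ℝ} (hα : 0 < α)
    (hα' : α < 1) : 6 * K * Real.log T ≤ lowerOrder K T α := by
  have h1 := one_le_log_of_le hK hT
  have h2 := mul_nonneg (beta1_pos (show 0 < K by omega) hα').le
    (maxPenalty_pos (show 2 ≤ K by omega) hα hα').le
  rw [maxPenalty, ← mul_div_assoc] at h2
  have h3 := mul_le_mul_of_nonneg_right (six_le_gam α)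
    (show 0 ≤ (K : ℝ) * Real.log T by positivity)
  rw [lowerOrder]
  linarith

theorem lowerOrder_nonneg {K T : ℕ} (hK : 4 ≤ K) (hT : 4 * K ≤ T) {α : ℝ} (hα : 0 < α)
    (hα' : α < 1) : 0 ≤ lowerOrder K T α := by
  have := one_le_log_of_le hK hT
  exact le_trans (by positivity) (le_lowerOrder hK hT hα hα')

theorem selfBoundingRate_nonneg {K T S : ℕ} (hK : 4 ≤ K) (hT : 4 * K ≤ T) {α : ℝ}
    (hα : 0 < α) (hα' : α < 1) {δ C : ℝ} (hδ : 0 < δ) : 0 ≤ selfBoundingRate K S T α δ C := by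
  have hlog := one_le_log_of_le hK hT
  have hα1 : 0 < 1 - α := by linarith
  have hK1 : (0 : ℝ) ≤ (K : ℝ) - 1 := by
    have : (4 : ℝ) ≤ K := by exact_mod_cast hK
    linarith
  unfold selfBoundingRate
  positivity

theorem regret_spmAlgorithm_le {K T : ℕ} (hK : 4 ≤ K) (hT : 4 * K ≤ T) {α : ℝ} (hα : 0 < α)
    (hα' : α < 1) {S : ℕ} {μ : Measure (Fin T → Fin K → ℝ)} [IsProbabilityMeasure μ]
    (hμ : HasSparseLosses S μ) :
    regret (spmAlgorithm K T α) μ ≤ 36 * advRate K S T α + 4 * lowerOrder K T α := by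
  have : Nonempty (Fin K) := ⟨⟨0, by omega⟩⟩
  have hπ := isAlgorithm_spmAlgorithm (show 0 < K by omega) hT hα hα'
  have hK4 : (4 : ℝ) ≤ K := by exact_mod_cast hK
  have hlog := one_le_log_of_le hK hT
  have hlow := le_lowerOrder hK hT hα hα'
  refine ciSup_le fun a₀ => ?_
  have h1 : ∀ᵐ l ∂μ, ∑ I, drawProb (spmAlgorithm K T α) l I * ∑ t, (l t (I t) - l t a₀)
      ≤ 36 * advRate K S T α + 4 * lowerOrder K T α := by
    filter_upwards [hμ] with l hl
    rw [sum_drawProb_regret _ _ a₀]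
    have h2 := extendLosses_abs_le fun t i => (hl t).1 i
    have h3 := pathExp_regret_le (T := T) (by omega) hT hα hα' h2 a₀ a₀
    have h4 := pathExp_roundGain_le (T := T) (by omega) hT hα hα' h2
      (ncard_extendLosses_le fun t => (hl t).2) a₀
    nlinarith
  have hint : Integrable (fun l => ∑ I, drawProb (spmAlgorithm K T α) l I
      * ∑ t, (l t (I t) - l t a₀)) μ := by
    refine integrable_sum_drawProb hπ (B := T * 2) (fun I => by fun_prop) ?_
    filter_upwards [hμ] with l hl I
    refine (Finset.abs_sum_le_sum_abs _ _).trans ((Finset.sum_le_card_nsmul _ _ 2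
      fun t _ => ?_).trans_eq (by simp))
    have h5 := (hl t).1 (I t)
    have h6 := (hl t).1 a₀
    rw [abs_le] at h5 h6 ⊢
    constructor <;> linarith
  have h2 := integral_mono_ae hint (integrable_const _) h1
  rw [integral_const, probReal_univ, one_smul] at h2
  exact h2

/-! ### Random losses and the self-bounding constraint. -/

theorem integral_sqrt_le {Ω : Type*} [MeasurableSpace Ω] {μ : Measure Ω} [IsProbabilityMeasure μ]
    {f : Ω → ℝ} (hf0 : ∀ ω, 0 ≤ f ω) (hf : Integrable f μ) :
    Integrable (fun ω => √(f ω)) μ ∧ ∫ ω, √(f ω) ∂μ ≤ √(∫ ω, f ω ∂μ) := by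
  have h1 : Integrable (fun ω => √(f ω)) μ := by
    refine Integrable.mono' (hf.add (integrable_const 1))
      (Real.continuous_sqrt.comp_aestronglyMeasurable hf.aestronglyMeasurable)
      (Filter.Eventually.of_forall fun ω => ?_)
    rw [Real.norm_eq_abs, abs_of_nonneg (Real.sqrt_nonneg _)]
    have h2 := Real.sq_sqrt (hf0 ω)
    simp only [Pi.add_apply]
    nlinarith [sq_nonneg (√(f ω) - 1)]
  exact ⟨h1, Real.strictConcaveOn_sqrt.concaveOn.le_map_integral
    Real.continuous_sqrt.continuousOn isClosed_Ici
    (Filter.Eventually.of_forall hf0) hf h1⟩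

/-- The expected number of draws of arms other than `i₀`. -/
noncomputable def otherDraws {K T : ℕ} (π : Policy K) (μ : Measure (Fin T → Fin K → ℝ))
    (i₀ : Fin K) : ℝ :=
  expect π μ fun _ I => ∑ t, if I t = i₀ then 0 else 1

theorem integrable_otherDraws {K T : ℕ} {π : Policy K} (hπ : IsAlgorithm T π)
    (μ : Measure (Fin T → Fin K → ℝ)) [IsProbabilityMeasure μ] (i₀ : Fin K) :
    Integrable (fun l => ∑ I, drawProb π l I * ∑ t, (if I t = i₀ then (0 : ℝ) else 1)) μ := by
  refine integrable_sum_drawProb hπ (B := T) (fun I => measurable_const)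
    (Filter.Eventually.of_forall fun l I => ?_)
  refine (Finset.abs_sum_le_sum_abs _ _).trans ((Finset.sum_le_card_nsmul _ _ 1
      fun t _ => ?_).trans_eq (by simp))
  split_ifs <;> simp

theorem armProb_nonneg {K T : ℕ} {π : Policy K} (hπ : IsAlgorithm T π)
    (μ : Measure (Fin T → Fin K → ℝ)) (t : Fin T) (i : Fin K) : 0 ≤ armProb π μ t i :=
  integral_nonneg fun l => Finset.sum_nonneg fun I _ =>
    mul_nonneg (drawProb_mem_Icc hπ l I).1 (by beta_reduce; split_ifs <;> simp)

theorem otherDraws_eq {K T : ℕ} {π : Policy K} (hπ : IsAlgorithm T π)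
    (μ : Measure (Fin T → Fin K → ℝ)) [IsProbabilityMeasure μ] (i₀ : Fin K) :
    otherDraws π μ i₀ = ∑ t, ∑ i, (if i = i₀ then 0 else 1) * armProb π μ t i := by
  have hint : ∀ (t : Fin T) (i : Fin K), Integrable (fun l : Fin T → Fin K → ℝ =>
      ∑ I, drawProb π l I * (if I t = i then (1 : ℝ) else 0)) μ := fun t i =>
    integrable_sum_drawProb hπ (B := 1) (fun I => measurable_const)
      (Filter.Eventually.of_forall fun l I => by split_ifs <;> simp)
  simp only [otherDraws, armProb, expect, ← integral_const_mul]
  rw [Finset.sum_congr rfl fun t _ =>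
    (integral_finsetSum Finset.univ fun i _ => (hint t i).const_mul _).symm,
    ← integral_finsetSum Finset.univ fun t _ =>
      integrable_finsetSum Finset.univ fun i _ => (hint t i).const_mul _]
  congr 1
  funext l
  simp only [Finset.mul_sum]
  rw [Finset.sum_comm]
  refine Finset.sum_congr rfl fun t _ => ?_
  rw [Finset.sum_comm]
  refine Finset.sum_congr rfl fun I _ => ?_
  rw [Finset.sum_eq_single (I t)]
  · simp [mul_comm]
  · intro i _ hi
    simp [hi.symm]
  · simp

theorem gapMin_pos {K : ℕ} {Δ : Fin K → ℝ} {i : Fin K} (hi : 0 < Δ i) : 0 < gapMin Δ := by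
  have hfin : {x : ℝ | ∃ i, 0 < Δ i ∧ Δ i = x}.Finite :=
    (Set.finite_range Δ).subset (by rintro x ⟨i, _, hx⟩; exact ⟨i, hx⟩)
  have hne : {x : ℝ | ∃ i, 0 < Δ i ∧ Δ i = x}.Nonempty := ⟨Δ i, i, hi, rfl⟩
  obtain ⟨j, hj, hx⟩ := hne.csInf_mem hfin
  rw [gapMin, ← hx]
  exact hj

theorem gapMin_le {K : ℕ} {Δ : Fin K → ℝ} {i : Fin K} (hi : 0 < Δ i) : gapMin Δ ≤ Δ i :=
  by
  refine csInf_le ⟨0, ?_⟩ ⟨i, hi, rfl⟩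
  rintro _ ⟨_, hj, rfl⟩
  exact hj.le

/-- The constraint is applied to the policy itself; every arm other than `i₀` has gap at least
`gapMin Δ`. -/
theorem gapMin_mul_otherDraws_le {K T : ℕ} {π : Policy K} (hπ : IsAlgorithm T π)
    {μ : Measure (Fin T → Fin K → ℝ)} [IsProbabilityMeasure μ] {Δ : Fin K → ℝ} {C : ℝ}
    (h : SelfBounding Δ C μ) {i₀ : Fin K} (hi₀ : ∀ i ≠ i₀, 0 < Δ i) :
    gapMin Δ * otherDraws π μ i₀ ≤ regret π μ + C := by
  have h1 := h.le_regret π hπ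
  have h2 : gapMin Δ * otherDraws π μ i₀ ≤ ∑ t : Fin T, ∑ i, Δ i * armProb π μ t i := by
    rw [otherDraws_eq hπ, Finset.mul_sum]
    refine Finset.sum_le_sum fun t _ => ?_
    rw [Finset.mul_sum]
    refine Finset.sum_le_sum fun i _ => ?_
    rw [← mul_assoc]
    refine mul_le_mul_of_nonneg_right ?_ (armProb_nonneg hπ μ t i)
    split_ifs with hi
    · simpa using (h.gap_mem i).1
    · simpa using gapMin_le (hi₀ i hi)
  linarith

theorem natLog_add_one_le {K T : ℕ} (hK : 4 ≤ K) (hT : 4 * K ≤ T) :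
    ((Nat.log 2 T + 1 : ℕ) : ℝ) ≤ 3 * Real.log T := by
  have h1 := one_le_log_of_le hK hT
  have h2 := Real.natLog_le_logb T 2
  rw [Real.logb, Nat.cast_ofNat, le_div_iff₀ (by positivity)] at h2
  have h3 : (0 : ℝ) ≤ Nat.log 2 T := Nat.cast_nonneg _
  push_cast
  nlinarith [Real.log_two_gt_d9]

theorem regret_spmAlgorithm_le_otherDraws {K T : ℕ} (hK : 4 ≤ K) (hT : 4 * K ≤ T) {α : ℝ}
    (hα : 0 < α) (hα' : α < 1) {S : ℕ} {μ : Measure (Fin T → Fin K → ℝ)}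
    [IsProbabilityMeasure μ] (hμ : HasSparseLosses S μ) (i₀ : Fin K) :
    regret (spmAlgorithm K T α) μ ≤ 7 * lowerOrder K T α
      + √(125 ^ 2 * (((K : ℝ) - 1) ^ (1 - α) * (S : ℝ) ^ α / (α * (1 - α))) * Real.log T
        * otherDraws (spmAlgorithm K T α) μ i₀) := by
  have : Nonempty (Fin K) := ⟨i₀⟩
  have hπ := isAlgorithm_spmAlgorithm (show 0 < K by omega) hT hα hα'
  have hK4 : (4 : ℝ) ≤ K := by exact_mod_cast hK
  have hα1 : 0 < 1 - α := by linarith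
  have hlog := one_le_log_of_le hK hT
  have hlow := le_lowerOrder hK hT hα hα'
  have hJ := natLog_add_one_le hK hT
  set M := ((K : ℝ) - 1) ^ (1 - α) * (S : ℝ) ^ α / (α * (1 - α)) with hM
  have hM0 : 0 ≤ M := div_nonneg (mul_nonneg (Real.rpow_nonneg (by linarith) _)
    (by positivity)) (by positivity)
  set N : (Fin T → Fin K → ℝ) → ℝ := fun l =>
    ∑ I, drawProb (spmAlgorithm K T α) l I * ∑ t, (if I t = i₀ then (0 : ℝ) else 1) with hN
  have hN0 : ∀ l, 0 ≤ N l := fun l => Finset.sum_nonneg fun I _ =>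
    mul_nonneg (drawProb_mem_Icc hπ l I).1 (Finset.sum_nonneg fun t _ => by split_ifs <;> simp)
  have hNint : Integrable N μ := integrable_otherDraws hπ μ i₀
  refine ciSup_le fun a₀ => ?_
  have h1 : ∀ᵐ l ∂μ, ∑ I, drawProb (spmAlgorithm K T α) l I * ∑ t, (l t (I t) - l t a₀)
      ≤ 7 * lowerOrder K T α + √(125 ^ 2 * M * Real.log T * N l) := by
    filter_upwards [hμ] with l hl
    rw [sum_drawProb_regret _ _ i₀]
    have h2 := extendLosses_abs_le fun t i => (hl t).1 i
    have h3 := pathExp_regret_le (T := T) (by omega) hT hα hα' h2 i₀ a₀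
    have h4 := pathExp_roundGain_le_selfBounding (T := T) (by omega) hT hα hα' h2
      (ncard_extendLosses_le fun t => (hl t).2) i₀
    rw [← sum_drawProb_other, ← hM] at h4
    set J := ((Nat.log 2 T + 1 : ℕ) : ℝ)
    -- `9 * 576 * 3 = 15552 ≤ 125 ^ 2`, where the last `3` comes from `J ≤ 3 log T`.
    have h5 : 3 * √(576 * J * M * N l) ≤ √(125 ^ 2 * M * Real.log T * N l) := by
      rw [show (3 : ℝ) = √9 by rw [show (9 : ℝ) = 3 ^ 2 by norm_num,
        Real.sqrt_sq (by norm_num)], ← Real.sqrt_mul (by norm_num)]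
      refine Real.sqrt_le_sqrt ?_
      have h6 : 0 ≤ M * N l := mul_nonneg hM0 (hN0 l)
      have h7 := mul_le_mul_of_nonneg_right hJ h6
      have h8 : 0 ≤ Real.log T * (M * N l) := mul_nonneg (by linarith) h6
      linarith
    nlinarith
  obtain ⟨hs1, hs2⟩ := integral_sqrt_le (μ := μ)
    (f := fun l => 125 ^ 2 * M * Real.log T * N l)
    (fun l => mul_nonneg (by positivity) (hN0 l)) (hNint.const_mul _)
  have hint : Integrable (fun l => ∑ I, drawProb (spmAlgorithm K T α) l I
      * ∑ t, (l t (I t) - l t a₀)) μ := by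
    refine integrable_sum_drawProb hπ (B := T * 2) (fun I => by fun_prop) ?_
    filter_upwards [hμ] with l hl I
    refine (Finset.abs_sum_le_sum_abs _ _).trans ((Finset.sum_le_card_nsmul _ _ 2
      fun t _ => ?_).trans_eq (by simp))
    have h5 := (hl t).1 (I t)
    have h6 := (hl t).1 a₀
    rw [abs_le] at h5 h6 ⊢
    constructor <;> linarith
  have h2 := integral_mono_ae hint ((integrable_const _).add hs1) h1
  rw [integral_add' (integrable_const _) hs1, integral_const, probReal_univ, one_smul] at h2
  rw [integral_const_mul] at hs2
  exact h2.trans (add_le_add_right hs2 _)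

/-- The self-bounding argument: the root splits into a part with `R` and a part with `C`. By the
arithmetic-geometric mean inequality the first is at most `(R + 125 ^ 2 * Y) / 2`, and `R / 2` moves
to the left. -/
theorem le_of_le_add_sqrt_mul {R B Y C : ℝ} (hB : 0 ≤ B) (hY : 0 ≤ Y) (hC : 0 ≤ C)
    (h : R ≤ B + √(125 ^ 2 * (Y * (R + C)))) : R ≤ 2 * B + 125 ^ 2 * Y + 250 * √(C * Y) := by
  rcases le_total R 0 with hR | hR
  · have := Real.sqrt_nonneg (C * Y)
    linarith
  have h1 : √(125 ^ 2 * (Y * (R + C))) ≤ √(R * (125 ^ 2 * Y)) + 125 * √(C * Y) := by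
    have h3 := Real.sq_sqrt (mul_nonneg hR (show 0 ≤ 125 ^ 2 * Y by positivity))
    have h4 := Real.sq_sqrt (mul_nonneg hC hY)
    have h5 := Real.sqrt_nonneg (R * (125 ^ 2 * Y))
    have h6 := Real.sqrt_nonneg (C * Y)
    refine Real.sqrt_le_left (by positivity) |>.2 ?_
    nlinarith [mul_nonneg h5 h6]
  have h2 : √(R * (125 ^ 2 * Y)) ≤ (R + 125 ^ 2 * Y) / 2 := by
    refine Real.sqrt_le_left (by positivity) |>.2 ?_
    nlinarith [sq_nonneg (R - 125 ^ 2 * Y)]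
  have h3 := h.trans (add_le_add_right (h1.trans (add_le_add_left h2 _)) B)
  linarith

theorem regret_spmAlgorithm_le_selfBounding {K T : ℕ} (hK : 4 ≤ K) (hT : 4 * K ≤ T) {α : ℝ}
    (hα : 0 < α) (hα' : α < 1) {S : ℕ} {μ : Measure (Fin T → Fin K → ℝ)}
    [IsProbabilityMeasure μ] (hμ : HasSparseLosses S μ) {Δ : Fin K → ℝ} {C : ℝ}
    (h : SelfBounding Δ C μ) (hi₀ : ∃ i₀, ∀ i ≠ i₀, 0 < Δ i) :
    0 < gapMin Δ ∧ regret (spmAlgorithm K T α) μ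
      ≤ 15625 * (selfBoundingRate K S T α (gapMin Δ) C + lowerOrder K T α) := by
  obtain ⟨i₀, hi₀⟩ := hi₀
  -- A second arm is needed here: without positive gaps the infimum is over the empty set and equals
  -- `0`.
  have hδ : 0 < gapMin Δ := by
    have : Nontrivial (Fin K) := Fin.nontrivial_iff_two_le.2 (by omega)
    obtain ⟨i, hi⟩ := exists_ne i₀
    exact gapMin_pos (hi₀ i hi)
  refine ⟨hδ, ?_⟩
  have hK4 : (4 : ℝ) ≤ K := by exact_mod_cast hK
  have hα1 : 0 < 1 - α := by linarith
  have hlog := one_le_log_of_le hK hT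
  have hlow := lowerOrder_nonneg hK hT hα hα'
  have h1 := regret_spmAlgorithm_le_otherDraws hK hT hα hα' hμ i₀
  have h2 := gapMin_mul_otherDraws_le (isAlgorithm_spmAlgorithm (show 0 < K by omega) hT hα hα')
    h hi₀
  rw [selfBoundingRate, show ((K : ℝ) - 1) ^ (1 - α) * (S : ℝ) ^ α * Real.log T
    / (α * (1 - α) * gapMin Δ) = ((K : ℝ) - 1) ^ (1 - α) * (S : ℝ) ^ α / (α * (1 - α))
      * Real.log T / gapMin Δ by field_simp]
  set M := ((K : ℝ) - 1) ^ (1 - α) * (S : ℝ) ^ α / (α * (1 - α)) with hM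
  have hM0 : 0 ≤ M := div_nonneg (mul_nonneg (Real.rpow_nonneg (by linarith) _)
    (by positivity)) (by positivity)
  set Y := M * Real.log T / gapMin Δ with hY
  have hY0 : 0 ≤ Y := div_nonneg (mul_nonneg hM0 (by linarith)) hδ.le
  have h3 : 125 ^ 2 * M * Real.log T * otherDraws (spmAlgorithm K T α) μ i₀
      ≤ 125 ^ 2 * (Y * (regret (spmAlgorithm K T α) μ + C)) := by
    refine le_trans (le_of_eq ?_) (mul_le_mul_of_nonneg_left
      (mul_le_mul_of_nonneg_left h2 hY0) (by norm_num))
    rw [hY]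
    field_simp
  have h4 := le_of_le_add_sqrt_mul (by positivity) hY0 h.nonneg
    (h1.trans (add_le_add_right (Real.sqrt_le_sqrt h3) _))
  have h5 := Real.sqrt_nonneg (C * Y)
  -- The term `√M` of the rate is slack here: only its sign matters.
  have h6 := Real.sqrt_nonneg M
  linarith

/-! ## Comparison of the rates -/

/-- The left side is `o(√T)` for fixed `K` and `α`, and the right side is at least a multiple of
`√T`, uniformly in `S` because `S ^ α ≥ 1`. -/
theorem exists_lowerOrder_le_advRate {K : ℕ} {α : ℝ} (hK : 4 ≤ K) (hα : 0 < α) (hα' : α < 1) :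
    ∃ T₀ : ℕ, ∀ T S : ℕ, T₀ ≤ T → 1 ≤ S → lowerOrder K T α ≤ advRate K S T α := by
  have hα1 : 0 < 1 - α := by linarith
  have hH := maxPenalty_pos (show 2 ≤ K by omega) hα hα'
  set k := √(maxPenalty K α / (1 - α)) with hk
  have hk0 : 0 < k := Real.sqrt_pos.2 (by positivity)
  have h1 : (fun x : ℝ => gam α * K * Real.log x
      + beta1 K α * ((K : ℝ) ^ (1 - α) - 1) / α) =o[Filter.atTop] fun x : ℝ => x ^ (1 / 2 : ℝ) := by
    refine ((isLittleO_log_rpow_atTop (by norm_num)).const_mul_left _).add ?_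
    exact Asymptotics.isLittleO_const_left.2 (Or.inr
      (tendsto_norm_atTop_atTop.comp (tendsto_rpow_atTop (by norm_num))))
  obtain ⟨T₀, hT₀⟩ := Filter.eventually_atTop.1
    (tendsto_natCast_atTop_atTop.eventually (h1.bound hk0))
  refine ⟨T₀, fun T S hT hS => ?_⟩
  have h2 := hT₀ T hT
  rw [Real.norm_eq_abs, Real.norm_eq_abs, ← Real.sqrt_eq_rpow,
    abs_of_nonneg (Real.sqrt_nonneg _)] at h2
  refine (le_abs_self _).trans (h2.trans ?_)
  rw [hk, ← Real.sqrt_mul (by positivity), advRate]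
  refine Real.sqrt_le_sqrt ?_
  have hS1 : (1 : ℝ) ≤ (S : ℝ) ^ α := Real.one_le_rpow (by exact_mod_cast hS) hα.le
  have h3 : ((K : ℝ) ^ (1 - α) - 1) * (S : ℝ) ^ α * T / (α * (1 - α))
      = maxPenalty K α / (1 - α) * T * (S : ℝ) ^ α := by
    rw [maxPenalty]
    field_simp
  rw [h3]
  exact le_mul_of_one_le_right (by positivity) hS1

theorem exists_lowerOrder_le_selfBoundingRate {K : ℕ} {α : ℝ} (hK : 4 ≤ K) (hα : 0 < α)
    (hα' : α < 1) : ∃ δ₀ : ℝ, 0 < δ₀ ∧ ∀ (T S : ℕ) (δ C : ℝ), 4 * K ≤ T → 1 ≤ S → 0 < δ →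
      δ ≤ δ₀ → lowerOrder K T α ≤ selfBoundingRate K S T α δ C := by
  have hα1 : 0 < 1 - α := by linarith
  have hK4 : (4 : ℝ) ≤ K := by exact_mod_cast hK
  have hγ := six_le_gam α
  have hb := mul_pos (beta1_pos (show 0 < K by omega) hα')
    (maxPenalty_pos (show 2 ≤ K by omega) hα hα')
  rw [maxPenalty, ← mul_div_assoc] at hb
  set b := beta1 K α * ((K : ℝ) ^ (1 - α) - 1) / α with hbdef
  have hpos : 0 < gam α * K + b := by positivity
  -- Since `log T ≥ 1`, the lower-order terms are at most `(gam α * K + b) * log T`, and the leading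
  -- term is at least `log T / δ`; so one threshold works for every horizon.
  refine ⟨1 / (gam α * K + b), by positivity, fun T S δ C hT hS hδ hδ' => ?_⟩
  have hlog := one_le_log_of_le hK hT
  have h1 : lowerOrder K T α ≤ (gam α * K + b) * Real.log T := by
    rw [lowerOrder, ← hbdef]
    nlinarith
  rw [le_div_iff₀ hpos] at hδ'
  have h2 : (gam α * K + b) * Real.log T ≤ Real.log T / δ := by
    rw [le_div_iff₀ hδ]
    nlinarith
  have h3 : (1 : ℝ) ≤ ((K : ℝ) - 1) ^ (1 - α) * (S : ℝ) ^ α :=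
    one_le_mul_of_one_le_of_one_le (Real.one_le_rpow (by linarith) hα1.le)
      (Real.one_le_rpow (by exact_mod_cast hS) hα.le)
  have h4 : Real.log T / δ ≤ ((K : ℝ) - 1) ^ (1 - α) * (S : ℝ) ^ α * Real.log T
      / (α * (1 - α) * δ) := by
    refine div_le_div₀ (by positivity) (le_mul_of_one_le_left (by linarith) h3)
      (by positivity) (mul_le_of_le_one_left hδ.le ?_)
    nlinarith
  rw [selfBoundingRate]
  have h5 := Real.sqrt_nonneg (C * (((K : ℝ) - 1) ^ (1 - α) * (S : ℝ) ^ α * Real.log T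
      / (α * (1 - α) * δ)))
  have h6 := Real.sqrt_nonneg (((K : ℝ) - 1) ^ (1 - α) * (S : ℝ) ^ α / (α * (1 - α)))
  linarith

/-! ### The exponent `1 - 1 / (2 ln K)`, chosen without knowledge of the sparsity. -/

section LogArms

variable {K T : ℕ} {α : ℝ}

theorem one_le_log_arms (hK : 4 ≤ K) : 1 ≤ Real.log K := by
  have hK4 : (4 : ℝ) ≤ K := by exact_mod_cast hK
  have h1 := Real.log_le_log (by norm_num) hK4
  rw [show (4 : ℝ) = 2 ^ 2 by norm_num, Real.log_pow] at h1
  push_cast at h1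
  linarith [Real.log_two_gt_d9]

/-- For this exponent `K ^ (1 - α) = exp (1 / 2)`, so the dependence on `K` beyond `S` reduces to `1
/ (1 - α)`, a logarithm. -/
theorem logArms_bounds (hK : 4 ≤ K) (hα : α = 1 - 1 / (2 * Real.log K)) :
    1 / 2 ≤ α ∧ α < 1 ∧ 1 / (1 - α) = 2 * Real.log K ∧ (K : ℝ) ^ (1 - α) ≤ 2 := by
  have hlog := one_le_log_arms hK
  have hK0 : (0 : ℝ) < K := by exact_mod_cast (by omega : 0 < K)
  have h1 : 1 / (2 * Real.log K) ≤ 1 / 2 :=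
    one_div_le_one_div_of_le (by norm_num) (by linarith)
  have h2 : 0 < 1 / (2 * Real.log K) := by positivity
  have h3 : 1 - α = 1 / (2 * Real.log K) := by linarith
  refine ⟨by linarith, by linarith, by rw [h3, one_div_one_div], ?_⟩
  rw [h3, Real.rpow_def_of_pos hK0, show Real.log K * (1 / (2 * Real.log K)) = 1 / 2 by
    field_simp]
  have h4 : Real.exp (1 / 2) ^ 2 = Real.exp 1 := by
    rw [← Real.exp_nat_mul]
    norm_num
  nlinarith [Real.exp_one_lt_d9, Real.exp_pos (1 / 2)]

theorem lowerOrder_le_logArms (hK : 4 ≤ K) (hT : 4 * K ≤ T)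
    (hα : α = 1 - 1 / (2 * Real.log K)) :
    lowerOrder K T α ≤ 134 * (K * Real.log K * Real.log T) := by
  obtain ⟨h1, h2, h3, h4⟩ := logArms_bounds hK hα
  have hlog := one_le_log_arms hK
  have hlogT := one_le_log_of_le hK hT
  have hα1 : 0 < 1 - α := by linarith
  have hK0 : (0 : ℝ) < K := by exact_mod_cast (by omega : 0 < K)
  have h5 : gam α ≤ 102 * Real.log K := by
    refine max_le (by linarith) ?_
    have h6 : α / (1 - α) ≤ 2 * Real.log K := by
      rw [← h3]
      exact div_le_div_of_nonneg_right h2.le hα1.le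
    have h7 : √(α / (1 - α)) ≤ 2 * Real.log K := by
      refine Real.sqrt_le_left (by positivity) |>.2 (h6.trans ?_)
      nlinarith
    linarith
  have h6 : beta1 K α * ((K : ℝ) ^ (1 - α) - 1) / α ≤ 32 * (K * Real.log K) := by
    have h7 : beta1 K α = 16 * (K * Real.log K) := by
      rw [beta1, div_eq_mul_one_div, h3]
      ring
    rw [h7, div_le_iff₀ (by linarith)]
    have h8 : 0 ≤ K * Real.log K := by positivity
    nlinarith
  have h7 := mul_le_mul_of_nonneg_right h5 (show 0 ≤ K * Real.log T by positivity)
  have h8 : K * Real.log K ≤ K * Real.log K * Real.log T :=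
    le_mul_of_one_le_right (by positivity) hlogT
  rw [lowerOrder]
  linarith

theorem advRate_le_logArms (hK : 4 ≤ K) (hα : α = 1 - 1 / (2 * Real.log K)) {S : ℕ}
    (hS : 1 ≤ S) : advRate K S T α ≤ 2 * √(S * T * Real.log K) := by
  obtain ⟨h1, h2, h3, h4⟩ := logArms_bounds hK hα
  have hlog := one_le_log_arms hK
  have hα1 : 0 < 1 - α := by linarith
  have hS1 : (S : ℝ) ^ α ≤ S := by
    simpa using Real.rpow_le_rpow_of_exponent_le (x := (S : ℝ)) (by exact_mod_cast hS) h2.le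
  rw [advRate, show (2 : ℝ) = √4 by rw [show (4 : ℝ) = 2 ^ 2 by norm_num,
    Real.sqrt_sq (by norm_num)], ← Real.sqrt_mul (by norm_num)]
  refine Real.sqrt_le_sqrt ?_
  calc ((K : ℝ) ^ (1 - α) - 1) * (S : ℝ) ^ α * T / (α * (1 - α))
      = ((K : ℝ) ^ (1 - α) - 1) * ((S : ℝ) ^ α * T) * (1 / (1 - α)) / α := by field_simp
    _ ≤ 1 * (S * T) * (2 * Real.log K) / (1 / 2) := by
        rw [h3]
        refine div_le_div₀ (by positivity) (mul_le_mul_of_nonneg_right (mul_le_mul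
          (by linarith) (mul_le_mul_of_nonneg_right hS1 (by positivity)) (by positivity)
          (by norm_num)) (by positivity)) (by norm_num) h1
    _ = 4 * (S * T * Real.log K) := by ring

theorem selfBoundingRate_le_logArms (hK : 4 ≤ K) (hT : 4 * K ≤ T)
    (hα : α = 1 - 1 / (2 * Real.log K)) {S : ℕ} (hS : 1 ≤ S) (hSK : S ≤ K) {δ C : ℝ}
    (hδ : 0 < δ) (hC : 0 ≤ C) :
    selfBoundingRate K S T α δ C ≤ 8 * (S * Real.log K * Real.log T / δ)
      + 8 * √(C * (S * Real.log K * Real.log T / δ)) + 8 * (K * Real.log K * Real.log T) := by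
  obtain ⟨h1, h2, h3, h4⟩ := logArms_bounds hK hα
  have hlog := one_le_log_arms hK
  have hlogT := one_le_log_of_le hK hT
  have hα1 : 0 < 1 - α := by linarith
  have hK4 : (4 : ℝ) ≤ K := by exact_mod_cast hK
  have hS' : (1 : ℝ) ≤ S := by exact_mod_cast hS
  have hSK' : (S : ℝ) ≤ K := by exact_mod_cast hSK
  have hS1 : (S : ℝ) ^ α ≤ S := by
    simpa using Real.rpow_le_rpow_of_exponent_le (x := (S : ℝ)) hS' h2.le
  have hK1 : ((K : ℝ) - 1) ^ (1 - α) ≤ 2 :=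
    (Real.rpow_le_rpow (by linarith) (by linarith) hα1.le).trans h4
  have hM : ((K : ℝ) - 1) ^ (1 - α) * (S : ℝ) ^ α / (α * (1 - α)) ≤ 8 * (S * Real.log K) := by
    calc ((K : ℝ) - 1) ^ (1 - α) * (S : ℝ) ^ α / (α * (1 - α))
        = ((K : ℝ) - 1) ^ (1 - α) * (S : ℝ) ^ α * (1 / (1 - α)) / α := by field_simp
      _ ≤ 2 * S * (2 * Real.log K) / (1 / 2) := by
          rw [h3]
          exact div_le_div₀ (by positivity) (mul_le_mul_of_nonneg_right (mul_le_mul hK1 hS1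
            (by positivity) (by norm_num)) (by positivity)) (by norm_num) h1
      _ = 8 * (S * Real.log K) := by ring
  have hY : ((K : ℝ) - 1) ^ (1 - α) * (S : ℝ) ^ α * Real.log T / (α * (1 - α) * δ)
      ≤ 8 * (S * Real.log K * Real.log T / δ) := by
    have h5 := mul_le_mul_of_nonneg_right hM (show 0 ≤ Real.log T / δ by positivity)
    refine (le_of_eq ?_).trans (h5.trans_eq ?_)
    · field_simp
    · ring
  have h8 : √(8 : ℝ) ≤ 8 := Real.sqrt_le_left (by norm_num) |>.2 (by norm_num)
  rw [selfBoundingRate]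
  refine add_le_add (add_le_add hY ?_) ?_
  · refine (Real.sqrt_le_sqrt (mul_le_mul_of_nonneg_left hY hC)).trans ?_
    rw [mul_left_comm, Real.sqrt_mul (by norm_num)]
    exact mul_le_mul_of_nonneg_right h8 (Real.sqrt_nonneg _)
  -- A number that is at least `1` dominates its root; `S ≤ K` then places `√M` among the
  -- lower-order terms.
  · have h9 : 1 ≤ 8 * (S * Real.log K) := by nlinarith
    have h10 : S * Real.log K ≤ K * Real.log K * Real.log T :=
      (mul_le_mul_of_nonneg_right hSK' (by linarith)).trans
        (le_mul_of_one_le_right (by positivity) hlogT)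
    refine (Real.sqrt_le_left (by positivity) |>.2 (hM.trans ?_) : _ ≤ 8 * (S * Real.log K)).trans
      (by linarith)
    nlinarith

end LogArms

/-! ### The exponent `1 - 1 / ln (K / S)` for known sparsity. -/

theorem sparse_exponent_mem {K S : ℕ} {α : ℝ} (hS : 1 ≤ S) (hSK : Real.exp 2 * S ≤ K)
    (hα : α = 1 - 1 / Real.log (K / S)) : 2 ≤ Real.log (K / S) ∧ 1 / 2 ≤ α ∧ α < 1 := by
  have hS' : (0 : ℝ) < S := by exact_mod_cast hS
  have h1 : 2 ≤ Real.log (K / S) := by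
    rw [← Real.log_exp 2]
    exact Real.log_le_log (Real.exp_pos _) ((le_div_iff₀ hS').2 hSK)
  have h2 : 1 / Real.log (K / S) ≤ 1 / 2 := one_div_le_one_div_of_le (by norm_num) h1
  have h3 : 0 < 1 / Real.log (K / S) := by positivity
  exact ⟨h1, by linarith, by linarith⟩

theorem advRate_le_sparse {K T S : ℕ} {α : ℝ} (hS : 1 ≤ S) (hSK : Real.exp 2 * S ≤ K)
    (hα : α = 1 - 1 / Real.log (K / S)) :
    advRate K S T α ≤ 3 * √(S * T * Real.log (K / S)) := by
  obtain ⟨h1, h2, h3⟩ := sparse_exponent_mem hS hSK hα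
  have hS' : (0 : ℝ) < S := by exact_mod_cast hS
  have hK0 : (0 : ℝ) < K := lt_of_lt_of_le (by positivity) hSK
  have hα1 : 0 < 1 - α := by linarith
  have h4 : 1 - α = 1 / Real.log (K / S) := by linarith
  -- The left side is `S (K / S) ^ (1 - α)`, and the exponent is tuned to make the power equal to
  -- `e`.
  have h5 : (K : ℝ) ^ (1 - α) * (S : ℝ) ^ α = S * Real.exp 1 := by
    have h6 : (S : ℝ) ^ α = S / (S : ℝ) ^ (1 - α) := by
      rw [eq_div_iff (by positivity), ← Real.rpow_add hS', add_sub_cancel, Real.rpow_one]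
    rw [h6, mul_div_assoc', mul_comm, mul_div_assoc, ← Real.div_rpow hK0.le hS'.le, h4,
      Real.rpow_def_of_pos (by positivity), mul_one_div_cancel (by linarith)]
  rw [advRate, show (3 : ℝ) = √9 by rw [show (9 : ℝ) = 3 ^ 2 by norm_num,
    Real.sqrt_sq (by norm_num)], ← Real.sqrt_mul (by norm_num)]
  refine Real.sqrt_le_sqrt ?_
  have h7 : 1 / (1 - α) = Real.log (K / S) := by rw [h4, one_div_one_div]
  have h8 : ((K : ℝ) ^ (1 - α) - 1) * (S : ℝ) ^ α ≤ 3 * S := by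
    have := Real.rpow_nonneg hS'.le α
    nlinarith [Real.exp_one_lt_d9]
  calc ((K : ℝ) ^ (1 - α) - 1) * (S : ℝ) ^ α * T / (α * (1 - α))
      = ((K : ℝ) ^ (1 - α) - 1) * (S : ℝ) ^ α * (T * (1 / (1 - α))) / α := by field_simp
    _ ≤ 3 * S * (T * Real.log (K / S)) / (1 / 2) := by
        rw [h7]
        exact div_le_div₀ (by positivity) (mul_le_mul_of_nonneg_right h8 (by positivity))
          (by norm_num) h2
    _ ≤ 9 * (S * T * Real.log (K / S)) := by
        have : 0 ≤ S * T * Real.log (K / S) := by positivity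
        linarith

end SparseBandit

/-! ### Assembly of the four statements. -/

theorem mainTheorem1 :
    ∃ c : ℝ, 0 < c ∧
      -- finite-time bounds, with explicit lower-order terms
      (∀ (K T : ℕ) (α : ℝ), 4 ≤ K → 4 * K ≤ T → 0 < α → α < 1 →
        IsAlgorithm T (spmAlgorithm K T α) ∧
        ∀ (S : ℕ) (μ : Measure (Fin T → Fin K → ℝ)), IsProbabilityMeasure μ →
          1 ≤ S → S ≤ K → HasSparseLosses S μ →
          regret (spmAlgorithm K T α) μ ≤ c * (advRate K S T α + lowerOrder K T α) ∧
          ∀ (Δ : Fin K → ℝ) (C : ℝ), SelfBounding Δ C μ → (∃ i₀, ∀ i ≠ i₀, 0 < Δ i) →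
            regret (spmAlgorithm K T α) μ
              ≤ c * (selfBoundingRate K S T α (gapMin Δ) C + lowerOrder K T α)) ∧
      -- the leading terms alone, for a large horizon and a small gap, respectively
      (∀ (K : ℕ) (α : ℝ), 4 ≤ K → 0 < α → α < 1 →
        ∃ (T₀ : ℕ) (δ₀ : ℝ), 0 < δ₀ ∧
          ∀ (T S : ℕ) (μ : Measure (Fin T → Fin K → ℝ)), IsProbabilityMeasure μ →
            4 * K ≤ T → 1 ≤ S → S ≤ K → HasSparseLosses S μ →
            (T₀ ≤ T → regret (spmAlgorithm K T α) μ ≤ c * advRate K S T α) ∧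
            ∀ (Δ : Fin K → ℝ) (C : ℝ), SelfBounding Δ C μ → (∃ i₀, ∀ i ≠ i₀, 0 < Δ i) →
              gapMin Δ ≤ δ₀ →
              regret (spmAlgorithm K T α) μ ≤ c * selfBoundingRate K S T α (gapMin Δ) C) ∧
      -- `α` close to `1`, chosen without knowledge of `S`
      (∀ (K T : ℕ) (α : ℝ), 4 ≤ K → 4 * K ≤ T → α = 1 - 1 / (2 * Real.log K) →
        ∀ (S : ℕ) (μ : Measure (Fin T → Fin K → ℝ)), IsProbabilityMeasure μ →
          1 ≤ S → S ≤ K → HasSparseLosses S μ →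
          regret (spmAlgorithm K T α) μ
            ≤ c * (√(S * T * Real.log K) + K * Real.log K * Real.log T) ∧
          ∀ (Δ : Fin K → ℝ) (C : ℝ), SelfBounding Δ C μ → (∃ i₀, ∀ i ≠ i₀, 0 < Δ i) →
            regret (spmAlgorithm K T α) μ
              ≤ c * (S * Real.log K * Real.log T / gapMin Δ
                + √(C * (S * Real.log K * Real.log T / gapMin Δ))
                + K * Real.log K * Real.log T)) ∧
      -- `α` chosen with knowledge of `S`
      (∀ (K T S : ℕ) (α : ℝ), 4 ≤ K → 4 * K ≤ T → 1 ≤ S → Real.exp 2 * S ≤ K →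
        α = 1 - 1 / Real.log (K / S) →
        ∀ μ : Measure (Fin T → Fin K → ℝ), IsProbabilityMeasure μ → HasSparseLosses S μ →
          regret (spmAlgorithm K T α) μ
            ≤ c * (√(S * T * Real.log (K / S)) + lowerOrder K T α)) := by
  -- Here `31250 = 2 * 15625` covers rates that absorb the lower-order terms, and `142 = 8 + 134`
  -- covers the passage to the logarithmic form.
  refine ⟨31250 * 142, by norm_num, ?_, ?_, ?_, ?_⟩
  · intro K T α hK hT hα hα'
    refine ⟨isAlgorithm_spmAlgorithm (by omega) hT hα hα', fun S μ _ hS hSK hμ => ⟨?_, ?_⟩⟩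
    · have h1 := regret_spmAlgorithm_le hK hT hα hα' hμ
      have h2 : 0 ≤ advRate K S T α := Real.sqrt_nonneg _
      have h3 := lowerOrder_nonneg hK hT hα hα'
      linarith
    · intro Δ C h hi₀
      obtain ⟨hδ, h1⟩ := regret_spmAlgorithm_le_selfBounding hK hT hα hα' hμ h hi₀
      have h2 := selfBoundingRate_nonneg (S := S) hK hT hα hα' hδ (C := C)
      have h3 := lowerOrder_nonneg hK hT hα hα'
      linarith
  · intro K α hK hα hα'
    obtain ⟨T₀, hT₀⟩ := exists_lowerOrder_le_advRate hK hα hα'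
    obtain ⟨δ₀, hδ₀, hrate⟩ := exists_lowerOrder_le_selfBoundingRate hK hα hα'
    refine ⟨T₀, δ₀, hδ₀, fun T S μ _ hT hS hSK hμ => ⟨fun hTT => ?_, ?_⟩⟩
    · have h1 := regret_spmAlgorithm_le hK hT hα hα' hμ
      have h2 := hT₀ T S hTT hS
      have h3 : 0 ≤ advRate K S T α := Real.sqrt_nonneg _
      linarith
    · intro Δ C h hi₀ hgap
      obtain ⟨hδ, h1⟩ := regret_spmAlgorithm_le_selfBounding hK hT hα hα' hμ h hi₀
      have h2 := hrate T S (gapMin Δ) C hT hS hδ hgap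
      have h3 := selfBoundingRate_nonneg (S := S) hK hT hα hα' hδ (C := C)
      linarith
  · intro K T α hK hT hα S μ _ hS hSK hμ
    obtain ⟨hα0, hα1, _, _⟩ := logArms_bounds hK hα
    have hα0' : 0 < α := by linarith
    have hlow := lowerOrder_le_logArms hK hT hα
    have hlow0 := lowerOrder_nonneg hK hT hα0' hα1
    refine ⟨?_, ?_⟩
    · have h1 := regret_spmAlgorithm_le hK hT hα0' hα1 hμ
      have h2 := advRate_le_logArms (T := T) hK hα hS
      have h3 := Real.sqrt_nonneg (S * T * Real.log K)
      linarith
    · intro Δ C h hi₀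
      obtain ⟨hδ, h1⟩ := regret_spmAlgorithm_le_selfBounding hK hT hα0' hα1 hμ h hi₀
      have h2 := selfBoundingRate_le_logArms hK hT hα hS hSK hδ h.nonneg
      have h3 := Real.sqrt_nonneg (C * (S * Real.log K * Real.log T / gapMin Δ))
      have hlog := one_le_log_arms hK
      have hlogT := one_le_log_of_le hK hT
      have h4 : 0 ≤ S * Real.log K * Real.log T / gapMin Δ := by positivity
      linarith
  · intro K T S α hK hT hS hSK hα μ _ hμ
    obtain ⟨_, hα0, hα1⟩ := sparse_exponent_mem hS hSK hα
    have hα0' : 0 < α := by linarith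
    have h1 := regret_spmAlgorithm_le hK hT hα0' hα1 hμ
    have h2 := advRate_le_sparse (T := T) hS hSK hα
    have h3 := Real.sqrt_nonneg (S * T * Real.log (K / S))
    have h4 := lowerOrder_nonneg hK hT hα0' hα1
    linarith
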